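/- Let $K$ be an oriented virtual knot diagram, with writhe $w(K)$ (the sum of the signs of its real crossings). The index $\mathrm{Ind}(c)$ of a real crossing $c$ is defined as follows. Smooth $c$ along the orientation; this gives a two-component virtual link $K_1\cup K_2$, where $K_1$ is the component that leaves $c$ on the strand passing under at $c$ and returns to $c$ on the strand passing over. Then $\mathrm{Ind}(c)$ is the sum of the signs of the real crossings between $K_1$ and $K_2$ at which $K_1$ passes over, minus the sum of the signs of those at which $K_1$ passes under. For an integer $n\ge 0$ let $C_n(K)$ be the set of real crossings of $K$ whose index is an integer multiple of $n$. A state $S$ is a virtual link diagram obtained by applying to every crossing in $C_n(K)$ either the $0$-smoothing or the $1$-smoothing (the Kauffman smoothings with weights $A$ and $A^{-1}$); $\#_0$ and $\#_1$ are the numbers of smoothings of the two kinds. Let $F(S)$ be the (unoriented) flat virtual link obtained by replacing all remaining real crossings of $S$ by flat crossings. Define $$\mathfrak V^n_K(t)=(-A^3)^{-w(K)}\sum_S A^{\#_0-\#_1}F(S)\Big|_{A=t^{-1/4}} .$$ Here $F(S)$ is considered in the module of Laurent polynomials in $t^{1/4}$ with coefficients in the free abelian group generated by all flat virtual links (flat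 virtual link diagrams up to flat generalized Reidemeister moves), modulo the relations $L\cup O=(-A^2-A^{-2})L$ for all flat virtual links $L$, where $O$ is a circle disjoint from $L$. Theorem. For every integer $n\ge 0$, $\mathfrak V^n_K(t)$ is a virtual knot invariant: if $K$ and $K'$ are virtual knot diagrams that are related by planar isotopy and finitely many generalized Reidemeister moves, then $\mathfrak V^n_K(t)=\mathfrak V^n_{K'}(t)$, whichever orientations of $K$ and $K'$ are used. -/

import Mathlib

/-! Virtual link diagrams are drawn in the plane in general position with respect to the height
function, and are read from bottom to top: such a diagram is a list of elementary pieces, each of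
which is a minimum (`cup`), a maximum (`cap`) or a crossing, with vertical strands to the left and
to the right of it.  Planar isotopies become the moves `exchange`, `zigzag` and `swing` below. -/

open scoped LaurentPolynomial

namespace VirtualKnots

/-- The crossings of a virtual link diagram.  The two strands of a crossing are the one that rises
to the right, and the one that rises to the left. -/
inductive Crossing
  /-- A virtual crossing. -/
  | virt
  /-- A real crossing at which the strand rising to the right passes over. -/
  | slash
  /-- A real crossing at which the strand rising to the left passes over. -/
  | backslash
  deriving DecidableEq

/-- The crossings of a flat virtual link diagram. -/
inductive FlatCrossing
  /-- A virtual crossing. -/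
  | virt
  /-- A flat crossing. -/
  | flat
  deriving DecidableEq

/-- The shape of an elementary piece, `κ` being the type of the crossings allowed. -/
inductive Shape (κ : Type)
  /-- A local minimum. -/
  | cup
  /-- A local maximum. -/
  | cap
  /-- A crossing. -/
  | cross (k : κ)
  deriving DecidableEq

/-- The number of strands that enter a shape from below. -/
def Shape.ins {κ : Type} : Shape κ → ℕ
  | .cup => 0
  | .cap => 2
  | .cross _ => 2

/-- The number of strands that leave a shape at the top. -/
def Shape.outs {κ : Type} : Shape κ → ℕ
  | .cup => 2
  | .cap => 0
  | .cross _ => 2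

/-- An elementary piece: a shape with exactly `pos` vertical strands to the left of it (and any
number of vertical strands to the right of it). -/
structure Piece (κ : Type) where
  /-- What is drawn. -/
  shape : Shape κ
  /-- The number of vertical strands to the left. -/
  pos : ℕ
  deriving DecidableEq

/-- The minimum with `i` strands to the left of it. -/
abbrev cup {κ : Type} (i : ℕ) : Piece κ := ⟨.cup, i⟩

/-- The maximum with `i` strands to the left of it. -/
abbrev cap {κ : Type} (i : ℕ) : Piece κ := ⟨.cap, i⟩

/-- The crossing `k` with `i` strands to the left of it. -/
abbrev cross {κ : Type} (k : κ) (i : ℕ) : Piece κ := ⟨.cross k, i⟩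

/-- A list of pieces, stacked on top of each other from bottom to top. -/
abbrev Word (κ : Type) := List (Piece κ)

/-- `IsTangle m w n`: the pieces of `w` fit together, with `m` strands at the bottom of `w` and `n`
strands at the top. -/
def IsTangle {κ : Type} : ℕ → Word κ → ℕ → Prop
  | m, [], n => m = n
  | m, p :: w, n => p.pos + p.shape.ins ≤ m ∧ IsTangle (m - p.shape.ins + p.shape.outs) w n

/-- A word is a link diagram when its pieces fit together and no strand ends at the bottom or at
the top. -/
def IsLinkDiagram {κ : Type} (w : Word κ) : Prop := IsTangle 0 w 0

/-- The number of strands at level `h` of a link diagram, that is, just below its `h`-th piece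
(pieces are counted from `0`). -/
def width {κ : Type} (w : Word κ) (h : ℕ) : ℕ :=
  (w.take h).foldl (fun m p => m - p.shape.ins + p.shape.outs) 0

/-! ### Components and orientations -/

/-- The ends of the arcs of a piece: the `j`-th strand (from the left, counted from `0`) at the
bottom or at the top of the piece. -/
inductive End
  /-- The `j`-th strand at the bottom. -/
  | bot (j : ℕ)
  /-- The `j`-th strand at the top. -/
  | top (j : ℕ)

/-- The point of the diagram at which an end of the `h`-th piece lies.  The pair `(h, j)` stands
for the `j`-th strand at level `h`. -/
def End.point (h : ℕ) : End → ℕ × ℕ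
  | .bot j => (h, j)
  | .top j => (h + 1, j)

/-- Whether an end lies at the top. -/
def End.isTop : End → Bool
  | .bot _ => false
  | .top _ => true

/-- `p.Arc e e'`: an arc of the piece `p` runs from `e` to `e'`.  (Nothing bounds the number of
vertical strands on the right; only the pairs `(h, j)` with `j < width w h` are points of a link
diagram `w`, and no arc joins one of them to a pair that is not.) -/
inductive Piece.Arc {κ : Type} : Piece κ → End → End → Prop
  | left (p : Piece κ) (j : ℕ) (hj : j < p.pos) : Piece.Arc p (.bot j) (.top j)
  | right (p : Piece κ) (j : ℕ) :
      Piece.Arc p (.bot (p.pos + p.shape.ins + j)) (.top (p.pos + p.shape.outs + j))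
  | cup (i : ℕ) : Piece.Arc ⟨.cup, i⟩ (.top i) (.top (i + 1))
  | cap (i : ℕ) : Piece.Arc ⟨.cap, i⟩ (.bot i) (.bot (i + 1))
  | crossRight (k : κ) (i : ℕ) : Piece.Arc ⟨.cross k, i⟩ (.bot i) (.top (i + 1))
  | crossLeft (k : κ) (i : ℕ) : Piece.Arc ⟨.cross k, i⟩ (.bot (i + 1)) (.top i)

/-- The arcs of the `h`-th piece of a word. -/
def arcs {κ : Type} (w : Word κ) (h : ℕ) (e e' : End) : Prop :=
  ∃ p, w[h]? = some p ∧ p.Arc e e'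

/-- Two points lie on the same component of the curve that consists of the arcs `a h e e'` in the
various pieces `h`. -/
def SameComponent (a : ℕ → End → End → Prop) : ℕ × ℕ → ℕ × ℕ → Prop :=
  Relation.EqvGen fun x y => ∃ h e e', a h e e' ∧ x = e.point h ∧ y = e'.point h

/-- A virtual knot diagram: a virtual link diagram with exactly one component. -/
structure KnotDiagram where
  /-- The pieces of the diagram. -/
  word : Word Crossing
  isClosed : IsLinkDiagram word
  ne_nil : word ≠ []
  connected : ∀ x y : ℕ × ℕ, x.2 < width word x.1 → y.2 < width word y.1 →
    SameComponent (arcs word) x y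

/-- An orientation of a virtual knot diagram: at each point it says whether the strand through that
point is directed upwards. -/
structure KnotDiagram.Orientation (K : KnotDiagram) where
  /-- Whether the strand through a point is directed upwards. -/
  up : ℕ × ℕ → Bool
  compatible : ∀ h e e', arcs K.word h e e' →
    (up (e.point h) = up (e'.point h) ↔ e.isTop ≠ e'.isTop)

/-! ### Generalized Reidemeister moves -/

/-- A crossing turned by a quarter of a full turn. -/
def Crossing.turn : Crossing → Crossing
  | .virt => .virt
  | .slash => .backslash
  | .backslash => .slash

/-- The triangles to which a third Reidemeister move applies.  Number the three strands of the
triangle from left to right at the bottom; `a`, `b`, `c` are the crossings of the strands 1 and 2,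
of 1 and 3, and of 2 and 3. The triangle may have three virtual crossings, or two virtual ones and a
real one, or three real ones such that one strand lies above the two others, and one below them. -/
def TriangleOK (a b c : Crossing) : Prop :=
  (a = .virt ∧ b = .virt) ∨ (a = .virt ∧ c = .virt) ∨ (b = .virt ∧ c = .virt) ∨
    (a ≠ .virt ∧ b ≠ .virt ∧ c ≠ .virt ∧ ¬ (a = c ∧ a ≠ b))

/-- The local moves on virtual link diagrams.  The first five are planar isotopies, the others the
generalized Reidemeister moves: for each of the three types, the moves with real crossings, those
with virtual crossings, and for the third type also the mixed move in which an arc with two virtual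
crossings is moved across a real crossing. -/
inductive LocalMove : Word Crossing → Word Crossing → Prop
  /-- Distant pieces are moved past each other in height: `p` on the left, and `q` on the right with
  `d` vertical strands between them. -/
  | exchange (p q : Shape Crossing) (i d : ℕ) :
      LocalMove [⟨p, i⟩, ⟨q, i + p.outs + d⟩] [⟨q, i + p.ins + d⟩, ⟨p, i⟩]
  /-- A maximum cancels a minimum. -/
  | zigzag (i : ℕ) : LocalMove [cup i, cap (i + 1)] []
  | zigzag' (i : ℕ) : LocalMove [cup (i + 1), cap i] []
  /-- A minimum is moved sideways through a crossing. -/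
  | swingCup (k : Crossing) (i : ℕ) :
      LocalMove [cup i, cross k (i + 1)] [cup (i + 1), cross k.turn i]
  /-- A maximum is moved sideways through a crossing. -/
  | swingCap (k : Crossing) (i : ℕ) :
      LocalMove [cross k (i + 1), cap i] [cross k.turn i, cap (i + 1)]
  /-- First move, for a curl at a minimum. -/
  | oneCup (k : Crossing) (i : ℕ) : LocalMove [cup i, cross k i] [cup i]
  /-- First move, for a curl at a maximum. -/
  | oneCap (k : Crossing) (i : ℕ) : LocalMove [cross k i, cap i] [cap i]
  /-- Second move. -/
  | two (k : Crossing) (i : ℕ) : LocalMove [cross k i, cross k.turn i] []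
  /-- Third move. -/
  | three (a b c : Crossing) (i : ℕ) (h : TriangleOK a b c) :
      LocalMove [cross a i, cross b (i + 1), cross c i] [cross c (i + 1), cross b i, cross a (i + 1)]

/-- A local move in some part of a diagram. -/
def Move (w w' : Word Crossing) : Prop :=
  ∃ pre u v suf, LocalMove u v ∧ w = pre ++ u ++ suf ∧ w' = pre ++ v ++ suf

/-- Two virtual knot diagrams are equivalent, i.e. represent the same virtual knot, when they are
connected by a finite sequence of moves and inverse moves. -/
def KnotDiagram.Equivalent : KnotDiagram → KnotDiagram → Prop :=
  Relation.EqvGen fun K K' => Move K.word K'.word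

/-! ### Flat virtual links -/

/-- Replace a real crossing by a flat crossing. -/
def Crossing.flatten : Crossing → FlatCrossing
  | .virt => .virt
  | .slash => .flat
  | .backslash => .flat

/-- Replace the real crossing of a shape by a flat one. -/
def Shape.flatten : Shape Crossing → Shape FlatCrossing
  | .cup => .cup
  | .cap => .cap
  | .cross k => .cross k.flatten

/-- Replace all real crossings of a diagram by flat crossings. -/
def flatten (w : Word Crossing) : Word FlatCrossing := w.map fun p => ⟨p.shape.flatten, p.pos⟩

/-- The flat moves: the above moves with all real crossings replaced by flat crossings. -/
def FlatMove (x y : Word FlatCrossing) : Prop :=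
  ∃ w w', Move w w' ∧ flatten w = x ∧ flatten w' = y

/-- A (nonempty, unoriented) flat virtual link diagram. -/
structure FlatDiagram where
  /-- The pieces of the diagram. -/
  word : Word FlatCrossing
  isClosed : IsLinkDiagram word
  ne_nil : word ≠ []

/-- Flat virtual links: flat virtual link diagrams up to the equivalence relation generated by the
flat moves. -/
def FlatLink : Type := Quot fun D E : FlatDiagram => FlatMove D.word E.word

/-! ### Writhe and chord index -/

/-- Whether the `c`-th piece of `w` is a real crossing. -/
def IsReal (w : Word Crossing) (c : ℕ) : Prop :=
  ∃ i, w[c]? = some (cross .slash i) ∨ w[c]? = some (cross .backslash i)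

/-- The sign of the real crossing `c` of an oriented diagram (`0` if the `c`-th piece is not a real
crossing).  It is `1` at the crossing `slash` with both strands directed upwards. -/
def sign (w : Word Crossing) (up : ℕ × ℕ → Bool) (c : ℕ) : ℤ :=
  match w[c]? with
  | some ⟨.cross .slash, i⟩ => if up (c, i) = up (c, i + 1) then 1 else -1
  | some ⟨.cross .backslash, i⟩ => if up (c, i) = up (c, i + 1) then -1 else 1
  | _ => 0

/-- The writhe of an oriented diagram: the sum of the signs of its real crossings. -/
def writhe (w : Word Crossing) (up : ℕ × ℕ → Bool) : ℤ :=
  ∑ c ∈ Finset.range w.length, sign w up c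

/-- The point just below the crossing `c` on the strand that passes over. -/
def overPoint (w : Word Crossing) (c : ℕ) : ℕ × ℕ :=
  match w[c]? with
  | some ⟨.cross .slash, i⟩ => (c, i)
  | some ⟨.cross _, i⟩ => (c, i + 1)
  | _ => (c, 0)

/-- The point just below the crossing `c` on the strand that passes under. -/
def underPoint (w : Word Crossing) (c : ℕ) : ℕ × ℕ :=
  match w[c]? with
  | some ⟨.cross .slash, i⟩ => (c, i + 1)
  | some ⟨.cross _, i⟩ => (c, i)
  | _ => (c, 0)

/-- The point just above the crossing `c` on the strand that passes under. -/
def underPointAbove (w : Word Crossing) (c : ℕ) : ℕ × ℕ :=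
  match w[c]? with
  | some ⟨.cross .slash, i⟩ => (c + 1, i)
  | some ⟨.cross _, i⟩ => (c + 1, i + 1)
  | _ => (c, 0)

/-- The point at which the strand that passes under at the crossing `c` leaves `c`. -/
def underOut (w : Word Crossing) (up : ℕ × ℕ → Bool) (c : ℕ) : ℕ × ℕ :=
  if up (underPoint w c) then underPointAbove w c else underPoint w c

/-- The arcs of a crossing with `i` strands to the left, after it is smoothed along the orientation:
two vertical arcs if the strands are parallel, otherwise a maximum below a minimum. -/
inductive SmoothedArc (parallel : Bool) (i : ℕ) : End → End → Prop
  | vertical (j : ℕ) (h : parallel = true ∨ (j ≠ i ∧ j ≠ i + 1)) :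
      SmoothedArc parallel i (.bot j) (.top j)
  | below (h : parallel = false) : SmoothedArc parallel i (.bot i) (.bot (i + 1))
  | above (h : parallel = false) : SmoothedArc parallel i (.top i) (.top (i + 1))

/-- The arcs of the two-component link that results when the crossing `c` of an oriented diagram is
smoothed along the orientation. -/
def smoothedArcs (w : Word Crossing) (up : ℕ × ℕ → Bool) (c : ℕ) (h : ℕ) (e e' : End) : Prop :=
  if h = c then ∃ p, w[c]? = some p ∧ SmoothedArc (up (c, p.pos) == up (c, p.pos + 1)) p.pos e e'
  else arcs w h e e'

/-- The component `K₁` of the link that results when `c` is smoothed along the orientation: the one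
that leaves `c` on the strand passing under, and comes back to `c` on the strand passing over. -/
def firstComponent (w : Word Crossing) (up : ℕ × ℕ → Bool) (c : ℕ) : Set (ℕ × ℕ) :=
  {x | SameComponent (smoothedArcs w up c) (underOut w up c) x}

open Classical in
/-- The index of the real crossing `c`: let `K₁ ∪ K₂` be the link that results when `c` is smoothed
along the orientation; the index is the over linking number (the sum of the signs of the real
crossings at which `K₁` passes over `K₂`) minus the under linking number (the sum of the signs of
the real crossings at which `K₁` passes under `K₂`). -/
noncomputable def chordIndex (w : Word Crossing) (up : ℕ × ℕ → Bool) (c : ℕ) : ℤ :=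
  (∑ d ∈ (Finset.range w.length).filter fun d => IsReal w d ∧ d ≠ c ∧
      overPoint w d ∈ firstComponent w up c ∧ underPoint w d ∉ firstComponent w up c, sign w up d) -
  ∑ d ∈ (Finset.range w.length).filter fun d => IsReal w d ∧ d ≠ c ∧
      underPoint w d ∈ firstComponent w up c ∧ overPoint w d ∉ firstComponent w up c, sign w up d

open Classical in
/-- The set `Cₙ` of the real crossings whose index is an integer multiple of `n`. -/
noncomputable def indexedCrossings (n : ℕ) (w : Word Crossing) (up : ℕ × ℕ → Bool) : Finset ℕ :=
  (Finset.range w.length).filter fun c => IsReal w c ∧ (n : ℤ) ∣ chordIndex w up c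

/-! ### States -/

/-- What a piece is replaced by: nothing changes for `none`, while `some true` (`some false`) tells
to apply the `0`-smoothing (the `1`-smoothing) to a real crossing. The `0`-smoothing joins the two
regions that are swept out when the upper strand is turned counterclockwise. -/
def Piece.resolve (p : Piece Crossing) (s : Option Bool) : Word Crossing :=
  match p.shape, s with
  | .cross .slash, some true => []
  | .cross .slash, some false => [cap p.pos, cup p.pos]
  | .cross .backslash, some true => [cap p.pos, cup p.pos]
  | .cross .backslash, some false => []
  | _, _ => [p]

/-- Apply to each piece of a diagram the resolution that `s` prescribes. -/
def resolve : Word Crossing → (ℕ → Option Bool) → Word Crossing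
  | [], _ => []
  | p :: w, s => p.resolve (s 0) ++ resolve w fun h => s (h + 1)

theorem isTangle_append {κ : Type} (u v : Word κ) (m n : ℕ) :
    IsTangle m (u ++ v) n ↔ ∃ k, IsTangle m u k ∧ IsTangle k v n := by
  induction u generalizing m with
  | nil => simp [IsTangle]
  | cons p u ih => simp [IsTangle, ih, and_assoc]

theorem isTangle_resolve (w : Word Crossing) (s : ℕ → Option Bool) (m n : ℕ)
    (hw : IsTangle m w n) : IsTangle m (resolve w s) n := by
  induction w generalizing m s with
  | nil => exact hw
  | cons p w ih =>
    obtain ⟨h1, h2⟩ := hw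
    refine (isTangle_append _ _ _ _).2 ⟨_, ?_, ih _ _ h2⟩
    obtain ⟨sh, i⟩ := p
    rcases sh with _ | _ | (_ | _ | _) <;> rcases s 0 with _ | _ | _ <;>
      simp_all [Piece.resolve, IsTangle, Shape.ins, Shape.outs] <;> omega

theorem isTangle_flatten (w : Word Crossing) (m n : ℕ) (hw : IsTangle m w n) :
    IsTangle m (flatten w) n := by
  induction w generalizing m with
  | nil => exact hw
  | cons p w ih =>
    obtain ⟨h1, h2⟩ := hw
    have e1 : p.shape.flatten.ins = p.shape.ins := by cases p.shape <;> rfl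
    have e2 : p.shape.flatten.outs = p.shape.outs := by cases p.shape <;> rfl
    refine ⟨?_, ?_⟩
    · simpa [e1] using h1
    · simpa [e1, e2, flatten] using ih _ h2

theorem flatten_resolve_ne_nil (w : Word Crossing) (s : ℕ → Option Bool) (hw : IsLinkDiagram w)
    (hn : w ≠ []) : flatten (resolve w s) ≠ [] := by
  cases w with
  | nil => exact absurd rfl hn
  | cons p w =>
    obtain ⟨h1, -⟩ := hw
    obtain ⟨sh, i⟩ := p
    rcases sh with _ | _ | _
    · simp [resolve, Piece.resolve, flatten]
    · simp [Shape.ins] at h1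
    · simp [Shape.ins] at h1

/-- The flat virtual link diagram `F(S)` of the state `S` that `s` prescribes. -/
def KnotDiagram.flatState (K : KnotDiagram) (s : ℕ → Option Bool) : FlatDiagram where
  word := flatten (resolve K.word s)
  isClosed := isTangle_flatten _ _ _ (isTangle_resolve _ _ _ _ K.isClosed)
  ne_nil := flatten_resolve_ne_nil _ _ K.isClosed K.ne_nil

/-! ### The polynomial -/

/-- The variable `A = t ^ (-1/4)`. The variable of the Laurent polynomials here is `t ^ (1/4)`. -/
noncomputable def A : ℤ[T;T⁻¹]ˣ where
  val := LaurentPolynomial.T (-1)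
  inv := LaurentPolynomial.T 1
  val_inv := by rw [← LaurentPolynomial.T_add]; simp
  inv_val := by rw [← LaurentPolynomial.T_add]; simp

/-- The Laurent polynomials in `t ^ (1/4)` with coefficients in the free abelian group generated by
all flat virtual links. -/
abbrev FVLPolynomial : Type := FlatLink →₀ ℤ[T;T⁻¹]

/-- The flat virtual link diagram `D'` is the union of `D` and a circle disjoint from `D`. -/
def AddsCircle (D D' : FlatDiagram) : Prop :=
  ∃ pre suf i, D.word = pre ++ suf ∧ D'.word = pre ++ [cup i, cap i] ++ suf

/-- The relations `D ∪ O = (- A ^ 2 - A ^ (-2)) D`, for a circle `O` that is disjoint from `D`. -/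
noncomputable def circleRelations : Submodule ℤ[T;T⁻¹] FVLPolynomial :=
  Submodule.span ℤ[T;T⁻¹] {x | ∃ D D' : FlatDiagram, AddsCircle D D' ∧
    x = Finsupp.single (Quot.mk _ D') 1 - Finsupp.single (Quot.mk _ D)
      (-((A ^ 2 : ℤ[T;T⁻¹]ˣ) : ℤ[T;T⁻¹]) - ((A ^ (-2 : ℤ) : ℤ[T;T⁻¹]ˣ) : ℤ[T;T⁻¹]))}

/-- The values of the polynomial: Laurent polynomials with coefficients in the free abelian group
generated by all flat virtual links, in which a disjoint circle is replaced by `- A ^ 2 - A ^ (-2)`.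
-/
abbrev Value : Type := FVLPolynomial ⧸ circleRelations

/-- The class in `Value` of a flat virtual link diagram. -/
noncomputable def FlatDiagram.value (D : FlatDiagram) : Value :=
  circleRelations.mkQ (Finsupp.single (Quot.mk _ D) 1)

open Classical in
/-- The graphical indexed Jones polynomial
`(- A ^ 3) ^ (- w(K)) * ∑ S, A ^ (#₀ - #₁) * F(S)` with `A = t ^ (-1/4)`. The states `S` result from
smoothing all crossings in `Cₙ`; they correspond to the sets `Z` of those crossings of `Cₙ` to which
the `0`-smoothing is applied. -/
noncomputable def graphicalJones (n : ℕ) (K : KnotDiagram) (o : K.Orientation) : Value :=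
  (((-A ^ 3) ^ (-writhe K.word o.up) : ℤ[T;T⁻¹]ˣ) : ℤ[T;T⁻¹]) •
    ∑ Z ∈ (indexedCrossings n K.word o.up).powerset,
      ((A ^ ((Z.card : ℤ) - ((indexedCrossings n K.word o.up \ Z).card : ℤ)) : ℤ[T;T⁻¹]ˣ) :
          ℤ[T;T⁻¹]) •
        (K.flatState fun h =>
          if h ∈ indexedCrossings n K.word o.up then some (decide (h ∈ Z)) else none).value

end VirtualKnots

set_option linter.unusedSimpArgs false

/-! Membership in `indexedCrossings` is a global condition; the proof makes it local by colouring
strands. Along the orientation, let an integer label rise by one wherever another strand crosses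
from right to left at a real crossing, and fall by one wherever another strand crosses from left to
right; virtual crossings are ignored. The two jumps at a crossing cancel, so the jumps along a whole
knot add up to zero and a labelling exists (`exists_pointColors`).

At a real crossing the label of the overstrand jumps by the sign of the crossing and that of the
understrand by minus the sign. Adding the jumps along `K₁` therefore gives the chord index, as
self-crossings of `K₁` contribute nothing. But the sum of these jumps is also the difference of the
labels with which `K₁` ends and begins at `c`, and up to sign this is the `gap` of the two colours
at `c` (`chordIndex_eq_gap`).

With the choice of smoothed crossings now readable from local colours, the invariant is the value of
a product over the pieces, taken in the algebra of flat words (`stateSum_eq_sum`). A move does not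
change the colours on its boundary, hence does not change the marks outside it, and only the inside
has to be compared. At a curl the gap is `0`, so a real curl is always smoothed, and the factor `-A
^ (±3)` is cancelled by the writhe. The two crossings of a second move have opposite gaps, so both
are smoothed or neither is. In a third move with real crossings the gap of the outer two strands is
the sum of the other two gaps; divisibility by `n` of two gaps implies that of the third, so none,
one or three crossings are smoothed. None smoothed is a flat third move, one smoothed is a turn-back
sliding past a flat strand (`eqv_three_first`, `eqv_three_middle`, `eqv_three_last`), and three
smoothed is Kauffman's bracket computation (`eqv_three_marked`).

Finally every colouring computes the invariant for every orientation (`Colors.graphicalJones_eq`): a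
colouring carries an orientation of its own, a knot has only two, and reversal merely negates the
gaps. Colourings can thus be transported along a chain of moves without orienting the intermediate
diagrams separately. -/

namespace VirtualKnots

/-! ### The algebra of words of flat pieces -/

/-- Formal linear combinations of words of flat pieces; the product stacks words. -/
abbrev WordAlgebra : Type := MonoidAlgebra ℤ[T;T⁻¹] (FreeMonoid (Piece FlatCrossing))

/-- A word as an element of the algebra of words. -/
noncomputable def wordElt (w : Word FlatCrossing) : WordAlgebra :=
  MonoidAlgebra.single (FreeMonoid.ofList w) 1

theorem wordElt_append (u v : Word FlatCrossing) :
    wordElt (u ++ v) = wordElt u * wordElt v := by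
  simp [wordElt, MonoidAlgebra.single_mul_single]

theorem wordElt_nil : wordElt [] = 1 := by
  simp [wordElt, MonoidAlgebra.one_def]

open Classical in
/-- The value of a word, which is `0` unless the word is a nonempty link diagram. -/
noncomputable def wordValue (w : Word FlatCrossing) : Value :=
  if h : IsLinkDiagram w ∧ w ≠ [] then FlatDiagram.value ⟨w, h.1, h.2⟩ else 0

/-- The linear extension of `wordValue`. -/
noncomputable def evalWord : WordAlgebra →ₗ[ℤ[T;T⁻¹]] Value where
  toFun x := Finsupp.linearCombination ℤ[T;T⁻¹] (fun w => wordValue (FreeMonoid.toList w)) x.coeff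
  map_add' x y := by simp
  map_smul' r x := by simp

theorem evalWord_wordElt (w : Word FlatCrossing) : evalWord (wordElt w) = wordValue w := by
  simp [evalWord, wordElt]

/-- The value of an element in a context. -/
noncomputable def evalIn (pre suf : Word FlatCrossing) : WordAlgebra →ₗ[ℤ[T;T⁻¹]] Value :=
  evalWord ∘ₗ (LinearMap.mulRight ℤ[T;T⁻¹] (wordElt suf)) ∘ₗ
    (LinearMap.mulLeft ℤ[T;T⁻¹] (wordElt pre))

theorem evalIn_apply (pre suf : Word FlatCrossing) (x : WordAlgebra) :
    evalIn pre suf x = evalWord (wordElt pre * x * wordElt suf) := rfl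

theorem evalIn_wordElt (pre suf w : Word FlatCrossing) :
    evalIn pre suf (wordElt w) = wordValue (pre ++ w ++ suf) := by
  rw [evalIn_apply, ← wordElt_append, ← wordElt_append, evalWord_wordElt]

/-- Two elements that have the same value in each context with `m` strands at the bottom. -/
def Eqv (m : ℕ) (x y : WordAlgebra) : Prop :=
  ∀ pre suf, IsTangle 0 pre m → evalIn pre suf x = evalIn pre suf y

theorem Eqv.refl (m : ℕ) (x : WordAlgebra) : Eqv m x x := fun _ _ _ => rfl

theorem Eqv.symm {m : ℕ} {x y : WordAlgebra} (h : Eqv m x y) : Eqv m y x :=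
  fun pre suf hp => (h pre suf hp).symm

theorem Eqv.trans {m : ℕ} {x y z : WordAlgebra} (h : Eqv m x y) (h' : Eqv m y z) : Eqv m x z :=
  fun pre suf hp => (h pre suf hp).trans (h' pre suf hp)

theorem Eqv.smul {m : ℕ} {x y : WordAlgebra} (r : ℤ[T;T⁻¹]) (h : Eqv m x y) :
    Eqv m (r • x) (r • y) :=
  fun pre suf hp => by rw [map_smul, map_smul, h pre suf hp]

theorem Eqv.add {m : ℕ} {x y x' y' : WordAlgebra} (h : Eqv m x y) (h' : Eqv m x' y') :
    Eqv m (x + x') (y + y') :=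
  fun pre suf hp => by rw [map_add, map_add, h pre suf hp, h' pre suf hp]

theorem wordElt_induction {motive : WordAlgebra → Prop} (x : WordAlgebra) (zero : motive 0)
    (add : ∀ x y, motive x → motive y → motive (x + y))
    (smul : ∀ (r : ℤ[T;T⁻¹]) w, motive (r • wordElt w)) : motive x := by
  induction x using MonoidAlgebra.induction_linear with
  | zero => exact zero
  | add x y hx hy => exact add x y hx hy
  | single w r => simpa [wordElt] using smul r (FreeMonoid.toList w)

theorem Eqv.mul_right {m : ℕ} {x y : WordAlgebra} (h : Eqv m x y) (z : WordAlgebra) :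
    Eqv m (x * z) (y * z) := by
  induction z using wordElt_induction with
  | zero => simpa using Eqv.refl m 0
  | add z z' hz hz' => simpa [mul_add] using hz.add hz'
  | smul r w =>
    rw [mul_smul_comm, mul_smul_comm]
    refine Eqv.smul r fun pre suf hp => ?_
    have := h pre (w ++ suf) hp
    simpa only [evalIn_apply, wordElt_append, mul_assoc] using this

theorem isTangle_unique {κ : Type} {w : Word κ} {m n n' : ℕ} (h : IsTangle m w n)
    (h' : IsTangle m w n') : n = n' := by
  induction w generalizing m with
  | nil => exact Eq.trans (Eq.symm h) h'
  | cons p w ih => exact ih h.2 h'.2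

/-- The combinations of words with `m` strands at the bottom and `n` strands at the top. -/
noncomputable def tangles (m n : ℕ) : Submodule ℤ[T;T⁻¹] WordAlgebra :=
  Submodule.span _ (wordElt '' {w | IsTangle m w n})

theorem wordElt_mem_tangles {m n : ℕ} {w : Word FlatCrossing} (h : IsTangle m w n) :
    wordElt w ∈ tangles m n := Submodule.subset_span ⟨w, h, rfl⟩

/-- A left factor is absorbed into the lower part of the context, whose number of strands is
prescribed; so it has to be a combination of tangles from `k` to `m`. Right factors need no such
condition, because `Eqv` leaves the upper part of the context free. -/
theorem Eqv.mul_left {k m : ℕ} {x y z : WordAlgebra} (h : Eqv m x y) (hz : z ∈ tangles k m) :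
    Eqv k (z * x) (z * y) := by
  induction hz using Submodule.span_induction with
  | mem z hz =>
    obtain ⟨w, hw, rfl⟩ := hz
    intro pre suf hp
    have := h (pre ++ w) suf ((isTangle_append _ _ _ _).2 ⟨k, hp, hw⟩)
    simpa only [evalIn_apply, wordElt_append, mul_assoc] using this
  | zero => simpa using Eqv.refl k 0
  | add z z' _ _ hz hz' => simpa [add_mul] using hz.add hz'
  | smul r z _ hz => simpa using hz.smul r

theorem mul_mem_tangles {k m n : ℕ} {x y : WordAlgebra} (hx : x ∈ tangles k m)
    (hy : y ∈ tangles m n) : x * y ∈ tangles k n := by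
  have := Submodule.mul_mem_mul hx hy
  rw [tangles, tangles, Submodule.span_mul_span] at this
  refine Submodule.span_mono ?_ this
  rintro _ ⟨_, ⟨u, hu, rfl⟩, _, ⟨v, hv, rfl⟩, rfl⟩
  exact ⟨u ++ v, (isTangle_append _ _ _ _).2 ⟨m, hu, hv⟩, wordElt_append u v⟩

theorem Eqv.evalWord_eq {x y : WordAlgebra} (h : Eqv 0 x y) : evalWord x = evalWord y := by
  simpa [evalIn_apply, wordElt_nil] using h [] [] rfl

/-! ### Flat moves in the algebra -/

theorem flatten_append (u v : Word Crossing) : flatten (u ++ v) = flatten u ++ flatten v :=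
  List.map_append

theorem flatten_surjective : Function.Surjective flatten := by
  refine List.map_surjective_iff.2 ?_
  rintro ⟨_ | _ | _ | _, i⟩
  · exact ⟨cup i, rfl⟩
  · exact ⟨cap i, rfl⟩
  · exact ⟨cross .virt i, rfl⟩
  · exact ⟨cross .slash i, rfl⟩

theorem LocalMove.isTangle {u v : Word Crossing} (h : LocalMove u v) {m n : ℕ}
    (hu : IsTangle m u n) : IsTangle m v n := by
  cases h <;> simp only [IsTangle, Shape.ins, Shape.outs] at hu ⊢ <;> omega

/-- Flat diagrams have to be nonempty. The moves that produce the empty word act on strands that are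
already there, so none of them applies to `0` strands. -/
theorem LocalMove.ne_nil {u v : Word Crossing} (h : LocalMove u v) {n : ℕ}
    (hu : IsTangle 0 u n) : u ≠ [] ∧ v ≠ [] := by
  cases h <;> simp [IsTangle, Shape.ins, Shape.outs] at hu ⊢

theorem LocalMove.eqv {u v : Word Crossing} (h : LocalMove u v) {m n : ℕ}
    (hu : IsTangle m u n) : Eqv m (wordElt (flatten u)) (wordElt (flatten v)) := by
  intro pre suf hp
  rw [evalIn_wordElt, evalIn_wordElt]
  have tu := isTangle_flatten _ _ _ hu
  have tv := isTangle_flatten _ _ _ (h.isTangle hu)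
  -- Tangles with the same numbers of ends are interchangeable in a link diagram, so the two words
  -- with this context are both closed or both have value `0`.
  have key : ∀ x y : Word FlatCrossing, IsTangle m x n → IsTangle m y n →
      IsLinkDiagram (pre ++ x ++ suf) → IsLinkDiagram (pre ++ y ++ suf) := by
    intro x y hx hy hl
    obtain ⟨n', h1, h2⟩ := (isTangle_append _ _ _ _).1 hl
    obtain ⟨m', h3, h4⟩ := (isTangle_append _ _ _ _).1 h1
    obtain rfl := isTangle_unique hp h3
    obtain rfl := isTangle_unique hx h4
    exact (isTangle_append _ _ _ _).2 ⟨n, (isTangle_append _ _ _ _).2 ⟨m, hp, hy⟩, h2⟩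
  have hne : pre ++ flatten u ++ suf ≠ [] ∧ pre ++ flatten v ++ suf ≠ [] := by
    cases pre with
    | cons p pre => simp
    | nil =>
      obtain rfl : 0 = m := hp
      have := h.ne_nil hu
      simp [flatten, this.1, this.2]
  by_cases hl : IsLinkDiagram (pre ++ flatten u ++ suf)
  · have hl' := key _ _ tu tv hl
    rw [wordValue, wordValue, dif_pos ⟨hl, hne.1⟩, dif_pos ⟨hl', hne.2⟩, FlatDiagram.value,
      FlatDiagram.value]
    congr 2
    refine Quot.sound ?_
    -- Flat moves are by definition flattened moves, so the flat context is lifted to one with real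
    -- crossings.
    obtain ⟨pre, rfl⟩ := flatten_surjective pre
    obtain ⟨suf, rfl⟩ := flatten_surjective suf
    exact ⟨pre ++ u ++ suf, pre ++ v ++ suf, ⟨pre, u, v, suf, h, rfl, rfl⟩,
      by simp only [flatten_append], by simp only [flatten_append]⟩
  · have hl' := fun x => hl (key _ _ tv tu x)
    rw [wordValue, wordValue, dif_neg fun x => hl x.1, dif_neg fun x => hl' x.1]

/-- The Laurent polynomial `A`. -/
noncomputable abbrev varA : ℤ[T;T⁻¹] := (A : ℤ[T;T⁻¹]ˣ)

/-- The Laurent polynomial `A⁻¹`. -/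
noncomputable abbrev varB : ℤ[T;T⁻¹] := (A⁻¹ : ℤ[T;T⁻¹]ˣ)

theorem varA_mul_varB : varA * varB = 1 := by simp [varA, varB]

/-- The condition on `u` guarantees that there are `i` strands to the left of the circle; otherwise
adding it could destroy a valid diagram. -/
theorem wordValue_circle (u v : Word FlatCrossing) (i : ℕ) (h : u ++ v ≠ [])
    (hu : ∀ m, IsTangle 0 u m → i ≤ m) :
    wordValue (u ++ [cup i, cap i] ++ v) = (- varA ^ 2 - varB ^ 2) • wordValue (u ++ v) := by
  have hiff : IsLinkDiagram (u ++ [cup i, cap i] ++ v) ↔ IsLinkDiagram (u ++ v) := by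
    simp only [IsLinkDiagram, isTangle_append]
    constructor
    · rintro ⟨k, ⟨l, h1, h2⟩, h3⟩
      have : l = k := by simpa [IsTangle, Shape.ins, Shape.outs] using h2.2.2
      exact ⟨k, this ▸ h1, h3⟩
    · rintro ⟨k, h1, h2⟩
      have := hu _ h1
      refine ⟨k, ⟨k, h1, ?_⟩, h2⟩
      simp [IsTangle, Shape.ins, Shape.outs]; omega
  by_cases hl : IsLinkDiagram (u ++ v)
  · have hl' := hiff.2 hl
    rw [wordValue, wordValue, dif_pos ⟨hl', by simp⟩, dif_pos ⟨hl, h⟩, FlatDiagram.value,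
      FlatDiagram.value, ← map_smul, ← sub_eq_zero, ← map_sub]
    refine (Submodule.Quotient.mk_eq_zero _).2 (Submodule.subset_span ?_)
    refine ⟨⟨u ++ v, hl, h⟩, ⟨u ++ [cup i, cap i] ++ v, hl', by simp⟩, ⟨u, v, i, rfl, rfl⟩, ?_⟩
    have hδ : (- varA ^ 2 - varB ^ 2) * 1 =
        -((A ^ 2 : ℤ[T;T⁻¹]ˣ) : ℤ[T;T⁻¹]) - ((A ^ (-2 : ℤ) : ℤ[T;T⁻¹]ˣ) : ℤ[T;T⁻¹]) := by
      rw [mul_one, zpow_neg, ← inv_zpow, zpow_ofNat, Units.val_pow_eq_pow_val,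
        Units.val_pow_eq_pow_val]
    exact congrArg₂ _ rfl ((Finsupp.smul_single _ _ _).trans (congrArg _ hδ))
  · have hl' := fun x => hl (hiff.1 x)
    rw [wordValue, wordValue, dif_neg fun x => hl' x.1, dif_neg fun x => hl x.1, smul_zero]

theorem eqv_cup_circle {m i : ℕ} (h : i ≤ m) :
    Eqv m (wordElt [cup i, cap i, cup i]) ((- varA ^ 2 - varB ^ 2) • wordElt [cup i]) := by
  intro pre suf hp
  rw [map_smul, evalIn_wordElt, evalIn_wordElt]
  have := wordValue_circle pre (cup i :: suf) i (by simp)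
    (fun m' h' => by rw [← isTangle_unique hp h']; exact h)
  simpa using this

theorem eqv_cap_circle {m i : ℕ} (h : i + 2 ≤ m) :
    Eqv m (wordElt [cap i, cup i, cap i]) ((- varA ^ 2 - varB ^ 2) • wordElt [cap i]) := by
  intro pre suf hp
  rw [map_smul, evalIn_wordElt, evalIn_wordElt]
  have := wordValue_circle (pre ++ [cap i]) suf i (by simp) (fun m' h' => by
    obtain ⟨k, h1, h2⟩ := (isTangle_append _ _ _ _).1 h'
    obtain rfl := isTangle_unique hp h1
    simp [IsTangle, Shape.ins, Shape.outs] at h2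
    omega)
  simpa using this

/-! ### Smoothed pieces and local moves in the algebra of words -/

/-- The contribution of a piece to the state sum; a marked crossing is smoothed in both ways. -/
noncomputable def pieceElt (p : Piece Crossing) (marked : Bool) : WordAlgebra :=
  if marked then
    varA • wordElt (flatten (p.resolve (some true))) +
      varB • wordElt (flatten (p.resolve (some false)))
  else wordElt (flatten (p.resolve none))

/-- The weight of the smoothing of a real crossing into two vertical strands. -/
noncomputable def Crossing.weight : Crossing → ℤ[T;T⁻¹]
  | .backslash => varB
  | _ => varA

theorem Crossing.turn_turn (k : Crossing) : k.turn.turn = k := by cases k <;> rfl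

theorem Crossing.flatten_turn (k : Crossing) : k.turn.flatten = k.flatten := by cases k <;> rfl

theorem Crossing.turn_eq_virt (k : Crossing) : k.turn = .virt ↔ k = .virt := by
  cases k <;> simp [Crossing.turn]

theorem Crossing.weight_mul {k : Crossing} (h : k ≠ .virt) :
    k.weight * k.turn.weight = 1 := by
  cases k with
  | virt => exact absurd rfl h
  | slash => exact varA_mul_varB
  | backslash => exact (mul_comm _ _).trans varA_mul_varB

/-- The value of a circle is symmetric in `A` and `A⁻¹`, so both types of real crossing can be
treated by one computation in the two weights. -/
theorem Crossing.circle_eq {k : Crossing} (h : k ≠ .virt) :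
    - varA ^ 2 - varB ^ 2 = - k.weight ^ 2 - k.turn.weight ^ 2 := by
  cases k with
  | virt => exact absurd rfl h
  | slash => rfl
  | backslash => simp only [Crossing.weight, Crossing.turn]; ring

theorem pieceElt_false (p : Piece Crossing) : pieceElt p false = wordElt (flatten [p]) := by
  obtain ⟨_ | _ | _ | _ | _, i⟩ := p <;> rfl

theorem pieceElt_true {k : Crossing} (h : k ≠ .virt) (i : ℕ) :
    pieceElt (cross k i) true =
      k.weight • wordElt [] + k.turn.weight • wordElt [cap i, cup i] := by
  cases k with
  | virt => exact absurd rfl h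
  | slash => simp [pieceElt, Piece.resolve, flatten, Crossing.weight, Crossing.turn, Shape.flatten]
  | backslash =>
    simp [pieceElt, Piece.resolve, flatten, Crossing.weight, Crossing.turn, Shape.flatten, add_comm]

theorem pieceElt_mem_tangles {p : Piece Crossing} (b : Bool) {m n : ℕ} (h : IsTangle m [p] n) :
    pieceElt p b ∈ tangles m n := by
  have key : ∀ s, wordElt (flatten (p.resolve s)) ∈ tangles m n := fun s => by
    have := isTangle_flatten _ _ _ (isTangle_resolve _ (fun _ => s) _ _ h)
    simp only [resolve, List.append_nil] at this
    exact wordElt_mem_tangles this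
  unfold pieceElt
  split
  · exact add_mem (Submodule.smul_mem _ _ (key _)) (Submodule.smul_mem _ _ (key _))
  · exact key _

theorem LocalMove.eqv_within {u v : Word Crossing} (h : LocalMove u v) (a b : Word Crossing)
    {m n : ℕ} (hu : IsTangle m (a ++ u ++ b) n) :
    Eqv m (wordElt (flatten (a ++ u ++ b))) (wordElt (flatten (a ++ v ++ b))) := by
  obtain ⟨k, h1, h2⟩ := (isTangle_append _ _ _ _).1 hu
  obtain ⟨l, h3, h4⟩ := (isTangle_append _ _ _ _).1 h1
  simp only [flatten_append, wordElt_append]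
  exact ((h.eqv h4).mul_left (wordElt_mem_tangles (isTangle_flatten _ _ _ h3))).mul_right _

/-! ### Temperley–Lieb relations, and turn-backs passing flat strands. -/

theorem eqv_cap_cup_circle {m i : ℕ} (h : i + 2 ≤ m) :
    Eqv m (wordElt [cap i, cup i, cap i, cup i])
      ((- varA ^ 2 - varB ^ 2) • wordElt [cap i, cup i]) := by
  have := (eqv_cap_circle h).mul_right (wordElt [cup i])
  rwa [smul_mul_assoc, ← wordElt_append, ← wordElt_append] at this

/-- This is `E₁E₂E₁ = E₁` in the Temperley–Lieb algebra: the strand between the outermost maximum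
and minimum contains two zigzags, which are straightened one after the other. -/
theorem eqv_zigzag {m i : ℕ} (h : i + 3 ≤ m) :
    Eqv m (wordElt [cap i, cup i, cap (i + 1), cup (i + 1), cap i, cup i])
      (wordElt [cap i, cup i]) := by
  have h1 := (LocalMove.zigzag i).eqv_within [cap i] [cup (i + 1), cap i, cup i] (m := m) (n := m)
    (by simp only [List.cons_append, List.nil_append, IsTangle, Shape.ins, Shape.outs]; omega)
  have h2 := (LocalMove.zigzag' i).eqv_within [cap i] [cup i] (m := m) (n := m)
    (by simp only [List.cons_append, List.nil_append, IsTangle, Shape.ins, Shape.outs]; omega)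
  exact h1.trans h2

theorem eqv_zigzag' {m i : ℕ} (h : i + 3 ≤ m) :
    Eqv m (wordElt [cap (i + 1), cup (i + 1), cap i, cup i, cap (i + 1), cup (i + 1)])
      (wordElt [cap (i + 1), cup (i + 1)]) := by
  have h1 := (LocalMove.zigzag' i).eqv_within [cap (i + 1)] [cup i, cap (i + 1), cup (i + 1)]
    (m := m) (n := m)
    (by simp only [List.cons_append, List.nil_append, IsTangle, Shape.ins, Shape.outs]; omega)
  have h2 := (LocalMove.zigzag i).eqv_within [cap (i + 1)] [cup (i + 1)] (m := m) (n := m)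
    (by simp only [List.cons_append, List.nil_append, IsTangle, Shape.ins, Shape.outs]; omega)
  exact h1.trans h2

theorem eqv_cancel {m i : ℕ} (k : Crossing) (h : i + 2 ≤ m) :
    Eqv m (wordElt [cross k.flatten i, cross k.flatten i]) (wordElt []) := by
  have h1 := (LocalMove.two k i).eqv_within [] [] (m := m) (n := m)
    (by simp only [List.cons_append, List.nil_append, IsTangle, Shape.ins, Shape.outs]; omega)
  simpa [flatten, Shape.flatten, Crossing.flatten_turn] using h1

/-- Swinging the minimum on one side, or the maximum on the other, makes the two crossings
consecutive and they cancel. Both sides reduce to `[cap i, cup (i + 1)]`. -/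
theorem eqv_slide_first {m i : ℕ} (k : Crossing) (h : i + 3 ≤ m) :
    Eqv m (wordElt [cap i, cup i, cross k.flatten (i + 1), cross k.flatten i])
      (wordElt [cross k.flatten (i + 1), cross k.flatten i, cap (i + 1), cup (i + 1)]) := by
  have h1 := (LocalMove.swingCup k i).eqv_within [cap i] [cross k i] (m := m) (n := m)
    (by simp only [List.cons_append, List.nil_append, IsTangle, Shape.ins, Shape.outs]; omega)
  have h2 := (LocalMove.two k i).eqv_within [cap i, cup (i + 1)] [] (m := m) (n := m)
    (by simp only [List.cons_append, List.nil_append, IsTangle, Shape.ins, Shape.outs]; omega)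
  have h3 := (LocalMove.swingCap k i).eqv_within [cross k (i + 1)] [cup (i + 1)] (m := m) (n := m)
    (by simp only [List.cons_append, List.nil_append, IsTangle, Shape.ins, Shape.outs]; omega)
  have h4 := (LocalMove.two k (i + 1)).eqv_within [] [cap i, cup (i + 1)] (m := m) (n := m)
    (by simp only [List.cons_append, List.nil_append, IsTangle, Shape.ins, Shape.outs]; omega)
  simp only [flatten, List.cons_append, List.nil_append, List.map, Shape.flatten,
    Crossing.flatten_turn] at h1 h2 h3 h4
  exact h1.trans (h2.trans (h4.symm.trans h3))

theorem eqv_slide_last {m i : ℕ} (k : Crossing) (h : i + 3 ≤ m) :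
    Eqv m (wordElt [cross k.flatten i, cross k.flatten (i + 1), cap i, cup i])
      (wordElt [cap (i + 1), cup (i + 1), cross k.flatten i, cross k.flatten (i + 1)]) := by
  have h1 := (LocalMove.swingCap k i).eqv_within [cross k i] [cup i] (m := m) (n := m)
    (by simp only [List.cons_append, List.nil_append, IsTangle, Shape.ins, Shape.outs]; omega)
  have h2 := (LocalMove.two k i).eqv_within [] [cap (i + 1), cup i] (m := m) (n := m)
    (by simp only [List.cons_append, List.nil_append, IsTangle, Shape.ins, Shape.outs]; omega)
  have h3 := (LocalMove.swingCup k i).eqv_within [cap (i + 1)] [cross k (i + 1)] (m := m) (n := m)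
    (by simp only [List.cons_append, List.nil_append, IsTangle, Shape.ins, Shape.outs]; omega)
  have h4 := (LocalMove.two k (i + 1)).eqv_within [cap (i + 1), cup i] [] (m := m) (n := m)
    (by simp only [List.cons_append, List.nil_append, IsTangle, Shape.ins, Shape.outs]; omega)
  simp only [flatten, List.cons_append, List.nil_append, List.map, Shape.flatten,
    Crossing.flatten_turn] at h1 h2 h3 h4
  exact h1.trans (h2.trans (h4.symm.trans h3))

/-- Here no crossing disappears: the maximum swings through the lower crossing and the minimum
through the upper one. -/
theorem eqv_slide_middle {m i : ℕ} (k : Crossing) (h : i + 3 ≤ m) :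
    Eqv m (wordElt [cross k.flatten i, cap (i + 1), cup (i + 1), cross k.flatten i])
      (wordElt [cross k.flatten (i + 1), cap i, cup i, cross k.flatten (i + 1)]) := by
  have h1 := (LocalMove.swingCap k i).eqv_within [] [cup i, cross k (i + 1)] (m := m) (n := m)
    (by simp only [List.cons_append, List.nil_append, IsTangle, Shape.ins, Shape.outs]; omega)
  have h2 := (LocalMove.swingCup k i).eqv_within [cross k.turn i, cap (i + 1)] [] (m := m) (n := m)
    (by simp only [List.cons_append, List.nil_append, IsTangle, Shape.ins, Shape.outs]; omega)
  simp only [flatten, List.cons_append, List.nil_append, List.map, Shape.flatten,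
    Crossing.flatten_turn] at h1 h2
  exact (h1.trans h2).symm

/-- Expands a product of linear combinations of words, evaluated in a context. -/
theorem eqv_of_evalIn {m : ℕ} {x y : WordAlgebra}
    (h : ∀ L : WordAlgebra →ₗ[ℤ[T;T⁻¹]] Value, (∀ x y, Eqv m x y → L x = L y) → L x = L y) :
    Eqv m x y := fun pre suf hp => h _ fun _ _ h => h pre suf hp

/-- If both crossings are smoothed, let `x` and `y` be the weights, with `xy = 1`, let `E` be the
turn-back, and use `E² = (-x² - y²)E`. Then `(x + yE)(y + xE) = 1 + (x² + y² - x² - y²)E = 1`. -/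
theorem eqv_two {m i : ℕ} (k : Crossing) (b : Bool) (hb : b = true → k ≠ .virt) (h : i + 2 ≤ m) :
    Eqv m (pieceElt (cross k i) b * pieceElt (cross k.turn i) b) (wordElt []) := by
  cases b with
  | false =>
    rw [pieceElt_false, pieceElt_false, ← wordElt_append]
    simpa [flatten, Shape.flatten, Crossing.flatten_turn] using eqv_cancel k h
  | true =>
    have hk := hb rfl
    have hk' : k.turn ≠ .virt := by rwa [ne_eq, Crossing.turn_eq_virt]
    have hw := Crossing.weight_mul hk
    rw [pieceElt_true hk, pieceElt_true hk', Crossing.turn_turn]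
    refine eqv_of_evalIn fun L hL => ?_
    have h1 := hL _ _ (eqv_cap_cup_circle h)
    simp only [mul_add, add_mul, smul_mul_assoc, mul_smul_comm, ← wordElt_append,
      List.cons_append, List.nil_append, map_add, map_smul, List.append_nil] at h1 ⊢
    rw [h1, Crossing.circle_eq hk]
    generalize k.weight = x at *
    generalize k.turn.weight = y at *
    match_scalars
    · linear_combination hw
    · linear_combination (-x ^ 2 - y ^ 2) * hw

/-- The vertical smoothing leaves the minimum, the other one adds a circle; the total factor is `x +
y(-x² - y²) = -y³` because `xy = 1`. -/
theorem eqv_curl_cup {m i : ℕ} {k : Crossing} (hk : k ≠ .virt) (h : i ≤ m) :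
    Eqv m (wordElt [cup i] * pieceElt (cross k i) true)
      ((-k.turn.weight ^ 3) • wordElt [cup i]) := by
  have hw := Crossing.weight_mul hk
  rw [pieceElt_true hk]
  refine eqv_of_evalIn fun L hL => ?_
  have h1 := hL _ _ (eqv_cup_circle h)
  simp only [mul_add, add_mul, smul_mul_assoc, mul_smul_comm, ← wordElt_append,
    List.cons_append, List.nil_append, map_add, map_smul, List.append_nil] at h1 ⊢
  rw [h1, Crossing.circle_eq hk]
  generalize k.weight = x at *
  generalize k.turn.weight = y at *
  match_scalars
  linear_combination (-x) * hw

theorem eqv_curl_cap {m i : ℕ} {k : Crossing} (hk : k ≠ .virt) (h : i + 2 ≤ m) :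
    Eqv m (pieceElt (cross k i) true * wordElt [cap i])
      ((-k.turn.weight ^ 3) • wordElt [cap i]) := by
  have hw := Crossing.weight_mul hk
  rw [pieceElt_true hk]
  refine eqv_of_evalIn fun L hL => ?_
  have h1 := hL _ _ (eqv_cap_circle h)
  simp only [mul_add, add_mul, smul_mul_assoc, mul_smul_comm, ← wordElt_append,
    List.cons_append, List.nil_append, map_add, map_smul, List.append_nil] at h1 ⊢
  rw [h1, Crossing.circle_eq hk]
  generalize k.weight = x at *
  generalize k.turn.weight = y at *
  match_scalars
  linear_combination (-x) * hw

/-- For a smoothed crossing, the quarter turn interchanges the two smoothings along with their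
weights. On each side one smoothing is a bare minimum and the other becomes one after a zigzag is
straightened, so the two sums have the same terms in opposite order. -/
theorem eqv_swing_cup {m i : ℕ} (k : Crossing) (b : Bool) (hb : b = true → k ≠ .virt)
    (h : i + 1 ≤ m) :
    Eqv m (wordElt [cup i] * pieceElt (cross k (i + 1)) b)
      (wordElt [cup (i + 1)] * pieceElt (cross k.turn i) b) := by
  cases b with
  | false =>
    rw [pieceElt_false, pieceElt_false, ← wordElt_append, ← wordElt_append]
    exact (LocalMove.swingCup k i).eqv (m := m) (n := m + 2)
      (by simp only [IsTangle, Shape.ins, Shape.outs]; omega)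
  | true =>
    have hk := hb rfl
    have hk' : k.turn ≠ .virt := by rwa [ne_eq, Crossing.turn_eq_virt]
    rw [pieceElt_true hk, pieceElt_true hk', Crossing.turn_turn]
    refine eqv_of_evalIn fun L hL => ?_
    have h1 := hL _ _ ((LocalMove.zigzag i).eqv_within [] [cup (i + 1)] (m := m) (n := m + 2)
      (by simp only [List.cons_append, List.nil_append, IsTangle, Shape.ins, Shape.outs]; omega))
    have h2 := hL _ _ ((LocalMove.zigzag' i).eqv_within [] [cup i] (m := m) (n := m + 2)
      (by simp only [List.cons_append, List.nil_append, IsTangle, Shape.ins, Shape.outs]; omega))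
    simp only [flatten, List.map, Shape.flatten, mul_add, add_mul, smul_mul_assoc, mul_smul_comm,
      ← wordElt_append, List.cons_append, List.nil_append, map_add, map_smul,
      List.append_nil] at h1 h2 ⊢
    rw [h1, h2, add_comm]

theorem eqv_swing_cap {m i : ℕ} (k : Crossing) (b : Bool) (hb : b = true → k ≠ .virt)
    (h : i + 3 ≤ m) :
    Eqv m (pieceElt (cross k (i + 1)) b * wordElt [cap i])
      (pieceElt (cross k.turn i) b * wordElt [cap (i + 1)]) := by
  cases b with
  | false =>
    rw [pieceElt_false, pieceElt_false, ← wordElt_append, ← wordElt_append]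
    exact (LocalMove.swingCap k i).eqv (m := m) (n := m - 2)
      (by simp only [IsTangle, Shape.ins, Shape.outs]; omega)
  | true =>
    have hk := hb rfl
    have hk' : k.turn ≠ .virt := by rwa [ne_eq, Crossing.turn_eq_virt]
    rw [pieceElt_true hk, pieceElt_true hk', Crossing.turn_turn]
    refine eqv_of_evalIn fun L hL => ?_
    have h1 := hL _ _ ((LocalMove.zigzag i).eqv_within [cap i] [] (m := m) (n := m - 2)
      (by simp only [List.cons_append, List.nil_append, IsTangle, Shape.ins, Shape.outs]; omega))
    have h2 := hL _ _ ((LocalMove.zigzag' i).eqv_within [cap (i + 1)] [] (m := m) (n := m - 2)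
      (by simp only [List.cons_append, List.nil_append, IsTangle, Shape.ins, Shape.outs]; omega))
    simp only [flatten, List.map, Shape.flatten, mul_add, add_mul, smul_mul_assoc, mul_smul_comm,
      ← wordElt_append, List.cons_append, List.nil_append, map_add, map_smul,
      List.append_nil] at h1 h2 ⊢
    rw [h1, h2, add_comm]

/-- The vertical smoothings of the two sides are the same word, and the turn-backs are related by
`eqv_slide_first`. -/
theorem eqv_three_first {m i : ℕ} {a : Crossing} (k : Crossing) (ha : a ≠ .virt) (h : i + 3 ≤ m) :
    Eqv m (pieceElt (cross a i) true * wordElt [cross k.flatten (i + 1), cross k.flatten i])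
      (wordElt [cross k.flatten (i + 1), cross k.flatten i] *
        pieceElt (cross a (i + 1)) true) := by
  rw [pieceElt_true ha, pieceElt_true ha]
  refine eqv_of_evalIn fun L hL => ?_
  have h1 := hL _ _ (eqv_slide_first k h)
  simp only [mul_add, add_mul, smul_mul_assoc, mul_smul_comm, ← wordElt_append,
    List.cons_append, List.nil_append, map_add, map_smul, List.append_nil, h1]

theorem eqv_three_last {m i : ℕ} {a : Crossing} (k : Crossing) (ha : a ≠ .virt) (h : i + 3 ≤ m) :
    Eqv m (wordElt [cross k.flatten i, cross k.flatten (i + 1)] * pieceElt (cross a i) true)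
      (pieceElt (cross a (i + 1)) true *
        wordElt [cross k.flatten i, cross k.flatten (i + 1)]) := by
  rw [pieceElt_true ha, pieceElt_true ha]
  refine eqv_of_evalIn fun L hL => ?_
  have h1 := hL _ _ (eqv_slide_last k h)
  simp only [mul_add, add_mul, smul_mul_assoc, mul_smul_comm, ← wordElt_append,
    List.cons_append, List.nil_append, map_add, map_smul, List.append_nil, h1]

/-- In contrast to the outer crossings, the vertical smoothing of the middle one leaves two
consecutive flat crossings at different places on the two sides; each pair cancels. -/
theorem eqv_three_middle {m i : ℕ} {a : Crossing} (k : Crossing) (ha : a ≠ .virt) (h : i + 3 ≤ m) :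
    Eqv m (wordElt [cross k.flatten i] * pieceElt (cross a (i + 1)) true *
        wordElt [cross k.flatten i])
      (wordElt [cross k.flatten (i + 1)] * pieceElt (cross a i) true *
        wordElt [cross k.flatten (i + 1)]) := by
  rw [pieceElt_true ha, pieceElt_true ha]
  refine eqv_of_evalIn fun L hL => ?_
  have h1 := hL _ _ (eqv_slide_middle k h)
  have h2 := hL _ _ (eqv_cancel (i := i) k (by omega : i + 2 ≤ m))
  have h3 := hL _ _ (eqv_cancel (i := i + 1) k (by omega : i + 1 + 2 ≤ m))
  simp only [mul_add, add_mul, smul_mul_assoc, mul_smul_comm, ← wordElt_append,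
    List.cons_append, List.nil_append, map_add, map_smul, List.append_nil, h1, h2, h3]

/-- Kauffman's computation in the Temperley–Lieb algebra on three strands. After `E₁² = δE₁`, `E₂² =
δE₂`, `E₁E₂E₁ = E₁` and `E₂E₁E₂ = E₂` both sides are combinations of `1`, `E₁`, `E₂`, `E₁E₂`,
`E₂E₁`. Only the coefficients of `E₁` and `E₂` need the value of `δ`; they agree because the middle
crossing has the type of one of the outer ones and its weights multiply to `1`. -/
theorem eqv_three_marked {m i : ℕ} {a b c : Crossing} (ha : a ≠ .virt) (hb : b ≠ .virt)
    (hc : c ≠ .virt) (habc : a = b ∨ b = c) (h : i + 3 ≤ m) :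
    Eqv m (pieceElt (cross a i) true * pieceElt (cross b (i + 1)) true *
        pieceElt (cross c i) true)
      (pieceElt (cross c (i + 1)) true * pieceElt (cross b i) true *
        pieceElt (cross a (i + 1)) true) := by
  have hw := Crossing.weight_mul hb
  rw [pieceElt_true ha, pieceElt_true hb, pieceElt_true hc, pieceElt_true ha, pieceElt_true hb,
    pieceElt_true hc]
  refine eqv_of_evalIn fun L hL => ?_
  have h1 := hL _ _ (eqv_cap_cup_circle (i := i) (by omega : i + 2 ≤ m))
  have h2 := hL _ _ (eqv_cap_cup_circle (i := i + 1) (by omega : i + 1 + 2 ≤ m))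
  have h3 := hL _ _ (eqv_zigzag h)
  have h4 := hL _ _ (eqv_zigzag' h)
  simp only [mul_add, add_mul, smul_mul_assoc, mul_smul_comm, ← wordElt_append,
    List.cons_append, List.nil_append, map_add, map_smul, List.append_nil] at h1 h2 h3 h4 ⊢
  rw [h1, h2, h3, h4, Crossing.circle_eq hb]
  rcases habc with rfl | rfl
  · generalize a.weight = x at *
    generalize a.turn.weight = y at *
    generalize c.weight = z at *
    generalize c.turn.weight = t at *
    match_scalars
    · ring
    · linear_combination (-x ^ 2 * t - t * y ^ 2) * hw
    · linear_combination (x ^ 2 * t + t * y ^ 2) * hw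
    · ring
    · ring
  · generalize b.weight = x at *
    generalize b.turn.weight = y at *
    generalize a.weight = z at *
    generalize a.turn.weight = t at *
    match_scalars
    · ring
    · linear_combination (-x ^ 2 * t - t * y ^ 2) * hw
    · linear_combination (x ^ 2 * t + t * y ^ 2) * hw
    · ring
    · ring

/-- A smoothed `q` is a combination of the empty word and a maximum followed by a minimum, and these
extrema move past `p` one at a time. -/
theorem eqv_exchange_word {m i d : ℕ} (p q : Shape Crossing) (b : Bool)
    (hb : b = true → ∃ k, q = .cross k ∧ k ≠ .virt) (h : i + p.ins + d + q.ins ≤ m) :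
    Eqv m (wordElt (flatten [⟨p, i⟩]) * pieceElt ⟨q, i + p.outs + d⟩ b)
      (pieceElt ⟨q, i + p.ins + d⟩ b * wordElt (flatten [⟨p, i⟩])) := by
  cases b with
  | false =>
    rw [pieceElt_false, pieceElt_false, ← wordElt_append, ← wordElt_append, ← flatten_append,
      ← flatten_append]
    exact (LocalMove.exchange p q i d).eqv (m := m) (n := m - p.ins + p.outs - q.ins + q.outs)
      (by simp only [IsTangle, and_true]; omega)
  | true =>
    obtain ⟨k, rfl, hk⟩ := hb rfl
    simp only [Shape.ins] at h
    have h1 := (LocalMove.exchange p .cap i d).eqv_within [] [cup (i + p.outs + d)]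
      (m := m) (n := m - p.ins + p.outs - 2 + 2)
      (by simp only [List.cons_append, List.nil_append, IsTangle, Shape.ins, Shape.outs]; omega)
    have h2 := (LocalMove.exchange p .cup i d).eqv_within [cap (i + p.ins + d)] []
      (m := m) (n := m - 2 - p.ins + p.outs + 2)
      (by simp only [List.cons_append, List.nil_append, IsTangle, Shape.ins, Shape.outs]; omega)
    have h3 := h1.trans h2
    have e : pieceElt ⟨.cross k, i + p.outs + d⟩ true = _ := pieceElt_true hk _
    have e' : pieceElt ⟨.cross k, i + p.ins + d⟩ true = _ := pieceElt_true hk _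
    rw [e, e']
    simp only [mul_add, add_mul, smul_mul_assoc, mul_smul_comm, ← wordElt_append, List.append_nil,
      List.nil_append]
    exact ((Eqv.refl _ _).smul _).add (h3.smul _)

/-- A smoothed `p` is expanded in the same way; `q`, smoothed or not, then passes its minimum and
its maximum in turn. Between these two extrema only `m - 2` strands remain. -/
theorem eqv_exchange {m i d : ℕ} (p q : Shape Crossing) (a b : Bool)
    (ha : a = true → ∃ k, p = .cross k ∧ k ≠ .virt)
    (hb : b = true → ∃ k, q = .cross k ∧ k ≠ .virt) (h : i + p.ins + d + q.ins ≤ m) :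
    Eqv m (pieceElt ⟨p, i⟩ a * pieceElt ⟨q, i + p.outs + d⟩ b)
      (pieceElt ⟨q, i + p.ins + d⟩ b * pieceElt ⟨p, i⟩ a) := by
  cases a with
  | false => rw [pieceElt_false]; exact eqv_exchange_word p q b hb h
  | true =>
    obtain ⟨k, rfl, hk⟩ := ha rfl
    simp only [Shape.ins, Shape.outs] at h ⊢
    have e : pieceElt ⟨.cross k, i⟩ true = _ := pieceElt_true hk _
    have hcap : wordElt [cap i] ∈ tangles m (m - 2) := wordElt_mem_tangles
      (by simp only [IsTangle, Shape.ins, Shape.outs]; omega)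
    have h1 := (eqv_exchange_word (m := m - 2) (i := i) (d := d) .cup q b hb
      (by simp only [Shape.ins]; omega)).mul_left hcap
    have h2 := (eqv_exchange_word (m := m) (i := i) (d := d) .cap q b hb
      (by simp only [Shape.ins]; omega)).mul_right (wordElt [cup i])
    rw [← mul_assoc] at h1
    simp only [flatten, List.map, Shape.flatten, Shape.ins, Shape.outs, add_zero,
      mul_assoc] at h1 h2
    have h3 := h1.trans h2
    rw [e, add_mul, mul_add]
    simp only [smul_mul_assoc, mul_smul_comm]
    refine Eqv.add (Eqv.smul _ ?_) (Eqv.smul _ ?_)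
    · rw [wordElt_nil, one_mul, mul_one]
      exact Eqv.refl _ _
    · have e2 : wordElt [cap i, cup i] = wordElt [cap i] * wordElt [cup i] :=
        wordElt_append [cap i] [cup i]
      rw [e2]
      simpa only [mul_assoc] using h3

theorem eqv_three {m i : ℕ} {a b c : Crossing} (habc : TriangleOK a b c) (x y z : Bool)
    (hx : x = true → a ≠ .virt) (hy : y = true → b ≠ .virt) (hz : z = true → c ≠ .virt)
    (hxy : x = true → y = true → z = true) (hxz : x = true → z = true → y = true)
    (hyz : y = true → z = true → x = true) (h : i + 3 ≤ m) :
    Eqv m (pieceElt (cross a i) x * pieceElt (cross b (i + 1)) y * pieceElt (cross c i) z)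
      (pieceElt (cross c (i + 1)) z * pieceElt (cross b i) y * pieceElt (cross a (i + 1)) x) := by
  have word : ∀ k j, pieceElt (cross k j) false = wordElt [cross k.flatten j] :=
    fun k j => pieceElt_false _
  -- The three implications exclude exactly two smoothed crossings; five patterns remain.
  cases x <;> cases y <;> cases z <;> simp only [forall_const, reduceCtorEq, imp_false,
    not_true_eq_false, not_false_eq_true, imp_true_iff, forall_true_left] at hx hy hz hxy hxz hyz
  · simp only [word, ← wordElt_append]
    exact (LocalMove.three a b c i habc).eqv (m := m) (n := m)
      (by simp only [IsTangle, Shape.ins, Shape.outs]; omega)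
  -- One crossing is smoothed, hence real. `TriangleOK` then makes the other two both virtual or
  -- both real, so that a single type of flat strand passes the turn-back.
  · have e : b.flatten = a.flatten := by
      revert habc hz; cases a <;> cases b <;> cases c <;> simp [TriangleOK, Crossing.flatten]
    have := eqv_three_last a hz h
    rw [word, word, word, word, e, ← wordElt_append, mul_assoc, ← wordElt_append]
    exact this
  · have e : c.flatten = a.flatten := by
      revert habc hy; cases a <;> cases b <;> cases c <;> simp [TriangleOK, Crossing.flatten]
    have := eqv_three_middle a hy h
    rw [word, word, word, word, e]
    exact this
  · have e : c.flatten = b.flatten := by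
      revert habc hx; cases a <;> cases b <;> cases c <;> simp [TriangleOK, Crossing.flatten]
    have := eqv_three_first b hx h
    rw [word, word, word, word, e, ← wordElt_append, mul_assoc, ← wordElt_append]
    exact this
  · refine eqv_three_marked hx hy hz ?_ h
    -- There are two real types only, and `a = c ≠ b` is the forbidden cyclic triangle, so `b`
    -- agrees with `a` or with `c`.
    revert habc hx hy hz; cases a <;> cases b <;> cases c <;> simp [TriangleOK]

/-! ### Coloured diagrams -/

/-- The colour of a strand: whether it is directed upwards, and an integer label. -/
structure Color where
  /-- Whether the strand is directed upwards. -/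
  up : Bool
  /-- The label of the strand. -/
  label : ℤ

/-- The colour of the other leg of a minimum or maximum. -/
def Color.rev (x : Color) : Color := ⟨!x.up, x.label⟩

/-- `1` for a strand directed upwards and `-1` for a strand directed downwards. -/
def upSign (b : Bool) : ℤ := if b then 1 else -1

/-- The colour of the upper left strand of a crossing, given those of the lower strands. -/
def Crossing.colorLeft (k : Crossing) (x y : Color) : Color :=
  if k = .virt then y else ⟨y.up, y.label - upSign x.up⟩

/-- The colour of the upper right strand of a crossing, given those of the lower strands. -/
def Crossing.colorRight (k : Crossing) (x y : Color) : Color :=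
  if k = .virt then x else ⟨x.up, x.label + upSign y.up⟩

/-- The index of a crossing in terms of its colours, up to the sign. -/
def gap (x y : Color) : ℤ :=
  x.label - y.label + (if x.up then 1 else 0) + (if y.up then 1 else 0) - 1

/-- Whether a crossing is smoothed. -/
def Crossing.mark (n : ℕ) (k : Crossing) (x y : Color) : Bool :=
  decide (k ≠ .virt ∧ (n : ℤ) ∣ gap x y)

/-- The sign of a crossing in terms of its colours. -/
def Crossing.colorSign (k : Crossing) (x y : Color) : ℤ :=
  match k with
  | .virt => 0
  | .slash => if x.up = y.up then 1 else -1
  | .backslash => if x.up = y.up then -1 else 1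

/-- The colours at the bottom and at the top of a shape, together with its mark and its sign. -/
inductive ShapeColors (n : ℕ) : Shape Crossing → List Color → List Color → Bool × ℤ → Prop
  | cup (x : Color) : ShapeColors n .cup [] [x, x.rev] (false, 0)
  | cap (x : Color) : ShapeColors n .cap [x, x.rev] [] (false, 0)
  | cross (k : Crossing) (x y : Color) : ShapeColors n (.cross k) [x, y]
      [k.colorLeft x y, k.colorRight x y] (k.mark n x y, k.colorSign x y)

/-- The colours at the bottom and at the top of a piece, with its mark and its sign. -/
def PieceColors (n : ℕ) (sh : Shape Crossing) :
    ℕ → List Color → List Color → Bool × ℤ → Prop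
  | 0, s, t, μ => ∃ P Q r, s = P ++ r ∧ t = Q ++ r ∧ ShapeColors n sh P Q μ
  | i + 1, s, t, μ => ∃ x s' t', s = x :: s' ∧ t = x :: t' ∧ PieceColors n sh i s' t' μ

/-- `Colors n s w t ms`: a colouring of the word `w` with the colours `s` at the bottom and `t` at
the top, with the list `ms` of marks and signs of its pieces. -/
def Colors (n : ℕ) : List Color → Word Crossing → List Color → List (Bool × ℤ) → Prop
  | s, [], t, ms => t = s ∧ ms = []
  | s, p :: w, t, ms => ∃ q μ ms', PieceColors n p.shape p.pos s q μ ∧ Colors n q w t ms' ∧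
      ms = μ :: ms'

/-- The scalar by which a crossing of sign `ε` contributes to the writhe factor. -/
noncomputable def writheFactor (ε : ℤ) : ℤ[T;T⁻¹] := (((-A ^ 3) ^ (-ε) : ℤ[T;T⁻¹]ˣ) : ℤ[T;T⁻¹])

theorem writheFactor_add (ε ε' : ℤ) :
    writheFactor (ε + ε') = writheFactor ε * writheFactor ε' := by
  rw [writheFactor, writheFactor, writheFactor, neg_add, zpow_add, Units.val_mul]

theorem writheFactor_zero : writheFactor 0 = 1 := by simp [writheFactor]

/-- The state sum of a word with given marks and signs. -/
noncomputable def stateSum : Word Crossing → List (Bool × ℤ) → WordAlgebra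
  | p :: w, μ :: ms => (writheFactor μ.2 • pieceElt p μ.1) * stateSum w ms
  | _, _ => 1

/-! ### Composition and translation of coloured words. -/

theorem pieceColors_append (n : ℕ) (sh : Shape Crossing) (l s t : List Color) (j : ℕ)
    (μ : Bool × ℤ) : PieceColors n sh (l.length + j) (l ++ s) t μ ↔
      ∃ t', t = l ++ t' ∧ PieceColors n sh j s t' μ := by
  induction l generalizing t with
  | nil => simp
  | cons x l ih =>
    rw [List.length_cons, add_right_comm]
    simp only [PieceColors, List.cons_append, List.cons.injEq]
    constructor
    · rintro ⟨y, s', t', ⟨rfl, rfl⟩, rfl, h⟩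
      obtain ⟨t', rfl, h'⟩ := (ih _).1 h
      exact ⟨t', rfl, h'⟩
    · rintro ⟨t', rfl, h⟩
      exact ⟨x, _, _, ⟨rfl, rfl⟩, rfl, (ih _).2 ⟨t', rfl, h⟩⟩

theorem pieceColors_cup (n : ℕ) (s t : List Color) (μ : Bool × ℤ) :
    PieceColors n .cup 0 s t μ ↔ ∃ x, t = x :: x.rev :: s ∧ μ = (false, 0) := by
  constructor
  · rintro ⟨P, Q, r, rfl, rfl, h⟩
    cases h with
    | cup x => exact ⟨x, rfl, rfl⟩
  · rintro ⟨x, rfl, rfl⟩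
    exact ⟨_, _, _, rfl, rfl, .cup x⟩

theorem pieceColors_cap (n : ℕ) (s t : List Color) (μ : Bool × ℤ) :
    PieceColors n .cap 0 s t μ ↔ ∃ x, s = x :: x.rev :: t ∧ μ = (false, 0) := by
  constructor
  · rintro ⟨P, Q, r, rfl, rfl, h⟩
    cases h with
    | cap x => exact ⟨x, rfl, rfl⟩
  · rintro ⟨x, rfl, rfl⟩
    exact ⟨_, _, _, rfl, rfl, .cap x⟩

theorem pieceColors_cross (n : ℕ) (k : Crossing) (s t : List Color) (μ : Bool × ℤ) :
    PieceColors n (.cross k) 0 s t μ ↔ ∃ x y r, s = x :: y :: r ∧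
      t = k.colorLeft x y :: k.colorRight x y :: r ∧ μ = (k.mark n x y, k.colorSign x y) := by
  constructor
  · rintro ⟨P, Q, r, rfl, rfl, h⟩
    cases h with
    | cross k x y => exact ⟨x, y, r, rfl, rfl, rfl⟩
  · rintro ⟨x, y, r, rfl, rfl, rfl⟩
    exact ⟨_, _, _, rfl, rfl, .cross k x y⟩

theorem PieceColors.exists_append {n : ℕ} {sh : Shape Crossing} {i : ℕ} {s t : List Color}
    {μ : Bool × ℤ} (h : PieceColors n sh i s t μ) : ∃ l P Q r, s = l ++ (P ++ r) ∧
      t = l ++ (Q ++ r) ∧ l.length = i ∧ ShapeColors n sh P Q μ := by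
  induction i generalizing s t with
  | zero =>
    obtain ⟨P, Q, r, rfl, rfl, h⟩ := h
    exact ⟨[], P, Q, r, rfl, rfl, rfl, h⟩
  | succ i ih =>
    obtain ⟨x, s, t, rfl, rfl, h⟩ := h
    obtain ⟨l, P, Q, r, rfl, rfl, rfl, h'⟩ := ih h
    exact ⟨x :: l, P, Q, r, rfl, rfl, rfl, h'⟩

theorem ShapeColors.length {n : ℕ} {sh : Shape Crossing} {P Q : List Color} {μ : Bool × ℤ}
    (h : ShapeColors n sh P Q μ) : P.length = sh.ins ∧ Q.length = sh.outs := by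
  cases h <;> exact ⟨rfl, rfl⟩

theorem PieceColors.isTangle {n : ℕ} {p : Piece Crossing} {s t : List Color}
    {μ : Bool × ℤ} (h : PieceColors n p.shape p.pos s t μ) : IsTangle s.length [p] t.length := by
  obtain ⟨l, P, Q, r, rfl, rfl, h1, h⟩ := h.exists_append
  obtain ⟨h2, h3⟩ := h.length
  simp only [IsTangle, List.length_append]
  omega

theorem Colors.isTangle {n : ℕ} {w : Word Crossing} {s t : List Color} {ms : List (Bool × ℤ)}
    (h : Colors n s w t ms) : IsTangle s.length w t.length := by
  induction w generalizing s ms with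
  | nil => obtain ⟨rfl, -⟩ := h; rfl
  | cons p w ih =>
    obtain ⟨q, μ, ms', h1, h2, -⟩ := h
    exact (isTangle_append [p] w _ _).2 ⟨_, h1.isTangle, ih h2⟩

theorem Colors.length_eq {n : ℕ} {w : Word Crossing} {s t : List Color} {ms : List (Bool × ℤ)}
    (h : Colors n s w t ms) : ms.length = w.length := by
  induction w generalizing s ms with
  | nil => obtain ⟨-, rfl⟩ := h; rfl
  | cons p w ih =>
    obtain ⟨q, μ, ms', h1, h2, rfl⟩ := h
    simpa using ih h2

theorem Colors.stateSum_mem_tangles {n : ℕ} {w : Word Crossing} {s t : List Color}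
    {ms : List (Bool × ℤ)} (h : Colors n s w t ms) :
    stateSum w ms ∈ tangles s.length t.length := by
  induction w generalizing s ms with
  | nil =>
    obtain ⟨rfl, rfl⟩ := h
    simpa only [stateSum, wordElt_nil] using wordElt_mem_tangles (w := []) rfl
  | cons p w ih =>
    obtain ⟨q, μ, ms', h1, h2, rfl⟩ := h
    exact mul_mem_tangles (Submodule.smul_mem _ _ (pieceElt_mem_tangles _ h1.isTangle)) (ih h2)

theorem colors_append (n : ℕ) (u v : Word Crossing) (s t : List Color) (ms : List (Bool × ℤ)) :
    Colors n s (u ++ v) t ms ↔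
      ∃ q ms₁ ms₂, Colors n s u q ms₁ ∧ Colors n q v t ms₂ ∧ ms = ms₁ ++ ms₂ := by
  induction u generalizing s ms with
  | nil =>
    constructor
    · intro h
      exact ⟨s, [], ms, ⟨rfl, rfl⟩, h, rfl⟩
    · rintro ⟨q, ms₁, ms₂, ⟨rfl, rfl⟩, h, rfl⟩
      exact h
  | cons p u ih =>
    constructor
    · rintro ⟨q, μ, ms', h1, h2, rfl⟩
      obtain ⟨q', ms₁, ms₂, h3, h4, rfl⟩ := (ih _ _).1 h2
      exact ⟨q', μ :: ms₁, ms₂, ⟨q, μ, ms₁, h1, h3, rfl⟩, h4, rfl⟩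
    · rintro ⟨q', _, ms₂, ⟨q, μ, ms₁, h1, h3, rfl⟩, h4, rfl⟩
      exact ⟨q, μ, ms₁ ++ ms₂, h1, (ih _ _).2 ⟨q', ms₁, ms₂, h3, h4, rfl⟩, rfl⟩

theorem stateSum_append (u v : Word Crossing) (ms₁ ms₂ : List (Bool × ℤ))
    (h : ms₁.length = u.length) :
    stateSum (u ++ v) (ms₁ ++ ms₂) = stateSum u ms₁ * stateSum v ms₂ := by
  induction u generalizing ms₁ with
  | nil => obtain rfl := List.length_eq_zero_iff.1 h; simp [stateSum]
  | cons p u ih =>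
    cases ms₁ with
    | nil => simp at h
    | cons μ ms₁ => simp [stateSum, ih ms₁ (by simpa using h), mul_assoc]

/-- A word with `i` strands added to the left. -/
def shift (i : ℕ) (w : Word Crossing) : Word Crossing := w.map fun p => ⟨p.shape, i + p.pos⟩

/-- Strands to the left of a word are inert, so the colours in a local move need to be examined at
the leftmost position only. -/
theorem colors_shift (n : ℕ) (w : Word Crossing) (l s t : List Color) (ms : List (Bool × ℤ)) :
    Colors n (l ++ s) (shift l.length w) t ms ↔ ∃ t', t = l ++ t' ∧ Colors n s w t' ms := by
  induction w generalizing s ms with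
  | nil =>
    constructor
    · rintro ⟨rfl, rfl⟩
      exact ⟨s, rfl, rfl, rfl⟩
    · rintro ⟨_, rfl, rfl, rfl⟩
      exact ⟨rfl, rfl⟩
  | cons p w ih =>
    constructor
    · rintro ⟨q, μ, ms', h1, h2, rfl⟩
      obtain ⟨q, rfl, h3⟩ := (pieceColors_append ..).1 h1
      obtain ⟨t, rfl, h4⟩ := (ih _ _).1 h2
      exact ⟨t, rfl, q, μ, ms', h3, h4, rfl⟩
    · rintro ⟨t, rfl, q, μ, ms', h1, h2, rfl⟩
      exact ⟨l ++ q, μ, ms', (pieceColors_append ..).2 ⟨q, rfl, h1⟩, (ih _ _).2 ⟨t, rfl, h2⟩, rfl⟩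

/-! ### Local moves of coloured diagrams -/

theorem upSign_not (b : Bool) : upSign (!b) = -upSign b := by cases b <;> rfl

theorem Color.rev_rev (x : Color) : x.rev.rev = x := by simp [Color.rev]

/-- The legs of one extremum have equal labels and opposite directions. A real curl therefore has
index `0`, a multiple of every `n`, and is always smoothed. -/
theorem gap_rev (x : Color) : gap x x.rev = 0 := by
  obtain ⟨u, a⟩ := x
  cases u <;> simp [gap, Color.rev]

section inversion

variable {n : ℕ} {w : Word Crossing} {s t : List Color} {ms : List (Bool × ℤ)}

theorem colors_cross_zero {k : Crossing} : Colors n s (cross k 0 :: w) t ms ↔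
    ∃ x y r ms', s = x :: y :: r ∧ ms = (k.mark n x y, k.colorSign x y) :: ms' ∧
      Colors n (k.colorLeft x y :: k.colorRight x y :: r) w t ms' := by
  constructor
  · rintro ⟨q, μ, ms', h1, h2, rfl⟩
    obtain ⟨x, y, r, rfl, rfl, rfl⟩ := (pieceColors_cross ..).1 h1
    exact ⟨x, y, r, ms', rfl, rfl, h2⟩
  · rintro ⟨x, y, r, ms', rfl, rfl, h⟩
    exact ⟨_, _, _, (pieceColors_cross ..).2 ⟨x, y, r, rfl, rfl, rfl⟩, h, rfl⟩

theorem colors_cross_one {k : Crossing} : Colors n s (cross k 1 :: w) t ms ↔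
    ∃ c x y r ms', s = c :: x :: y :: r ∧ ms = (k.mark n x y, k.colorSign x y) :: ms' ∧
      Colors n (c :: k.colorLeft x y :: k.colorRight x y :: r) w t ms' := by
  constructor
  · rintro ⟨q, μ, ms', ⟨c, s', t', rfl, rfl, h1⟩, h2, rfl⟩
    obtain ⟨x, y, r, rfl, rfl, rfl⟩ := (pieceColors_cross ..).1 h1
    exact ⟨c, x, y, r, ms', rfl, rfl, h2⟩
  · rintro ⟨c, x, y, r, ms', rfl, rfl, h⟩
    exact ⟨_, _, _, ⟨c, _, _, rfl, rfl, (pieceColors_cross ..).2 ⟨x, y, r, rfl, rfl, rfl⟩⟩, h, rfl⟩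

theorem colors_cup_zero : Colors n s (cup 0 :: w) t ms ↔
    ∃ x ms', ms = (false, 0) :: ms' ∧ Colors n (x :: x.rev :: s) w t ms' := by
  constructor
  · rintro ⟨q, μ, ms', h1, h2, rfl⟩
    obtain ⟨x, rfl, rfl⟩ := (pieceColors_cup ..).1 h1
    exact ⟨x, ms', rfl, h2⟩
  · rintro ⟨x, ms', rfl, h⟩
    exact ⟨_, _, _, (pieceColors_cup ..).2 ⟨x, rfl, rfl⟩, h, rfl⟩

theorem colors_cup_one : Colors n s (cup 1 :: w) t ms ↔
    ∃ c r x ms', s = c :: r ∧ ms = (false, 0) :: ms' ∧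
      Colors n (c :: x :: x.rev :: r) w t ms' := by
  constructor
  · rintro ⟨q, μ, ms', ⟨c, s', t', rfl, rfl, h1⟩, h2, rfl⟩
    obtain ⟨x, rfl, rfl⟩ := (pieceColors_cup ..).1 h1
    exact ⟨c, s', x, ms', rfl, rfl, h2⟩
  · rintro ⟨c, r, x, ms', rfl, rfl, h⟩
    exact ⟨_, _, _, ⟨c, _, _, rfl, rfl, (pieceColors_cup ..).2 ⟨x, rfl, rfl⟩⟩, h, rfl⟩

theorem colors_cap_zero : Colors n s (cap 0 :: w) t ms ↔
    ∃ x r ms', s = x :: x.rev :: r ∧ ms = (false, 0) :: ms' ∧ Colors n r w t ms' := by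
  constructor
  · rintro ⟨q, μ, ms', h1, h2, rfl⟩
    obtain ⟨x, rfl, rfl⟩ := (pieceColors_cap ..).1 h1
    exact ⟨x, q, ms', rfl, rfl, h2⟩
  · rintro ⟨x, r, ms', rfl, rfl, h⟩
    exact ⟨_, _, _, (pieceColors_cap ..).2 ⟨x, rfl, rfl⟩, h, rfl⟩

theorem colors_cap_one : Colors n s (cap 1 :: w) t ms ↔
    ∃ c x r ms', s = c :: x :: x.rev :: r ∧ ms = (false, 0) :: ms' ∧
      Colors n (c :: r) w t ms' := by
  constructor
  · rintro ⟨q, μ, ms', ⟨c, s', t', rfl, rfl, h1⟩, h2, rfl⟩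
    obtain ⟨x, rfl, rfl⟩ := (pieceColors_cap ..).1 h1
    exact ⟨c, x, t', ms', rfl, rfl, h2⟩
  · rintro ⟨c, x, r, ms', rfl, rfl, h⟩
    exact ⟨_, _, _, ⟨c, _, _, rfl, rfl, (pieceColors_cap ..).2 ⟨x, rfl, rfl⟩⟩, h, rfl⟩

end inversion

theorem stateSum_one (p : Piece Crossing) (μ : Bool × ℤ) :
    stateSum [p] [μ] = writheFactor μ.2 • pieceElt p μ.1 := by
  simp [stateSum]

theorem stateSum_two (p q : Piece Crossing) (μ ν : Bool × ℤ) :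
    stateSum [p, q] [μ, ν] =
      writheFactor (μ.2 + ν.2) • (pieceElt p μ.1 * pieceElt q ν.1) := by
  simp [stateSum, writheFactor_add, smul_smul, mul_comm]

theorem stateSum_three (p q r : Piece Crossing) (μ ν ρ : Bool × ℤ) :
    stateSum [p, q, r] [μ, ν, ρ] =
      writheFactor (μ.2 + ν.2 + ρ.2) • (pieceElt p μ.1 * pieceElt q ν.1 * pieceElt r ρ.1) := by
  simp [stateSum, writheFactor_add, smul_smul, mul_assoc, mul_comm, mul_left_comm]

/-- The words `u` and `v` carry the same colours, and when a word with `i` strands is added to the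
left of both, then their state sums have the same value. -/
def SameColors (n i : ℕ) (u v : Word Crossing) : Prop :=
  ∀ s t : List Color, (∃ k, IsTangle s.length u k) →
    (∀ ms, Colors n s u t ms → ∃ ms', Colors n s v t ms' ∧ ∀ m, i + s.length ≤ m →
      Eqv m (stateSum (shift i u) ms) (stateSum (shift i v) ms')) ∧
    (∀ ms', Colors n s v t ms' → ∃ ms, Colors n s u t ms)

theorem sameColors_zigzag (n i : ℕ) : SameColors n i [cup 0, cap 1] [] := by
  intro s t ht
  constructor
  · intro ms h
    obtain ⟨x, ms, rfl, h1⟩ := colors_cup_zero.1 h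
    obtain ⟨c, x', r, ms, e, rfl, ⟨rfl, rfl⟩⟩ := colors_cap_one.1 h1
    simp only [List.cons.injEq] at e
    obtain ⟨rfl, rfl, rfl⟩ := e
    rw [Color.rev_rev]
    refine ⟨[], ⟨rfl, rfl⟩, fun m hm => ?_⟩
    simp only [List.length_cons] at hm
    have := (LocalMove.zigzag i).eqv (m := m) (n := m)
      (by simp only [IsTangle, Shape.ins, Shape.outs]; omega)
    simpa [stateSum, shift, pieceElt_false, writheFactor_zero, ← wordElt_append, flatten,
      wordElt_nil] using this
  · rintro ms ⟨rfl, rfl⟩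
    cases t with
    -- The maximum at position `1` uses a strand from below, so an empty bottom contradicts the
    -- tangle hypothesis.
    | nil => obtain ⟨k, hk⟩ := ht; simp [IsTangle, Shape.ins, Shape.outs] at hk
    | cons x r =>
      exact ⟨_, colors_cup_zero.2 ⟨x, _, rfl, colors_cap_one.2 ⟨x, x.rev, r, _, by
        rw [Color.rev_rev], rfl, rfl, rfl⟩⟩⟩

theorem sameColors_zigzag' (n i : ℕ) : SameColors n i [cup 1, cap 0] [] := by
  intro s t ht
  constructor
  · intro ms h
    obtain ⟨c, r, x, ms, rfl, rfl, h1⟩ := colors_cup_one.1 h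
    obtain ⟨x', r', ms, e, rfl, ⟨rfl, rfl⟩⟩ := colors_cap_zero.1 h1
    simp only [List.cons.injEq] at e
    obtain ⟨rfl, rfl, rfl⟩ := e
    rw [Color.rev_rev]
    refine ⟨[], ⟨rfl, rfl⟩, fun m hm => ?_⟩
    simp only [List.length_cons] at hm
    have := (LocalMove.zigzag' i).eqv (m := m) (n := m)
      (by simp only [IsTangle, Shape.ins, Shape.outs]; omega)
    simpa [stateSum, shift, pieceElt_false, writheFactor_zero, ← wordElt_append, flatten,
      wordElt_nil] using this
  · rintro ms ⟨rfl, rfl⟩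
    cases t with
    | nil => obtain ⟨k, hk⟩ := ht; simp [IsTangle, Shape.ins, Shape.outs] at hk
    | cons x r =>
      exact ⟨_, colors_cup_one.2 ⟨x, r, x.rev, _, rfl, rfl, colors_cap_zero.2 ⟨x, x.rev.rev :: r, _,
        rfl, rfl, by rw [Color.rev_rev], rfl⟩⟩⟩

theorem Crossing.mark_ne {n : ℕ} {k : Crossing} {x y : Color} (h : k.mark n x y = true) :
    k ≠ .virt := (of_decide_eq_true h).1

/-- Divisibility ignores signs. That matters because second moves, swings and reversal of
orientation negate the gap. -/
theorem Crossing.mark_congr {n : ℕ} {k k' : Crossing} {x y x' y' : Color}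
    (h : k = .virt ↔ k' = .virt)
    (hg : k ≠ .virt → gap x y = gap x' y' ∨ gap x y = -gap x' y') :
    k.mark n x y = k'.mark n x' y' := by
  unfold Crossing.mark
  congr 1
  rw [eq_iff_iff, ne_eq, ne_eq, h]
  refine and_congr_right fun hk => ?_
  rcases hg (by rwa [ne_eq, h]) with e | e <;> rw [e]
  rw [dvd_neg]

/-- At the second crossing the two strands have changed sides: the jumps are undone, the gap is
negated and the signs add up to `0`. The crossings are thus smoothed together or not at all, without
any writhe factor. -/
theorem sameColors_cross_turn (n i : ℕ) (k : Crossing) :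
    SameColors n i [cross k 0, cross k.turn 0] [] := by
  have key : ∀ x y, k.turn.colorLeft (k.colorLeft x y) (k.colorRight x y) = x ∧
      k.turn.colorRight (k.colorLeft x y) (k.colorRight x y) = y := by
    intro x y
    cases k <;> simp [Crossing.turn, Crossing.colorLeft, Crossing.colorRight]
  intro s t ht
  constructor
  · intro ms h
    obtain ⟨x, y, r, ms, rfl, rfl, h1⟩ := colors_cross_zero.1 h
    obtain ⟨x', y', r', ms, e, rfl, ⟨rfl, rfl⟩⟩ := colors_cross_zero.1 h1
    simp only [List.cons.injEq] at e
    obtain ⟨rfl, rfl, rfl⟩ := e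
    rw [(key x y).1, (key x y).2]
    refine ⟨[], ⟨rfl, rfl⟩, fun m hm => ?_⟩
    simp only [List.length_cons] at hm
    have hmark : k.mark n x y = k.turn.mark n (k.colorLeft x y) (k.colorRight x y) := by
      refine Crossing.mark_congr k.turn_eq_virt.symm fun hk => Or.inr ?_
      obtain ⟨u, a⟩ := x
      obtain ⟨v, b⟩ := y
      cases u <;> cases v <;> simp [gap, Crossing.colorLeft, Crossing.colorRight, hk, upSign] <;> 
        ring
    have hsign : k.colorSign x y + k.turn.colorSign (k.colorLeft x y) (k.colorRight x y) = 0 := by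
      obtain ⟨u, a⟩ := x
      obtain ⟨v, b⟩ := y
      cases k <;> cases u <;> cases v <;>
        simp [Crossing.colorSign, Crossing.turn, Crossing.colorLeft, Crossing.colorRight]
    have := eqv_two (m := m) (i := i) k (k.mark n x y) Crossing.mark_ne (by omega)
    simp only [shift, List.map, stateSum_two, ← hmark, hsign, writheFactor_zero, one_smul]
    simpa [stateSum, wordElt_nil] using this
  · rintro ms ⟨rfl, rfl⟩
    match t, ht with
    | [], ⟨k, hk⟩ => simp [IsTangle, Shape.ins, Shape.outs] at hk
    | [x], ⟨k, hk⟩ => simp [IsTangle, Shape.ins, Shape.outs] at hk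
    | x :: y :: r, _ =>
      exact ⟨_, colors_cross_zero.2 ⟨x, y, r, _, rfl, rfl, colors_cross_zero.2 ⟨_, _, r, _, rfl, rfl,
        by rw [(key x y).1, (key x y).2], rfl⟩⟩⟩

/-- The strands of a curl at an extremum are antiparallel, so the sign depends on the type of the
crossing alone; its writhe factor is the inverse of the factor found in `eqv_curl_cup`. -/
theorem writheFactor_mul_curl {k : Crossing} (hk : k ≠ .virt) (x : Color) :
    writheFactor (k.colorSign x x.rev) * (-k.turn.weight ^ 3) = 1 := by
  have h : k.colorSign x x.rev = if k = .slash then -1 else 1 := by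
    cases k <;> simp [Crossing.colorSign, Color.rev] at hk ⊢
  rw [h]
  have hw := varA_mul_varB
  cases k with
  | virt => exact absurd rfl hk
  | slash =>
    simp only [if_true, writheFactor, neg_neg, zpow_one, Units.val_neg, Units.val_pow_eq_pow_val,
      Crossing.turn, Crossing.weight]
    linear_combination (varA ^ 2 * varB ^ 2 + varA * varB + 1) * hw
  | backslash =>
    have e : ((-A ^ 3) ^ (-(1 : ℤ)) : ℤ[T;T⁻¹]ˣ) = -(A⁻¹) ^ 3 := by
      rw [zpow_neg, zpow_one, inv_pow]; exact inv_neg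
    simp only [reduceCtorEq, if_false, writheFactor, e, Units.val_neg, Units.val_pow_eq_pow_val,
      Crossing.turn, Crossing.weight]
    linear_combination (varA ^ 2 * varB ^ 2 + varA * varB + 1) * hw

theorem sameColors_curl_cup (n i : ℕ) (k : Crossing) :
    SameColors n i [cup 0, cross k 0] [cup 0] := by
  have key : ∀ x : Color, k.colorRight x x.rev = (k.colorLeft x x.rev).rev := by
    intro x
    by_cases hk : k = .virt <;>
      simp [Crossing.colorLeft, Crossing.colorRight, Color.rev, hk, upSign_not, sub_eq_add_neg]
  intro s t ht
  constructor
  · intro ms h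
    obtain ⟨x, ms, rfl, h1⟩ := colors_cup_zero.1 h
    obtain ⟨x', y', r', ms, e, rfl, ⟨rfl, rfl⟩⟩ := colors_cross_zero.1 h1
    simp only [List.cons.injEq] at e
    obtain ⟨rfl, rfl, rfl⟩ := e
    rw [key]
    refine ⟨_, colors_cup_zero.2 ⟨_, _, rfl, rfl, rfl⟩, fun m hm => ?_⟩
    simp only [shift, List.map, stateSum_one, stateSum_two, zero_add, writheFactor_zero, one_smul,
      pieceElt_false, add_zero]
    -- A virtual curl is never smoothed and disappears by a flat move; a real one is always
    -- smoothed.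
    by_cases hk : k = .virt
    · subst hk
      simp only [Crossing.mark, ne_eq, not_true_eq_false, false_and, decide_false, pieceElt_false,
        ← wordElt_append, Crossing.colorSign, writheFactor_zero, one_smul]
      exact (LocalMove.oneCup .virt i).eqv (m := m) (n := m + 2)
        (by simp only [IsTangle, Shape.ins, Shape.outs]; omega)
    · have hmark : k.mark n x x.rev = true := by simp [Crossing.mark, hk, gap_rev]
      rw [hmark]
      have := (eqv_curl_cup hk (by omega : i ≤ m)).smul (writheFactor (k.colorSign x x.rev))
      rw [smul_smul, writheFactor_mul_curl hk, one_smul] at this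
      exact this
  · intro ms h
    obtain ⟨c, ms, rfl, ⟨rfl, rfl⟩⟩ := colors_cup_zero.1 h
    obtain ⟨x, rfl⟩ : ∃ x : Color, k.colorLeft x x.rev = c := by
      -- The crossing swaps the legs of the minimum: the direction is reversed and the jump is
      -- undone.
      refine ⟨⟨!c.up, if k = .virt then c.label else c.label + upSign (!c.up)⟩, ?_⟩
      by_cases hk : k = .virt <;> simp [Crossing.colorLeft, Color.rev, hk]
    exact ⟨_, colors_cup_zero.2 ⟨x, _, rfl, colors_cross_zero.2 ⟨x, x.rev, s, _, rfl, rfl,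
      by rw [key], rfl⟩⟩⟩

theorem sameColors_curl_cap (n i : ℕ) (k : Crossing) :
    SameColors n i [cross k 0, cap 0] [cap 0] := by
  have key : ∀ x : Color, k.colorRight x x.rev = (k.colorLeft x x.rev).rev := by
    intro x
    by_cases hk : k = .virt <;>
      simp [Crossing.colorLeft, Crossing.colorRight, Color.rev, hk, upSign_not, sub_eq_add_neg]
  -- The maximum constrains only the colours above the crossing; those below must then also be the
  -- two legs of an extremum.
  have key' : ∀ x y : Color, k.colorRight x y = (k.colorLeft x y).rev → y = x.rev := by
    rintro ⟨u, a⟩ ⟨v, b⟩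
    by_cases hk : k = .virt <;> cases u <;> cases v <;>
      simp [Crossing.colorLeft, Crossing.colorRight, Color.rev, hk, upSign] <;> omega
  intro s t ht
  constructor
  · intro ms h
    obtain ⟨x, y, r, ms, rfl, rfl, h1⟩ := colors_cross_zero.1 h
    obtain ⟨x', r', ms, e, rfl, ⟨rfl, rfl⟩⟩ := colors_cap_zero.1 h1
    simp only [List.cons.injEq] at e
    obtain ⟨rfl, e, rfl⟩ := e
    obtain rfl := key' _ _ e
    refine ⟨_, colors_cap_zero.2 ⟨_, _, _, rfl, rfl, rfl, rfl⟩, fun m hm => ?_⟩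
    simp only [List.length_cons] at hm
    simp only [shift, List.map, stateSum_one, stateSum_two, zero_add, writheFactor_zero, one_smul,
      pieceElt_false, add_zero]
    by_cases hk : k = .virt
    · subst hk
      simp only [Crossing.mark, ne_eq, not_true_eq_false, false_and, decide_false, pieceElt_false,
        ← wordElt_append, Crossing.colorSign, writheFactor_zero, one_smul]
      exact (LocalMove.oneCap .virt i).eqv (m := m) (n := m - 2)
        (by simp only [IsTangle, Shape.ins, Shape.outs]; omega)
    · have hmark : k.mark n x x.rev = true := by simp [Crossing.mark, hk, gap_rev]
      rw [hmark]
      have := (eqv_curl_cap hk (by omega : i + 2 ≤ m)).smul (writheFactor (k.colorSign x x.rev))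
      rw [smul_smul, writheFactor_mul_curl hk, one_smul] at this
      exact this
  · intro ms h
    obtain ⟨x, r, ms, rfl, rfl, ⟨rfl, rfl⟩⟩ := colors_cap_zero.1 h
    exact ⟨_, colors_cross_zero.2 ⟨x, x.rev, _, _, rfl, rfl, colors_cap_zero.2 ⟨_, _, _,
      by rw [key], rfl, rfl, rfl⟩⟩⟩

theorem sameColors_swing_cup (n i : ℕ) (k : Crossing) :
    SameColors n i [cup 0, cross k 1] [cup 1, cross k.turn 0] := by
  have hv := k.turn_eq_virt
  have hv' : Crossing.virt.turn = .virt := rfl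
  have key : ∀ x y : Color, k.colorLeft x.rev y = k.turn.colorRight y (k.colorRight x y) ∧
      k.colorRight x.rev y = (k.colorRight x y).rev ∧
      k.turn.colorLeft y (k.colorRight x y) = x := by
    intro x y
    by_cases hk : k = .virt <;>
      simp [Crossing.colorLeft, Crossing.colorRight, Color.rev, hk, hv, hv', upSign_not, sub_eq_add_neg]
  have hmark : ∀ x y : Color, k.mark n x.rev y = k.turn.mark n y (k.colorRight x y) := by
    intro x y
    refine Crossing.mark_congr hv.symm fun hk => Or.inr ?_
    obtain ⟨u, a⟩ := x
    obtain ⟨v, b⟩ := y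
    cases u <;> cases v <;> simp [gap, Crossing.colorRight, hk, upSign, Color.rev] <;> ring
  have hsign : ∀ x y : Color, k.colorSign x.rev y = k.turn.colorSign y (k.colorRight x y) := by
    rintro ⟨u, a⟩ ⟨v, b⟩
    cases k <;> cases u <;> cases v <;>
      simp [Crossing.colorSign, Crossing.turn, Crossing.colorRight, Color.rev]
  intro s t ht
  constructor
  · intro ms h
    obtain ⟨x, ms, rfl, h1⟩ := colors_cup_zero.1 h
    obtain ⟨c, x', y, r, ms, e, rfl, ⟨rfl, rfl⟩⟩ := colors_cross_one.1 h1
    simp only [List.cons.injEq] at e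
    obtain ⟨rfl, rfl, rfl⟩ := e
    refine ⟨_, colors_cup_one.2 ⟨y, r, k.colorRight x y, _, rfl, rfl, colors_cross_zero.2
      ⟨_, _, _, _, rfl, rfl, ?_, rfl⟩⟩, fun m hm => ?_⟩
    · rw [(key x y).1, (key x y).2.1, (key x y).2.2]
    · simp only [List.length_cons] at hm
      simp only [shift, List.map, stateSum_two, zero_add, pieceElt_false, hmark, hsign]
      exact (eqv_swing_cup (i := i) k _ (fun h => (not_congr hv).1 (Crossing.mark_ne h)) (by omega)).smul _
  · intro ms h
    obtain ⟨y, r, z, ms, rfl, rfl, h1⟩ := colors_cup_one.1 h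
    obtain ⟨x', y', r', ms, e, rfl, ⟨rfl, rfl⟩⟩ := colors_cross_zero.1 h1
    simp only [List.cons.injEq] at e
    obtain ⟨rfl, rfl, rfl⟩ := e
    obtain ⟨x, rfl⟩ : ∃ x : Color, k.colorRight x y = z := by
      -- This is the colour at the upper left of the turned crossing. Colours do not depend on which
      -- strand is above, so `k` can be used in place of `k.turn`.
      refine ⟨k.colorLeft y z, ?_⟩
      by_cases hk : k = .virt <;> simp [Crossing.colorLeft, Crossing.colorRight, hk]
    exact ⟨_, colors_cup_zero.2 ⟨x, _, rfl, colors_cross_one.2 ⟨x, x.rev, y, r, _, rfl, rfl,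
      by rw [(key x y).1, (key x y).2.1, (key x y).2.2], rfl⟩⟩⟩

theorem sameColors_swing_cap (n i : ℕ) (k : Crossing) :
    SameColors n i [cross k 1, cap 0] [cross k.turn 0, cap 1] := by
  have hv := k.turn_eq_virt
  have hv' : Crossing.virt.turn = .virt := rfl
  have key : ∀ x y z : Color, k.colorLeft y z = x.rev ↔ z = (k.turn.colorRight x y).rev := by
    rintro ⟨u, a⟩ ⟨v, b⟩ ⟨w, c⟩
    by_cases hk : k = .virt <;>
      simp [Crossing.colorLeft, Crossing.colorRight, Color.rev, hk, hv, hv', sub_eq_iff_eq_add]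
  have key' : ∀ x y : Color,
      k.colorRight y (k.turn.colorRight x y).rev = k.turn.colorLeft x y := by
    rintro ⟨u, a⟩ ⟨v, b⟩
    by_cases hk : k = .virt <;>
      simp [Crossing.colorLeft, Crossing.colorRight, Color.rev, hk, hv, hv', upSign_not, sub_eq_add_neg]
  have hmark : ∀ x y : Color,
      k.mark n y (k.turn.colorRight x y).rev = k.turn.mark n x y := by
    intro x y
    refine Crossing.mark_congr hv.symm fun hk => Or.inr ?_
    obtain ⟨u, a⟩ := x
    obtain ⟨v, b⟩ := y
    cases u <;> cases v <;> simp [gap, Crossing.colorRight, hv, hk, upSign, Color.rev] <;> ring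
  have hsign : ∀ x y : Color,
      k.colorSign y (k.turn.colorRight x y).rev = k.turn.colorSign x y := by
    rintro ⟨u, a⟩ ⟨v, b⟩
    cases k <;> cases u <;> cases v <;>
      simp [Crossing.colorSign, Crossing.turn, Crossing.colorRight, Color.rev]
  intro s t ht
  constructor
  · intro ms h
    obtain ⟨x, y, z, r, ms, rfl, rfl, h1⟩ := colors_cross_one.1 h
    obtain ⟨x', r', ms, e, rfl, ⟨rfl, rfl⟩⟩ := colors_cap_zero.1 h1
    simp only [List.cons.injEq] at e
    obtain ⟨rfl, e, rfl⟩ := e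
    obtain rfl := (key _ _ _).1 e
    refine ⟨_, colors_cross_zero.2 ⟨_, _, _, _, rfl, rfl, colors_cap_one.2
      ⟨_, _, _, _, rfl, rfl, ?_, rfl⟩⟩, fun m hm => ?_⟩
    · rw [key']
    · simp only [List.length_cons] at hm
      simp only [shift, List.map, stateSum_two, add_zero, pieceElt_false, hmark, hsign]
      exact (eqv_swing_cap (i := i) k _ (fun h => (not_congr hv).1 (Crossing.mark_ne h)) (by omega)).smul _
  · intro ms h
    obtain ⟨x, y, r, ms, rfl, rfl, h1⟩ := colors_cross_zero.1 h
    obtain ⟨c, z, r', ms, e, rfl, ⟨rfl, rfl⟩⟩ := colors_cap_one.1 h1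
    simp only [List.cons.injEq] at e
    obtain ⟨rfl, rfl, rfl⟩ := e
    exact ⟨_, colors_cross_one.2 ⟨x, y, _, r', _, rfl, rfl, colors_cap_zero.2 ⟨x, _, _,
      by rw [(key _ _ _).2 rfl], rfl, by rw [key'], rfl⟩⟩⟩

theorem sameColors_three (n i : ℕ) {a b c : Crossing} (habc : TriangleOK a b c) :
    SameColors n i [cross a 0, cross b 1, cross c 0] [cross c 1, cross b 0, cross a 1] := by
  -- The jump caused by another strand depends only on its direction, which crossings do not change;
  -- so the order in which a strand meets the other two is irrelevant.
  have key : ∀ x y z : Color,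
      c.colorLeft (a.colorLeft x y) (b.colorLeft (a.colorRight x y) z) =
        b.colorLeft x (c.colorLeft y z) ∧
      c.colorRight (a.colorLeft x y) (b.colorLeft (a.colorRight x y) z) =
        a.colorLeft (b.colorRight x (c.colorLeft y z)) (c.colorRight y z) ∧
      b.colorRight (a.colorRight x y) z =
        a.colorRight (b.colorRight x (c.colorLeft y z)) (c.colorRight y z) := by
    rintro ⟨u, l⟩ ⟨v, l'⟩ ⟨w, l''⟩
    revert habc
    cases a <;> cases b <;> cases c <;>
      simp [TriangleOK, Crossing.colorLeft, Crossing.colorRight] <;> omega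
  have hgap : ∀ x y z : Color,
      a.mark n (b.colorRight x (c.colorLeft y z)) (c.colorRight y z) = a.mark n x y ∧
      b.mark n (a.colorRight x y) z = b.mark n x (c.colorLeft y z) ∧
      c.mark n (a.colorLeft x y) (b.colorLeft (a.colorRight x y) z) = c.mark n y z := by
    rintro ⟨u, l⟩ ⟨v, l'⟩ ⟨w, l''⟩
    refine ⟨Crossing.mark_congr Iff.rfl fun h => Or.inl ?_,
      Crossing.mark_congr Iff.rfl fun h => Or.inl ?_,
      Crossing.mark_congr Iff.rfl fun h => Or.inl ?_⟩ <;> revert habc h <;>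
    cases a <;> cases b <;> cases c <;>
      simp [TriangleOK, Crossing.colorLeft, Crossing.colorRight, gap] <;> 
      cases u <;> cases v <;> cases w <;> simp [upSign] <;> ring
  have hsign : ∀ x y z : Color,
      a.colorSign (b.colorRight x (c.colorLeft y z)) (c.colorRight y z) = a.colorSign x y ∧
      b.colorSign (a.colorRight x y) z = b.colorSign x (c.colorLeft y z) ∧
      c.colorSign (a.colorLeft x y) (b.colorLeft (a.colorRight x y) z) = c.colorSign y z := by
    rintro ⟨u, l⟩ ⟨v, l'⟩ ⟨w, l''⟩
    cases a <;> cases b <;> cases c <;>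
      simp [Crossing.colorSign, Crossing.colorLeft, Crossing.colorRight]
  -- Additivity of the gaps: a smoothed pair of real crossings forces the third one to be smoothed.
  have hsum : ∀ x y z : Color, a ≠ .virt → b ≠ .virt → c ≠ .virt →
      gap (a.colorRight x y) z = gap x y + gap y z := by
    rintro ⟨u, l⟩ ⟨v, l'⟩ ⟨w, l''⟩ ha hb hc
    cases u <;> cases v <;> cases w <;> simp [gap, Crossing.colorRight, ha, upSign] <;> ring
  intro s t ht
  constructor
  · intro ms h
    obtain ⟨x, y, r, ms, rfl, rfl, h1⟩ := colors_cross_zero.1 h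
    obtain ⟨x', y', z, r', ms, e, rfl, h2⟩ := colors_cross_one.1 h1
    simp only [List.cons.injEq] at e
    obtain ⟨rfl, rfl, rfl⟩ := e
    obtain ⟨x', y', r, ms, e, rfl, ⟨rfl, rfl⟩⟩ := colors_cross_zero.1 h2
    simp only [List.cons.injEq] at e
    obtain ⟨rfl, rfl, rfl⟩ := e
    refine ⟨_, colors_cross_one.2 ⟨_, _, _, _, _, rfl, rfl, colors_cross_zero.2
      ⟨_, _, _, _, rfl, rfl, colors_cross_one.2 ⟨_, _, _, _, _, rfl, rfl, ?_, rfl⟩⟩⟩,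
      fun m hm => ?_⟩
    · rw [(key x y z).1, (key x y z).2.1, (key x y z).2.2]
    · simp only [List.length_cons] at hm
      obtain ⟨g1, g2, g3⟩ := hgap x y z
      obtain ⟨e1, e2, e3⟩ := hsign x y z
      simp only [shift, List.map, stateSum_three, g1, g3, e1, e2, e3]
      rw [← g2, add_comm (_ + _) (a.colorSign x y), add_comm (c.colorSign y z), ← add_assoc]
      refine Eqv.smul _ (eqv_three habc _ _ _ Crossing.mark_ne Crossing.mark_ne Crossing.mark_ne
        ?_ ?_ ?_ (by omega)) <;>
      · intro h1 h2
        obtain ⟨v1, d1⟩ := of_decide_eq_true h1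
        obtain ⟨v2, d2⟩ := of_decide_eq_true h2
        by_cases hall : a ≠ .virt ∧ b ≠ .virt ∧ c ≠ .virt
        · obtain ⟨ha, hb, hc⟩ := hall
          have hs := hsum x y z ha hb hc
          refine decide_eq_true ⟨by assumption, ?_⟩
          simp only [hs] at d1 d2 ⊢
          first
            | exact (dvd_add_right d1).1 d2
            | exact dvd_add d1 d2
            | exact (dvd_add_left d2).1 d1
        -- A triangle with a virtual crossing has at least two of them, so two crossings cannot both
        -- be marked.
        · exfalso
          revert habc
          simp only [TriangleOK]
          tauto
  · intro ms h
    obtain ⟨x, y, z, r, ms, rfl, rfl, h1⟩ := colors_cross_one.1 h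
    obtain ⟨x', y', r', ms, e, rfl, h2⟩ := colors_cross_zero.1 h1
    simp only [List.cons.injEq] at e
    obtain ⟨rfl, rfl, rfl⟩ := e
    obtain ⟨c', x', y', r', ms, e, rfl, ⟨rfl, rfl⟩⟩ := colors_cross_one.1 h2
    simp only [List.cons.injEq] at e
    obtain ⟨rfl, rfl, rfl, rfl⟩ := e
    exact ⟨_, colors_cross_zero.2 ⟨x, y, _, _, rfl, rfl, colors_cross_one.2
      ⟨_, _, _, _, _, rfl, rfl, colors_cross_zero.2 ⟨_, _, _, _, rfl, rfl, by
        rw [(key x y z).1, (key x y z).2.1, (key x y z).2.2], rfl⟩⟩⟩⟩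

theorem ShapeColors.exists_cross {n : ℕ} {sh : Shape Crossing} {P Q : List Color} {μ : Bool × ℤ}
    (h : ShapeColors n sh P Q μ) (hμ : μ.1 = true) : ∃ k, sh = .cross k ∧ k ≠ .virt := by
  cases h with
  | cup => simp at hμ
  | cap => simp at hμ
  | cross k x y => exact ⟨k, rfl, Crossing.mark_ne hμ⟩

theorem PieceColors.exists_cross {n : ℕ} {sh : Shape Crossing} {i : ℕ} {s t : List Color}
    {μ : Bool × ℤ} (h : PieceColors n sh i s t μ) (hμ : μ.1 = true) :
    ∃ k, sh = .cross k ∧ k ≠ .virt := by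
  obtain ⟨l, P, Q, r, -, -, -, h⟩ := h.exists_append
  exact h.exists_cross hμ

theorem sameColors_exchange (n i : ℕ) (p q : Shape Crossing) (d : ℕ) :
    SameColors n i [⟨p, 0⟩, ⟨q, p.outs + d⟩] [⟨q, p.ins + d⟩, ⟨p, 0⟩] := by
  intro s t ht
  constructor
  · rintro _ ⟨_, μ, _, ⟨P, Q, r, rfl, rfl, hs⟩, ⟨_, ν, _, h, ⟨rfl, rfl⟩, rfl⟩, rfl⟩
    obtain ⟨l1, l2⟩ : P.length = p.ins ∧ Q.length = p.outs := hs.length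
    simp only [← l2] at h
    obtain ⟨t', rfl, h'⟩ := (pieceColors_append ..).1 h
    refine ⟨[ν, μ], ⟨P ++ t', ν, _, ?_, ⟨_, μ, _, ⟨P, Q, t', rfl, rfl, hs⟩, ⟨rfl, rfl⟩, rfl⟩, rfl⟩,
      fun m hm => ?_⟩
    · simp only [← l1]
      exact (pieceColors_append ..).2 ⟨t', rfl, h'⟩
    · have hr : d + q.ins ≤ r.length := (h'.isTangle (p := ⟨q, d⟩)).1
      simp only [List.length_append] at hm
      simp only [shift, List.map, stateSum_two, add_comm ν.2]
      refine Eqv.smul _ ?_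
      have := eqv_exchange (m := m) (i := i) (d := d) p q μ.1 ν.1 hs.exists_cross h'.exists_cross
        (by rw [← l1]; omega)
      simpa only [add_assoc, add_zero] using this
  · rintro _ ⟨s', ν, _, h, ⟨_, μ, _, ⟨P, Q, r, rfl, rfl, hs⟩, ⟨rfl, rfl⟩, rfl⟩, rfl⟩
    obtain ⟨k, h1, -⟩ := ht
    simp only [Nat.zero_add] at h1
    obtain ⟨l1, l2⟩ : P.length = p.ins ∧ Q.length = p.outs := hs.length
    -- The tangle hypothesis supplies enough strands at the bottom to split off those that enter
    -- `p`.
    obtain ⟨P', r', rfl, l3⟩ : ∃ P' r', s = P' ++ r' ∧ P'.length = p.ins :=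
      ⟨s.take p.ins, s.drop p.ins, (List.take_append_drop _ _).symm,
        by rw [List.length_take]; omega⟩
    simp only [← l3] at h
    obtain ⟨t', e, h'⟩ := (pieceColors_append ..).1 h
    obtain ⟨rfl, rfl⟩ := List.append_inj e (by omega)
    refine ⟨[μ, ν], ⟨Q ++ r', μ, _, ⟨P, Q, r', rfl, rfl, hs⟩, ⟨_, ν, _, ?_, ⟨rfl, rfl⟩, rfl⟩, rfl⟩⟩
    simp only [← l2]
    exact (pieceColors_append ..).2 ⟨_, rfl, h'⟩

/-- Nonemptiness of `u₀` is recorded because its first piece then ensures at least `i` strands at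
the bottom, enough to split the colours at position `i`. -/
theorem LocalMove.exists_shift {u v : Word Crossing} (h : LocalMove u v) :
    ∃ i u₀ v₀, u = shift i u₀ ∧ v = shift i v₀ ∧ u₀ ≠ [] ∧ ∀ n, SameColors n i u₀ v₀ := by
  cases h with
  | exchange p q i d =>
    exact ⟨i, _, _, by simp only [shift, List.map, add_zero, add_assoc],
      by simp only [shift, List.map, add_zero, add_assoc], by simp,
      fun n => sameColors_exchange n i p q d⟩
  | zigzag i => exact ⟨i, _, _, rfl, rfl, by simp, fun n => sameColors_zigzag n i⟩
  | zigzag' i => exact ⟨i, _, _, rfl, rfl, by simp, fun n => sameColors_zigzag' n i⟩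
  | swingCup k i => exact ⟨i, _, _, rfl, rfl, by simp, fun n => sameColors_swing_cup n i k⟩
  | swingCap k i => exact ⟨i, _, _, rfl, rfl, by simp, fun n => sameColors_swing_cap n i k⟩
  | oneCup k i => exact ⟨i, _, _, rfl, rfl, by simp, fun n => sameColors_curl_cup n i k⟩
  | oneCap k i => exact ⟨i, _, _, rfl, rfl, by simp, fun n => sameColors_curl_cap n i k⟩
  | two k i => exact ⟨i, _, _, rfl, rfl, by simp, fun n => sameColors_cross_turn n i k⟩
  | three a b c i h => exact ⟨i, _, _, rfl, rfl, by simp, fun n => sameColors_three n i h⟩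

theorem isTangle_of_shift {i k m : ℕ} {w : Word Crossing} (h : IsTangle (i + m) (shift i w) k) :
    ∃ k', IsTangle m w k' := by
  induction w generalizing m with
  | nil => exact ⟨m, rfl⟩
  | cons p w ih =>
    obtain ⟨h1, h2⟩ := h
    have e : i + m - p.shape.ins + p.shape.outs = i + (m - p.shape.ins + p.shape.outs) := by
      simp only at h1; omega
    simp only at h1 h2
    obtain ⟨k', hk'⟩ := ih (e ▸ h2)
    exact ⟨k', by omega, hk'⟩

/-- Backwards only the existence of a colouring is claimed. This is enough because on a knot the
value does not depend on the colouring (`Colors.evalWord_eq`). The tangle hypothesis is needed since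
an empty `v` admits colours on too few strands for `u`. -/
theorem LocalMove.colors {u v : Word Crossing} (h : LocalMove u v) (n : ℕ) (s t : List Color)
    (hs : ∃ k, IsTangle s.length u k) :
    (∀ ms, Colors n s u t ms → ∃ ms', Colors n s v t ms' ∧
      Eqv s.length (stateSum u ms) (stateSum v ms')) ∧
    (∀ ms', Colors n s v t ms' → ∃ ms, Colors n s u t ms) := by
  obtain ⟨i, u₀, v₀, rfl, rfl, hne, H⟩ := h.exists_shift
  obtain ⟨k, hk⟩ := hs
  have hi : i ≤ s.length := by
    cases u₀ with
    | nil => exact absurd rfl hne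
    | cons p u₀ =>
      have := hk.1
      simp only at this
      omega
  obtain ⟨l, r, rfl, rfl⟩ : ∃ l r, s = l ++ r ∧ l.length = i :=
    ⟨s.take i, s.drop i, (List.take_append_drop _ _).symm, by rw [List.length_take]; omega⟩
  rw [List.length_append] at hk ⊢
  have hr := isTangle_of_shift hk
  constructor
  · intro ms hm
    obtain ⟨t', rfl, hm'⟩ := (colors_shift ..).1 hm
    obtain ⟨ms', h1, h2⟩ := (H n r t' hr).1 ms hm'
    exact ⟨ms', (colors_shift ..).2 ⟨t', rfl, h1⟩, h2 _ le_rfl⟩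
  · intro ms hm
    obtain ⟨t', rfl, hm'⟩ := (colors_shift ..).1 hm
    obtain ⟨ms', h1⟩ := (H n r t' hr).2 ms hm'
    exact ⟨ms', (colors_shift ..).2 ⟨t', rfl, h1⟩⟩

theorem Move.colors {w w' : Word Crossing} (h : Move w w') {n : ℕ} {ms : List (Bool × ℤ)}
    (hc : Colors n [] w [] ms) : ∃ ms', Colors n [] w' [] ms' ∧
      evalWord (stateSum w ms) = evalWord (stateSum w' ms') := by
  obtain ⟨pre, u, v, suf, hm, rfl, rfl⟩ := h
  obtain ⟨t, ms₁, ms₂, hc1, hc2, rfl⟩ := (colors_append ..).1 hc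
  obtain ⟨s, ms₃, ms₄, hc3, hc4, rfl⟩ := (colors_append ..).1 hc1
  obtain ⟨ms', h1, h2⟩ := (hm.colors n s t ⟨_, hc4.isTangle⟩).1 _ hc4
  refine ⟨ms₃ ++ ms' ++ ms₂, (colors_append ..).2 ⟨t, _, _, (colors_append ..).2
    ⟨s, _, _, hc3, h1, rfl⟩, hc2, rfl⟩, Eqv.evalWord_eq ?_⟩
  rw [stateSum_append _ _ _ _ hc1.length_eq, stateSum_append _ _ _ _ hc3.length_eq,
    stateSum_append _ _ _ _ (by simp [hc3.length_eq, h1.length_eq]),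
    stateSum_append _ _ _ _ hc3.length_eq]
  exact (h2.mul_left hc3.stateSum_mem_tangles).mul_right _

theorem Move.exists_colors {w w' : Word Crossing} (h : Move w w') (hw : IsLinkDiagram w) {n : ℕ}
    {ms' : List (Bool × ℤ)} (hc : Colors n [] w' [] ms') : ∃ ms, Colors n [] w [] ms := by
  obtain ⟨pre, u, v, suf, hm, rfl, rfl⟩ := h
  obtain ⟨t, ms₁, ms₂, hc1, hc2, rfl⟩ := (colors_append ..).1 hc
  obtain ⟨s, ms₃, ms₄, hc3, hc4, rfl⟩ := (colors_append ..).1 hc1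
  obtain ⟨k, h1, -⟩ := (isTangle_append ..).1 hw
  obtain ⟨l, h2, h3⟩ := (isTangle_append ..).1 h1
  obtain rfl := isTangle_unique hc3.isTangle h2
  obtain ⟨ms, h4⟩ := (hm.colors n s t ⟨_, h3⟩).2 _ hc4
  exact ⟨_, (colors_append ..).2 ⟨t, _, _, (colors_append ..).2
    ⟨s, _, _, hc3, h4, rfl⟩, hc2, rfl⟩⟩

/-! ### The state sum as a sum over states -/

theorem resolve_append (u v : Word Crossing) (s : ℕ → Option Bool) :
    resolve (u ++ v) s = resolve u s ++ resolve v fun h => s (h + u.length) := by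
  induction u generalizing s with
  | nil => simp [resolve]
  | cons p u ih => simp [resolve, ih, add_assoc]

theorem resolve_congr (w : Word Crossing) {s s' : ℕ → Option Bool}
    (h : ∀ j < w.length, s j = s' j) : resolve w s = resolve w s' := by
  induction w generalizing s s' with
  | nil => rfl
  | cons p w ih =>
    rw [resolve, resolve, h 0 (by simp), ih fun j hj => h (j + 1) (by simpa using hj)]

open Classical in
/-- The choice of smoothings that belongs to the set `Z` of crossings with a `0`-smoothing. -/
noncomputable def stateChoice (C Z : Finset ℕ) (h : ℕ) : Option Bool :=
  if h ∈ C then some (decide (h ∈ Z)) else none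

open Classical in
/-- The weight of a state. -/
noncomputable def stateWeight (C Z : Finset ℕ) : ℤ[T;T⁻¹] :=
  ((A ^ ((Z.card : ℤ) - ((C \ Z).card : ℤ)) : ℤ[T;T⁻¹]ˣ) : ℤ[T;T⁻¹])

-- The product of the sums over both smoothings is multiplied out. The induction removes the last
-- piece, so that the remaining pieces keep their positions and `C` loses at most its greatest
-- possible element.
open Classical in
theorem stateSum_eq_sum (w : Word Crossing) (C : Finset ℕ) (hC : C ⊆ Finset.range w.length)
    (ε : ℕ → ℤ) :
    stateSum w ((List.range w.length).map fun h => (decide (h ∈ C), ε h)) =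
      writheFactor (∑ c ∈ Finset.range w.length, ε c) •
        ∑ Z ∈ C.powerset, stateWeight C Z • wordElt (flatten (resolve w (stateChoice C Z))) := by
  induction w using List.reverseRecOn generalizing C with
  | nil =>
    obtain rfl := Finset.subset_empty.1 hC
    simp [stateSum, writheFactor_zero, stateWeight, resolve, flatten, wordElt_nil]
  | append_singleton w p ih =>
    rw [List.length_append, List.length_singleton] at hC ⊢
    set N := w.length with hN
    have hC' : C.erase N ⊆ Finset.range N := by
      intro h hh
      obtain ⟨h1, h2⟩ := Finset.mem_erase.1 hh
      have := Finset.mem_range.1 (hC h2)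
      exact Finset.mem_range.2 (by omega)
    have hNC : N ∉ C.erase N := Finset.notMem_erase _ _
    have ih := ih (C.erase N) hC'
    have hmap : (List.range N).map (fun h => (decide (h ∈ C.erase N), ε h)) =
        (List.range N).map fun h => (decide (h ∈ C), ε h) := by
      refine List.map_congr_left fun h hh => ?_
      have : h ≠ N := (List.mem_range.1 hh).ne
      simp [this]
    rw [hmap] at ih
    rw [List.range_succ, List.map_append, stateSum_append _ _ _ _ (by simp [hN]), ih,
      Finset.sum_range_succ, writheFactor_add, List.map_singleton, stateSum_one,
      smul_mul_assoc, mul_smul_comm, smul_smul]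
    congr 1
    have hres : ∀ Z' Z : Finset ℕ, (∀ j < N, j ∈ Z' ↔ j ∈ Z) →
        resolve w (stateChoice (C.erase N) Z') = resolve w (stateChoice C Z) := by
      intro Z' Z hZ
      refine resolve_congr _ fun j hj => ?_
      have : j ≠ N := hj.ne
      simp [stateChoice, this, hZ j hj]
    have hfl : ∀ Z, wordElt (flatten (resolve (w ++ [p]) (stateChoice C Z))) =
        wordElt (flatten (resolve w (stateChoice C Z))) *
          wordElt (flatten (p.resolve (stateChoice C Z N))) := by
      intro Z
      rw [resolve_append, flatten_append, wordElt_append]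
      simp [resolve, hN]
    by_cases hN' : N ∈ C
    · have hins : C = insert N (C.erase N) := (Finset.insert_erase hN').symm
      -- The states are split according to the smoothing of the last crossing.
      have hsum : ∀ F : Finset ℕ → WordAlgebra, ∑ Z ∈ C.powerset, F Z =
          ∑ Z ∈ (C.erase N).powerset, F Z + ∑ Z ∈ (C.erase N).powerset, F (insert N Z) := by
        intro F
        conv_lhs => rw [hins]
        exact Finset.sum_powerset_insert hNC F
      rw [hsum, Finset.sum_mul, ← Finset.sum_add_distrib]
      refine Finset.sum_congr rfl fun Z hZ => ?_
      have hNZ : N ∉ Z := fun h => hNC (Finset.mem_powerset.1 hZ h)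
      have hNZ' : N ∉ C.erase N \ Z := fun h => hNC (Finset.mem_sdiff.1 h).1
      have e1 : C \ Z = insert N (C.erase N \ Z) := by
        conv_lhs => rw [hins]
        exact Finset.insert_sdiff_of_notMem _ hNZ
      have e2 : C \ insert N Z = C.erase N \ Z := by
        ext j
        simp only [Finset.mem_sdiff, Finset.mem_insert, Finset.mem_erase]
        tauto
      have w1 : stateWeight C Z = varB * stateWeight (C.erase N) Z := by
        rw [stateWeight, stateWeight, e1, Finset.card_insert_of_notMem hNZ', ← Units.val_mul,
          ← zpow_neg_one, ← zpow_add]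
        congr 2
        push_cast
        ring
      have w2 : stateWeight C (insert N Z) = varA * stateWeight (C.erase N) Z := by
        rw [stateWeight, stateWeight, e2, Finset.card_insert_of_notMem hNZ, ← Units.val_mul,
          ← zpow_one_add]
        congr 2
        push_cast
        ring
      have c1 : stateChoice C Z N = some false := by simp [stateChoice, hN', hNZ]
      have c2 : stateChoice C (insert N Z) N = some true := by simp [stateChoice, hN']
      rw [hfl, hfl, c1, c2, w1, w2, ← hres Z Z (fun _ _ => Iff.rfl),
        ← hres Z (insert N Z) (fun j hj => by simp [hj.ne])]
      simp only [hN', decide_true, pieceElt, if_true, mul_add, mul_smul_comm, smul_mul_assoc,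
        smul_smul]
      exact add_comm _ _
    · have hC'' : C.erase N = C := Finset.erase_eq_of_notMem hN'
      rw [hC'', Finset.sum_mul]
      refine Finset.sum_congr rfl fun Z hZ => ?_
      have c1 : stateChoice C Z N = none := by simp [stateChoice, hN']
      rw [hfl, c1]
      simp only [hN', decide_false, pieceElt, Bool.false_eq_true, if_false, smul_mul_assoc]

open Classical in
theorem graphicalJones_eq (n : ℕ) (K : KnotDiagram) (o : K.Orientation) :
    graphicalJones n K o = evalWord (stateSum K.word ((List.range K.word.length).map fun h =>
      (decide (h ∈ indexedCrossings n K.word o.up), sign K.word o.up h))) := by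
  rw [stateSum_eq_sum K.word (indexedCrossings n K.word o.up) (Finset.filter_subset _ _), map_smul,
    map_sum]
  unfold graphicalJones
  refine congrArg₂ _ rfl (Finset.sum_congr rfl fun Z _ => ?_)
  rw [map_smul, evalWord_wordElt, wordValue, dif_pos]
  · refine congrArg₂ _ ?_ ?_
    · rw [stateWeight]
    · unfold stateChoice KnotDiagram.flatState
      congr!
  · exact ⟨isTangle_flatten _ _ _ (isTangle_resolve _ _ _ _ K.isClosed),
      flatten_resolve_ne_nil _ _ K.isClosed K.ne_nil⟩

/-! ### Potentials on the points of a diagram -/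

/-- A discrete primitive on a circle: the increments are summed from a base point, and the zero
total makes this consistent after one turn. -/
theorem exists_potential_of_sameCycle {α : Type*} [Fintype α] (f : Equiv.Perm α)
    (hf : ∀ x y, f.SameCycle x y) (c : α → ℤ) (hc : ∑ x, c x = 0) :
    ∃ φ : α → ℤ, ∀ x, φ (f x) = φ x + c x := by
  rcases isEmpty_or_nonempty α with h | ⟨⟨x₀⟩⟩
  · exact ⟨fun _ => 0, fun x => (h.false x).elim⟩
  have hcyc : f.IsCycleOn ((Finset.univ : Finset α) : Set α) :=
    ⟨by simp, fun x _ y _ => hf x y⟩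
  have hx₀ : x₀ ∈ Finset.univ := Finset.mem_univ _
  choose k hk hkx using fun x : α => hcyc.exists_pow_eq hx₀ (Finset.mem_univ x)
  refine ⟨fun x => ∑ i ∈ Finset.range (k x), c ((f ^ i) x₀), fun x => ?_⟩
  have hmod : k (f x) ≡ k x + 1 [MOD (Finset.univ : Finset α).card] := by
    rw [← hcyc.pow_apply_eq_pow_apply hx₀, hkx, pow_succ', Equiv.Perm.mul_apply, hkx]
  have hsucc : ∑ i ∈ Finset.range (k x), c ((f ^ i) x₀) + c x =
      ∑ i ∈ Finset.range (k x + 1), c ((f ^ i) x₀) := by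
    rw [Finset.sum_range_succ, hkx]
  rw [hsucc]
  change ∑ i ∈ Finset.range (k (f x)), c ((f ^ i) x₀) = _
  rcases lt_or_ge (k x + 1) (Finset.univ : Finset α).card with hlt | hge
  · rw [Nat.ModEq, Nat.mod_eq_of_lt (hk _), Nat.mod_eq_of_lt hlt] at hmod
    rw [hmod]
  -- This is the step back to the base point, where the partial sum has become the whole sum.
  · have hN : k x + 1 = (Finset.univ : Finset α).card := le_antisymm (hk x) hge
    rw [Nat.ModEq, Nat.mod_eq_of_lt (hk _), hN, Nat.mod_self] at hmod
    rw [hmod, hN, Finset.range_zero, Finset.sum_empty, ← hc]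
    symm
    refine Finset.sum_nbij (fun i => (f ^ i) x₀) (fun _ _ => Finset.mem_univ _) ?_ ?_
      (fun _ _ => rfl)
    · intro i hi j hj hij
      have := (hcyc.pow_apply_eq_pow_apply hx₀).1 hij
      rwa [Nat.ModEq, Nat.mod_eq_of_lt (Finset.mem_range.1 hi),
        Nat.mod_eq_of_lt (Finset.mem_range.1 hj)] at this
    · intro y _
      exact ⟨k y, Finset.mem_coe.2 (Finset.mem_range.2 (hk y)), hkx y⟩

/-- The other end of the arc that ends at a given end. -/
def Piece.other (p : Piece Crossing) : End → End
  | .bot j =>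
    if j < p.pos then .top j
    else if p.pos + p.shape.ins ≤ j then .top (j - p.shape.ins + p.shape.outs)
    else match p.shape with
      | .cap => .bot (2 * p.pos + 1 - j)
      | _ => .top (2 * p.pos + 1 - j)
  | .top j =>
    if j < p.pos then .bot j
    else if p.pos + p.shape.outs ≤ j then .bot (j - p.shape.outs + p.shape.ins)
    else match p.shape with
      | .cup => .top (2 * p.pos + 1 - j)
      | _ => .bot (2 * p.pos + 1 - j)

theorem Piece.Arc.other_eq {p : Piece Crossing} {e e' : End} (h : p.Arc e e') :
    p.other e = e' ∧ p.other e' = e := by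
  cases h with
  | left _ j hj => simp [Piece.other, hj]
  | right _ j =>
    have h1 : ¬ p.pos + p.shape.ins + j < p.pos := by omega
    have h2 : ¬ p.pos + p.shape.outs + j < p.pos := by omega
    have h3 : p.pos + p.shape.ins + j - p.shape.ins + p.shape.outs = p.pos + p.shape.outs + j := by
      omega
    have h4 : p.pos + p.shape.outs + j - p.shape.outs + p.shape.ins = p.pos + p.shape.ins + j := by
      omega
    simp [Piece.other, h1, h2, h3, h4]
  | cup i => simp [Piece.other, Shape.outs]; omega
  | cap i => simp [Piece.other, Shape.ins]; omega
  | crossRight k i => simp [Piece.other, Shape.ins, Shape.outs]; omega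
  | crossLeft k i => simp [Piece.other, Shape.ins, Shape.outs]; omega

theorem Piece.exists_arc (p : Piece Crossing) (e : End) : ∃ e', p.Arc e e' ∨ p.Arc e' e := by
  obtain ⟨sh, i⟩ := p
  cases e with
  | bot j =>
    by_cases h1 : j < i
    · exact ⟨_, Or.inl (.left ⟨sh, i⟩ j h1)⟩
    by_cases h2 : i + sh.ins ≤ j
    · obtain ⟨d, rfl⟩ := Nat.exists_eq_add_of_le h2
      exact ⟨_, Or.inl (.right ⟨sh, i⟩ d)⟩
    cases sh with
    | cup => simp only [Shape.ins] at h2; omega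
    | cap =>
      obtain rfl | rfl : j = i ∨ j = i + 1 := by simp only [Shape.ins] at h2; omega
      · exact ⟨_, Or.inl (.cap _)⟩
      · exact ⟨_, Or.inr (.cap _)⟩
    | cross k =>
      obtain rfl | rfl : j = i ∨ j = i + 1 := by simp only [Shape.ins] at h2; omega
      · exact ⟨_, Or.inl (.crossRight _ _)⟩
      · exact ⟨_, Or.inl (.crossLeft _ _)⟩
  | top j =>
    by_cases h1 : j < i
    · exact ⟨_, Or.inr (.left ⟨sh, i⟩ j h1)⟩
    by_cases h2 : i + sh.outs ≤ j
    · obtain ⟨d, rfl⟩ := Nat.exists_eq_add_of_le h2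
      exact ⟨_, Or.inr (.right ⟨sh, i⟩ d)⟩
    cases sh with
    | cap => simp only [Shape.outs] at h2; omega
    | cup =>
      obtain rfl | rfl : j = i ∨ j = i + 1 := by simp only [Shape.outs] at h2; omega
      · exact ⟨_, Or.inl (.cup _)⟩
      · exact ⟨_, Or.inr (.cup _)⟩
    | cross k =>
      obtain rfl | rfl : j = i ∨ j = i + 1 := by simp only [Shape.outs] at h2; omega
      · exact ⟨_, Or.inr (.crossLeft _ _)⟩
      · exact ⟨_, Or.inr (.crossRight _ _)⟩

theorem width_succ (w : Word Crossing) {h : ℕ} {p : Piece Crossing} (hp : w[h]? = some p) :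
    width w (h + 1) = width w h - p.shape.ins + p.shape.outs := by
  rw [width, width, List.take_add_one, hp, List.foldl_append]
  rfl

theorem isTangle_take_drop (w : Word Crossing) (hw : IsLinkDiagram w) (h : ℕ) :
    IsTangle (width w h) (w.drop h) 0 := by
  induction h with
  | zero => exact hw
  | succ h ih =>
    cases hp : w[h]? with
    | none =>
      have hl : w.length ≤ h := List.getElem?_eq_none_iff.1 hp
      rw [List.drop_eq_nil_of_le hl] at ih
      rw [List.drop_eq_nil_of_le (by omega)]
      rw [width, List.take_of_length_le (by omega)]
      rwa [width, List.take_of_length_le hl] at ih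
    | some p =>
      obtain ⟨hl, rfl⟩ := List.getElem?_eq_some_iff.1 hp
      rw [List.drop_eq_getElem_cons hl] at ih
      rw [width_succ w hp]
      exact ih.2

theorem pos_add_ins_le {w : Word Crossing} (hw : IsLinkDiagram w) {h : ℕ} {p : Piece Crossing}
    (hp : w[h]? = some p) : p.pos + p.shape.ins ≤ width w h := by
  have := isTangle_take_drop w hw h
  obtain ⟨hl, rfl⟩ := List.getElem?_eq_some_iff.1 hp
  rw [List.drop_eq_getElem_cons hl] at this
  exact this.1

theorem width_of_length_le {w : Word Crossing} (hw : IsLinkDiagram w) {h : ℕ}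
    (hl : w.length ≤ h) : width w h = 0 := by
  have := isTangle_take_drop w hw h
  rwa [List.drop_eq_nil_of_le hl] at this

/-- The points of a diagram. -/
def InDiagram (w : Word Crossing) (x : ℕ × ℕ) : Prop := x.2 < width w x.1

theorem arc_inDiagram {w : Word Crossing} (hw : IsLinkDiagram w) {h : ℕ} {e e' : End}
    (ha : arcs w h e e') : InDiagram w (e.point h) ↔ InDiagram w (e'.point h) := by
  obtain ⟨p, hp, ha⟩ := ha
  have h1 := pos_add_ins_le hw hp
  have h2 := width_succ w hp
  cases ha <;> simp only [InDiagram, End.point, h2, Shape.ins, Shape.outs] at * <;> omega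

variable {K : KnotDiagram} (o : K.Orientation)

/-- The strand that leaves `x` along the orientation next passes through `y`. -/
def KnotDiagram.Orientation.Next (x y : ℕ × ℕ) : Prop :=
  ∃ h e e', (arcs K.word h e e' ∨ arcs K.word h e' e) ∧ x = e.point h ∧ y = e'.point h ∧
    o.up x = !e.isTop ∧ o.up y = e'.isTop

variable {o}

theorem KnotDiagram.Orientation.next_of_arc {h : ℕ} {e e' : End}
    (ha : arcs K.word h e e' ∨ arcs K.word h e' e) (hx : o.up (e.point h) = !e.isTop) :
    o.Next (e.point h) (e'.point h) := by
  refine ⟨h, e, e', ha, rfl, rfl, hx, ?_⟩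
  rcases ha with ha | ha <;> have := o.compatible _ _ _ ha <;> revert this <;>
    cases e <;> cases e' <;> simp_all [End.isTop]

theorem KnotDiagram.Orientation.next_or_next {h : ℕ} {e e' : End}
    (ha : arcs K.word h e e' ∨ arcs K.word h e' e) :
    (o.Next (e.point h) (e'.point h) ∧ o.up (e.point h) = !e.isTop ∧
      o.up (e'.point h) = e'.isTop) ∨
    (o.Next (e'.point h) (e.point h) ∧ o.up (e.point h) = e.isTop ∧
      o.up (e'.point h) = !e'.isTop) := by
  by_cases hx : o.up (e.point h) = !e.isTop
  · refine Or.inl ⟨next_of_arc ha hx, hx, ?_⟩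
    rcases ha with ha | ha <;> have := o.compatible _ _ _ ha <;> revert this <;>
      cases e <;> cases e' <;> simp_all [End.isTop]
  · have hx' : o.up (e'.point h) = !e'.isTop := by
      rcases ha with ha | ha <;> have := o.compatible _ _ _ ha <;> revert this <;>
        cases e <;> cases e' <;> simp_all [End.isTop]
    refine Or.inr ⟨next_of_arc ha.symm hx', ?_, hx'⟩
    revert hx
    cases o.up (e.point h) <;> cases e.isTop <;> simp

theorem arc_partner {w : Word Crossing} {h : ℕ} {e e₁ e₂ : End}
    (h₁ : arcs w h e e₁ ∨ arcs w h e₁ e) (h₂ : arcs w h e e₂ ∨ arcs w h e₂ e) : e₁ = e₂ := by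
  have key : ∀ e', arcs w h e e' ∨ arcs w h e' e → ∃ p, w[h]? = some p ∧ p.other e = e' := by
    rintro e' (⟨p, hp, ha⟩ | ⟨p, hp, ha⟩)
    · exact ⟨p, hp, ha.other_eq.1⟩
    · exact ⟨p, hp, ha.other_eq.2⟩
  obtain ⟨p, hp, rfl⟩ := key _ h₁
  obtain ⟨q, hq, rfl⟩ := key _ h₂
  rw [hp] at hq
  obtain rfl := Option.some.inj hq
  rfl

theorem End.point_inj {h h' : ℕ} {e e' : End} (hp : e.point h = e'.point h')
    (ht : e.isTop = e'.isTop) : h = h' ∧ e = e' := by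
  cases e <;> cases e' <;> simp_all [End.point, End.isTop]

theorem KnotDiagram.Orientation.Next.unique {x y y' : ℕ × ℕ} (h : o.Next x y)
    (h' : o.Next x y') : y = y' := by
  obtain ⟨i, e, f, ha, rfl, rfl, h1, -⟩ := h
  obtain ⟨i', e', f', ha', h2, rfl, h3, -⟩ := h'
  obtain ⟨rfl, rfl⟩ := End.point_inj h2 (by
    rw [h1] at h3; cases e <;> cases e' <;> simp_all [End.isTop])
  rw [arc_partner ha ha']

theorem KnotDiagram.Orientation.Next.injective {x x' y : ℕ × ℕ} (h : o.Next x y)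
    (h' : o.Next x' y) : x = x' := by
  obtain ⟨i, e, f, ha, rfl, rfl, -, h1⟩ := h
  obtain ⟨i', e', f', ha', rfl, h2, -, h3⟩ := h'
  obtain ⟨rfl, rfl⟩ := End.point_inj h2 (h1.symm.trans h3)
  rw [arc_partner ha.symm ha'.symm]

theorem KnotDiagram.Orientation.Next.inDiagram_iff {x y : ℕ × ℕ} (h : o.Next x y) :
    InDiagram K.word x ↔ InDiagram K.word y := by
  obtain ⟨i, e, f, ha | ha, rfl, rfl, -⟩ := h
  · exact arc_inDiagram K.isClosed ha
  · exact (arc_inDiagram K.isClosed ha).symm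

theorem KnotDiagram.Orientation.exists_next {x : ℕ × ℕ} (hx : InDiagram K.word x) :
    ∃ y, o.Next x y := by
  obtain ⟨h, j⟩ := x
  have hlen : h < K.word.length := by
    by_contra hl
    simp [InDiagram, width_of_length_le K.isClosed (not_lt.1 hl)] at hx
  -- A strand directed upwards at level `h` enters piece `h`; one directed downwards enters piece `h
  -- - 1` from above.
  cases hu : o.up (h, j) with
  | true =>
    obtain ⟨e', he'⟩ := K.word[h].exists_arc (.bot j)
    have ha : arcs K.word h (.bot j) e' ∨ arcs K.word h e' (.bot j) :=
      he'.imp (fun h' => ⟨_, List.getElem?_eq_getElem hlen, h'⟩)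
        fun h' => ⟨_, List.getElem?_eq_getElem hlen, h'⟩
    exact ⟨_, next_of_arc ha hu⟩
  | false =>
    cases h with
    | zero => simp [InDiagram, width] at hx
    | succ h =>
      have hlen' : h < K.word.length := by omega
      obtain ⟨e', he'⟩ := K.word[h].exists_arc (.top j)
      have ha : arcs K.word h (.top j) e' ∨ arcs K.word h e' (.top j) :=
        he'.imp (fun h' => ⟨_, List.getElem?_eq_getElem hlen', h'⟩)
          fun h' => ⟨_, List.getElem?_eq_getElem hlen', h'⟩
      exact ⟨_, next_of_arc ha hu⟩

/-- The points of a diagram, as a finite type. -/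
abbrev PointType (w : Word Crossing) : Type := Σ h : Fin (w.length + 1), Fin (width w h)

/-- The point that an element of `PointType` stands for. -/
def PointType.val {w : Word Crossing} (x : PointType w) : ℕ × ℕ := (x.1, x.2)

theorem PointType.val_injective {w : Word Crossing} :
    Function.Injective (PointType.val (w := w)) := by
  rintro ⟨⟨h, hh⟩, ⟨j, hj⟩⟩ ⟨⟨h', hh'⟩, ⟨j', hj'⟩⟩ e
  simp only [PointType.val, Prod.mk.injEq] at e
  obtain ⟨rfl, rfl⟩ := e
  rfl

theorem PointType.inDiagram {w : Word Crossing} (x : PointType w) : InDiagram w x.val := x.2.2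

theorem exists_pointType {w : Word Crossing} (hw : IsLinkDiagram w) {x : ℕ × ℕ}
    (hx : InDiagram w x) : ∃ y : PointType w, y.val = x := by
  have : x.1 < w.length + 1 := by
    by_contra hl
    simp [InDiagram, width_of_length_le hw (by omega : w.length ≤ x.1)] at hx
  exact ⟨⟨⟨x.1, this⟩, ⟨x.2, hx⟩⟩, rfl⟩

/-- If the total of the jumps `J` along a knot is zero, then there is a function on its points that
changes exactly by these jumps (`J x` being the jump that takes place just below the point `x`). -/
theorem KnotDiagram.exists_potential (o : K.Orientation) (J : ℕ × ℕ → ℤ)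
    (hJ : ∑ h ∈ Finset.range (K.word.length + 1), ∑ j ∈ Finset.range (width K.word h),
      upSign (o.up (h, j)) * J (h, j) = 0) :
    ∃ φ : ℕ × ℕ → ℤ, (∀ x, ¬ InDiagram K.word x → φ x = 0) ∧
      ∀ h e e', arcs K.word h e e' → InDiagram K.word (e.point h) →
        φ (e.point h) - (if e.isTop then J (e.point h) else 0) =
          φ (e'.point h) - (if e'.isTop then J (e'.point h) else 0) := by
  classical
  have hnext : ∀ x : PointType K.word, ∃ y : PointType K.word, o.Next x.val y.val := by
    intro x
    obtain ⟨y, hy⟩ := Orientation.exists_next (o := o) x.inDiagram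
    obtain ⟨y, rfl⟩ := exists_pointType K.isClosed (hy.inDiagram_iff.1 x.inDiagram)
    exact ⟨y, hy⟩
  choose f hf using hnext
  have hinj : Function.Injective f := fun x y hxy =>
    PointType.val_injective ((hf x).injective (hxy ▸ hf y))
  let g : Equiv.Perm (PointType K.word) :=
    Equiv.ofBijective f (Finite.injective_iff_bijective.1 hinj)
  have hg : ∀ x, g x = f x := fun _ => rfl
  have hgn : ∀ x y : PointType K.word, o.Next x.val y.val → g x = y := fun x y h =>
    PointType.val_injective ((hf x).unique h)
  -- Having one component means that the successor permutation is a single cycle.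
  have hcyc : ∀ x y, g.SameCycle x y := by
    have key : ∀ x y, SameComponent (arcs K.word) x y →
        (InDiagram K.word x ↔ InDiagram K.word y) ∧
        ∀ a b : PointType K.word, a.val = x → b.val = y → g.SameCycle a b := by
      intro x y hxy
      induction hxy with
      | rel x y h =>
        obtain ⟨h, e, e', ha, rfl, rfl⟩ := h
        refine ⟨arc_inDiagram K.isClosed ha, fun a b ha' hb' => ?_⟩
        rcases Orientation.next_or_next (o := o) (Or.inl ha) with ⟨h1, -⟩ | ⟨h1, -⟩
        · rw [← ha', ← hb'] at h1
          rw [← hgn a b h1]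
          exact (Equiv.Perm.sameCycle_apply_right).2 (Equiv.Perm.SameCycle.refl _ _)
        · rw [← ha', ← hb'] at h1
          rw [← hgn b a h1]
          exact (Equiv.Perm.sameCycle_apply_left).2 (Equiv.Perm.SameCycle.refl _ _)
      | refl x =>
        refine ⟨Iff.rfl, fun a b ha hb => ?_⟩
        rw [PointType.val_injective (ha.trans hb.symm)]
      | symm x y _ ih => exact ⟨ih.1.symm, fun a b ha hb => (ih.2 b a hb ha).symm⟩
      | trans x y z _ _ ih ih' =>
        refine ⟨ih.1.trans ih'.1, fun a b ha hb => ?_⟩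
        obtain ⟨c, hc⟩ := exists_pointType K.isClosed (ih.1.1 (ha ▸ a.inDiagram))
        exact (ih.2 a c ha hc).trans (ih'.2 c b hc hb)
    exact fun x y => (key _ _ (K.connected _ _ x.inDiagram y.inDiagram)).2 x y rfl rfl
  -- The step from `x` to `g x` undoes the jump below `x` if it leaves downwards, and makes the jump
  -- below `g x` if it arrives upwards. Since `g` is a permutation, both contributions can be
  -- collected at the same point, which gives the sum in `hJ`.
  have hsum : ∑ x : PointType K.word, ((if o.up x.val then 0 else -J x.val) +
      (if o.up (g x).val then J (g x).val else 0)) = 0 := by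
    rw [Finset.sum_add_distrib,
      Equiv.sum_comp g fun x : PointType K.word => if o.up x.val then J x.val else 0,
      ← Finset.sum_add_distrib, Fintype.sum_sigma]
    refine Eq.trans ?_ hJ
    rw [← Fin.sum_univ_eq_sum_range (fun h => ∑ j ∈ Finset.range (width K.word h),
        upSign (o.up (h, j)) * J (h, j))]
    refine Finset.sum_congr rfl fun h _ => ?_
    rw [← Fin.sum_univ_eq_sum_range (fun j => upSign (o.up (h, j)) * J (h, j))]
    refine Finset.sum_congr rfl fun j _ => ?_
    simp only [PointType.val, upSign]
    by_cases hu : o.up (h, j) = true <;> simp [hu]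
  obtain ⟨φ, hφ⟩ := exists_potential_of_sameCycle g hcyc _ hsum
  refine ⟨fun x => if hx : ∃ y : PointType K.word, y.val = x then φ hx.choose else 0, ?_, ?_⟩
  · intro x hx
    refine dif_neg ?_
    rintro ⟨y, rfl⟩
    exact hx y.inDiagram
  · have hval : ∀ a : PointType K.word,
        (if hx : ∃ y : PointType K.word, y.val = a.val then φ hx.choose else 0) = φ a := by
      intro a
      have hx : ∃ y : PointType K.word, y.val = a.val := ⟨a, rfl⟩
      rw [dif_pos hx, PointType.val_injective hx.choose_spec]
    intro h e e' ha hx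
    obtain ⟨a, hav⟩ := exists_pointType K.isClosed hx
    obtain ⟨b, hbv⟩ := exists_pointType K.isClosed ((arc_inDiagram K.isClosed ha).1 hx)
    have key := Orientation.next_or_next (o := o) (Or.inl ha)
    simp only [← hav, ← hbv] at key ⊢
    rw [hval, hval]
    rcases key with ⟨h1, h2, h3⟩ | ⟨h1, h2, h3⟩
    · have := hφ a
      rw [hgn _ _ h1, h2, h3] at this
      rw [this]
      cases e.isTop <;> cases e'.isTop <;> simp <;> ring
    · have := hφ b
      rw [hgn _ _ h1, h2, h3] at this
      rw [this]
      cases e.isTop <;> cases e'.isTop <;> simp <;> ring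

end VirtualKnots

/-! ### Labels with prescribed jumps, and colourings of knot diagrams. -/

namespace VirtualKnots

/-- How a potential changes at a piece, with the jumps `α` and `β` on the strands that rise to the
right and to the left at a crossing. -/
structure PotentialStep (p : Piece Crossing) (α β : ℤ) (f g : ℕ → ℤ) : Prop where
  left : ∀ j < p.pos, g j = f j
  right : ∀ j, g (p.pos + p.shape.outs + j) = f (p.pos + p.shape.ins + j)
  cup : p.shape = .cup → g (p.pos + 1) = g p.pos
  cap : p.shape = .cap → f (p.pos + 1) = f p.pos
  cross : ∀ k, p.shape = .cross k → g p.pos = f (p.pos + 1) + β ∧ g (p.pos + 1) = f p.pos + α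

/-- The jump just below a point that corresponds to jumps `α` and `β` at the crossings. -/
def crossingJump (w : Word Crossing) (α β : ℕ → ℤ) : ℕ × ℕ → ℤ
  | (0, _) => 0
  | (h + 1, j) => match w[h]? with
    | some ⟨.cross _, i⟩ => if j = i then β h else if j = i + 1 then α h else 0
    | _ => 0

/-- The hypothesis says that the jumps of the two strands of a crossing, measured along the
orientation, cancel. A knot passes each crossing on both strands, so its total jump is zero. -/
theorem KnotDiagram.exists_potentialStep {K : KnotDiagram} (o : K.Orientation) (α β : ℕ → ℤ)
    (hαβ : ∀ h k i, K.word[h]? = some (VirtualKnots.cross k i) →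
      upSign (o.up (h, i)) * α h + upSign (o.up (h, i + 1)) * β h = 0) :
    ∃ φ : ℕ × ℕ → ℤ, ∀ h p, K.word[h]? = some p →
      PotentialStep p (α h) (β h) (fun j => φ (h, j)) (fun j => φ (h + 1, j)) := by
  obtain ⟨φ, h0, hφ⟩ := K.exists_potential o (crossingJump K.word α β) (by
    rw [Finset.sum_range_succ']
    have hz : ∑ j ∈ Finset.range (width K.word 0),
        upSign (o.up (0, j)) * crossingJump K.word α β (0, j) = 0 := by
      simp [crossingJump]
    rw [hz, add_zero]
    refine Finset.sum_eq_zero fun h _ => ?_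
    cases hp : K.word[h]? with
    | none => exact Finset.sum_eq_zero fun j _ => by simp [crossingJump, hp]
    | some p =>
      obtain ⟨sh, i⟩ := p
      cases sh with
      | cup => exact Finset.sum_eq_zero fun j _ => by simp [crossingJump, hp]
      | cap => exact Finset.sum_eq_zero fun j _ => by simp [crossingJump, hp]
      | cross k =>
        have h1 := pos_add_ins_le K.isClosed hp
        have h2 := width_succ K.word hp
        simp only [Shape.ins, Shape.outs] at h1 h2
        have hsub : ({i, i + 1} : Finset ℕ) ⊆ Finset.range (width K.word (h + 1)) := by
          intro j hj
          simp only [Finset.mem_insert, Finset.mem_singleton] at hj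
          rw [Finset.mem_range]
          omega
        rw [← Finset.sum_subset hsub, Finset.sum_pair (by omega)]
        · have a1 : arcs K.word h (.bot i) (.top (i + 1)) := ⟨_, hp, .crossRight k i⟩
          have a2 : arcs K.word h (.bot (i + 1)) (.top i) := ⟨_, hp, .crossLeft k i⟩
          have e1 := (o.compatible _ _ _ a1).2 (by simp [End.isTop])
          have e2 := (o.compatible _ _ _ a2).2 (by simp [End.isTop])
          simp only [End.point] at e1 e2
          have := hαβ h k i hp
          simp only [crossingJump, hp, ← e1, ← e2, if_true, Nat.succ_ne_self, if_false]
          linarith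
        · intro j _ hj
          simp only [Finset.mem_insert, Finset.mem_singleton, not_or] at hj
          simp [crossingJump, hp, hj.1, hj.2])
  -- Outside the diagram `φ` is `0`, so the equation extends to arcs there that carry no jump;
  -- `PotentialStep.right` asks for all places on the right, without a bound.
  have hφ' : ∀ h e e', arcs K.word h e e' →
      (InDiagram K.word (e.point h) ∨ ((e.isTop = true → crossingJump K.word α β (e.point h) = 0) ∧
        (e'.isTop = true → crossingJump K.word α β (e'.point h) = 0))) →
      φ (e.point h) - (if e.isTop then crossingJump K.word α β (e.point h) else 0) =
        φ (e'.point h) - (if e'.isTop then crossingJump K.word α β (e'.point h) else 0) := by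
    intro h e e' ha hx
    by_cases hd : InDiagram K.word (e.point h)
    · exact hφ h e e' ha hd
    · obtain ⟨j1, j2⟩ := hx.resolve_left hd
      rw [h0 _ hd, h0 _ fun h' => hd ((arc_inDiagram K.isClosed ha).2 h')]
      cases e <;> cases e' <;> simp_all [End.isTop]
  refine ⟨φ, fun h p hp => ?_⟩
  have hle := pos_add_ins_le K.isClosed hp
  have hw := width_succ K.word hp
  constructor
  · intro j hj
    have := hφ' h _ _ ⟨p, hp, .left p j hj⟩ (Or.inl (by
      simp only [InDiagram, End.point]; omega))
    have hJ : crossingJump K.word α β (h + 1, j) = 0 := by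
      obtain ⟨_ | _ | _, i⟩ := p <;> simp only [crossingJump, hp]
      simp only at hj
      rw [if_neg (by omega), if_neg (by omega)]
    simp [End.point, End.isTop, hJ] at this
    exact this.symm
  · intro j
    have hJ : crossingJump K.word α β (h + 1, p.pos + p.shape.outs + j) = 0 := by
      obtain ⟨_ | _ | k, i⟩ := p <;> simp only [crossingJump, hp]
      have e1 : ¬ i + (Shape.cross k).outs + j = i := by simp only [Shape.outs]; omega
      have e2 : ¬ i + (Shape.cross k).outs + j = i + 1 := by simp only [Shape.outs]; omega
      rw [if_neg e1, if_neg e2]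
    have := hφ' h _ _ ⟨p, hp, .right p j⟩ (Or.inr ⟨by simp [End.isTop], fun _ => hJ⟩)
    simp [End.point, End.isTop, hJ] at this
    exact this.symm
  · intro hs
    obtain ⟨sh, i⟩ := p
    obtain rfl : sh = .cup := hs
    have := hφ' h _ _ ⟨_, hp, .cup i⟩ (Or.inl (by
      simp only [InDiagram, End.point, hw, Shape.ins, Shape.outs] at *; omega))
    simp [End.point, End.isTop, crossingJump, hp] at this
    exact this.symm
  · intro hs
    obtain ⟨sh, i⟩ := p
    obtain rfl : sh = .cap := hs
    have := hφ' h _ _ ⟨_, hp, .cap i⟩ (Or.inl (by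
      simp only [InDiagram, End.point, Shape.ins] at *; omega))
    simp [End.point, End.isTop] at this
    exact this.symm
  · intro k hs
    obtain ⟨sh, i⟩ := p
    obtain rfl : sh = .cross k := hs
    have h1 := hφ' h _ _ ⟨_, hp, .crossRight k i⟩ (Or.inl (by
      simp only [InDiagram, End.point, Shape.ins] at *; omega))
    have h2 := hφ' h _ _ ⟨_, hp, .crossLeft k i⟩ (Or.inl (by
      simp only [InDiagram, End.point, Shape.ins] at *; omega))
    simp [End.point, End.isTop, crossingJump, hp] at h1 h2
    constructor
    · simp only; linarith
    · simp only; linarith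

/-- The colours of the points below and above a piece. -/
structure ColorStep (p : Piece Crossing) (f g : ℕ → Color) : Prop where
  left : ∀ j < p.pos, g j = f j
  right : ∀ j, g (p.pos + p.shape.outs + j) = f (p.pos + p.shape.ins + j)
  cup : p.shape = .cup → g (p.pos + 1) = (g p.pos).rev
  cap : p.shape = .cap → f (p.pos + 1) = (f p.pos).rev
  cross : ∀ k, p.shape = .cross k → g p.pos = k.colorLeft (f p.pos) (f (p.pos + 1)) ∧
    g (p.pos + 1) = k.colorRight (f p.pos) (f (p.pos + 1))

/-- A colouring of the points of a word. -/
def PointColors (w : Word Crossing) (col : ℕ × ℕ → Color) : Prop :=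
  ∀ h p, w[h]? = some p → ColorStep p (fun j => col (h, j)) (fun j => col (h + 1, j))

/-- The mark and the sign of a piece, given the colours of the points below it. -/
def pieceMark (n : ℕ) (p : Piece Crossing) (f : ℕ → Color) : Bool × ℤ :=
  match p.shape with
  | .cross k => (k.mark n (f p.pos) (f (p.pos + 1)), k.colorSign (f p.pos) (f (p.pos + 1)))
  | _ => (false, 0)

/-- The jump of each strand at a real crossing is, up to sign, the direction of the other strand.
Along the orientation the two jumps are a product of the directions and its negative, so they
cancel. -/
theorem exists_pointColors (K : KnotDiagram) (o : K.Orientation) :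
    ∃ col, PointColors K.word col := by
  classical
  obtain ⟨φ, hφ⟩ := K.exists_potentialStep o
    (fun h => match K.word[h]? with
      | some ⟨.cross k, i⟩ => if k = .virt then 0 else upSign (o.up (h, i + 1))
      | _ => 0)
    (fun h => match K.word[h]? with
      | some ⟨.cross k, i⟩ => if k = .virt then 0 else -upSign (o.up (h, i))
      | _ => 0)
    (by
      intro h k i hp
      simp only [hp]
      split <;> ring)
  refine ⟨fun x => ⟨o.up x, φ x⟩, fun h p hp => ?_⟩
  have st := hφ h p hp
  have up : ∀ e e', p.Arc e e' → (o.up (e.point h) = o.up (e'.point h) ↔ e.isTop ≠ e'.isTop) :=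
    fun e e' ha => o.compatible h e e' ⟨p, hp, ha⟩
  constructor
  · intro j hj
    have h1 := (up _ _ (.left p j hj)).2 (by simp [End.isTop])
    simp only [End.point] at h1
    exact congrArg₂ Color.mk h1.symm (st.left j hj)
  · intro j
    have h1 := (up _ _ (.right p j)).2 (by simp [End.isTop])
    simp only [End.point] at h1
    exact congrArg₂ Color.mk h1.symm (st.right j)
  · intro hs
    have h0 := st.cup hs
    obtain ⟨sh, i⟩ := p
    obtain rfl : sh = .cup := hs
    have h1 := up _ _ (.cup i)
    simp only [End.point, End.isTop, ne_eq, not_true_eq_false, iff_false] at h1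
    simp only [Color.rev, Color.mk.injEq]
    refine ⟨?_, h0⟩
    revert h1
    cases o.up (h + 1, i) <;> cases o.up (h + 1, i + 1) <;> simp
  · intro hs
    have h0 := st.cap hs
    obtain ⟨sh, i⟩ := p
    obtain rfl : sh = .cap := hs
    have h1 := up _ _ (.cap i)
    simp only [End.point, End.isTop, ne_eq, not_true_eq_false, iff_false] at h1
    simp only [Color.rev, Color.mk.injEq]
    refine ⟨?_, h0⟩
    revert h1
    cases o.up (h, i) <;> cases o.up (h, i + 1) <;> simp
  · intro k hs
    obtain ⟨h0, h0'⟩ := st.cross k hs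
    obtain ⟨sh, i⟩ := p
    obtain rfl : sh = .cross k := hs
    have h1 := (up _ _ (.crossRight k i)).2 (by simp [End.isTop])
    have h2 := (up _ _ (.crossLeft k i)).2 (by simp [End.isTop])
    simp only [End.point] at h1 h2
    simp only [hp] at h0 h0'
    by_cases hk : k = .virt
    · simp only [hk, if_true, add_zero] at h0 h0'
      simp [Crossing.colorLeft, Crossing.colorRight, hk, h0, h0', h1, h2]
    · simp only [hk, if_false] at h0 h0'
      simp [Crossing.colorLeft, Crossing.colorRight, hk, h0, h0', h1, h2, sub_eq_add_neg]

/-- The colours of the points just below the `h`-th piece. -/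
def levelColors (w : Word Crossing) (col : ℕ × ℕ → Color) (h : ℕ) : List Color :=
  (List.range (width w h)).map fun j => col (h, j)

theorem ColorStep.pieceColors {n : ℕ} {p : Piece Crossing} {f g : ℕ → Color} (h : ColorStep p f g)
    {m : ℕ} (hm : p.pos + p.shape.ins ≤ m) :
    PieceColors n p.shape p.pos ((List.range m).map f)
      ((List.range (m - p.shape.ins + p.shape.outs)).map g) (pieceMark n p f) := by
  obtain ⟨r, rfl⟩ := Nat.exists_eq_add_of_le hm
  have e : p.pos + p.shape.ins + r - p.shape.ins + p.shape.outs = p.pos + p.shape.outs + r := by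
    omega
  rw [e]
  simp only [List.range_add, List.map_append, List.map_map, Function.comp_def, List.append_assoc]
  have h1 : (List.range p.pos).map g = (List.range p.pos).map f :=
    List.map_congr_left fun j hj => h.left j (List.mem_range.1 hj)
  have h2 : (List.range r).map (fun j => g (p.pos + p.shape.outs + j)) =
      (List.range r).map fun j => f (p.pos + p.shape.ins + j) :=
    List.map_congr_left fun j _ => h.right j
  rw [h1, h2]
  have hl : p.pos = ((List.range p.pos).map f).length + 0 := by simp
  have key := (pieceColors_append n p.shape ((List.range p.pos).map f)
    ((List.range p.shape.ins).map (fun j => f (p.pos + j)) ++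
      (List.range r).map fun j => f (p.pos + p.shape.ins + j))
    ((List.range p.pos).map f ++ ((List.range p.shape.outs).map (fun j => g (p.pos + j)) ++
      (List.range r).map fun j => f (p.pos + p.shape.ins + j))) 0 (pieceMark n p f)).2
    ⟨_, rfl, _, _, _, rfl, rfl, by
      obtain ⟨sh, i⟩ := p
      cases sh with
      | cup => simpa [Shape.ins, Shape.outs, pieceMark, List.range_succ, h.cup rfl] using
          ShapeColors.cup (n := n) (g i)
      | cap => simpa [Shape.ins, Shape.outs, pieceMark, List.range_succ, h.cap rfl] using
          ShapeColors.cap (n := n) (f i)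
      | cross k => simpa [Shape.ins, Shape.outs, pieceMark, List.range_succ, (h.cross k rfl).1,
          (h.cross k rfl).2] using ShapeColors.cross (n := n) k (f i) (f (i + 1))⟩
  rwa [← hl] at key

theorem PointColors.colors {w : Word Crossing} {col : ℕ × ℕ → Color} (hcol : PointColors w col)
    (hw : IsLinkDiagram w) (n : ℕ) : ∃ ms, Colors n [] w [] ms := by
  have key : ∀ h ≤ w.length, ∃ ms, Colors n [] (w.take h) (levelColors w col h) ms := by
    intro h
    induction h with
    | zero => exact fun _ => ⟨[], rfl, rfl⟩
    | succ h ih =>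
      intro hh
      obtain ⟨ms, hms⟩ := ih (by omega)
      have hp : w[h]? = some w[h] := List.getElem?_eq_getElem (by omega)
      have hstep := (hcol h _ hp).pieceColors (n := n) (pos_add_ins_le hw hp)
      rw [← width_succ w hp] at hstep
      rw [List.take_add_one, hp]
      exact ⟨_, (colors_append ..).2 ⟨_, ms, _, hms, ⟨_, _, _, hstep, ⟨rfl, rfl⟩, rfl⟩, rfl⟩⟩
  obtain ⟨ms, hms⟩ := key w.length le_rfl
  rw [List.take_length, levelColors, width_of_length_le hw le_rfl] at hms
  exact ⟨ms, hms⟩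

theorem PieceColors.colorStep {n : ℕ} {p : Piece Crossing} {s t : List Color} {μ : Bool × ℤ}
    (h : PieceColors n p.shape p.pos s t μ) (d : Color) :
    ColorStep p (fun j => s.getD j d) (fun j => t.getD j d) ∧
      μ = pieceMark n p (fun j => s.getD j d) := by
  obtain ⟨l, P, Q, r, rfl, rfl, hl, hs⟩ := h.exists_append
  obtain ⟨sh, i⟩ := p
  obtain rfl : l.length = i := hl
  have left : ∀ (u v : List Color), ∀ j < l.length, (l ++ u).getD j d = (l ++ v).getD j d := by
    intro u v j hj
    rw [List.getD_append _ _ _ _ hj, List.getD_append _ _ _ _ hj]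
  have mid : ∀ (u : List Color) (j : ℕ), (l ++ u).getD (l.length + j) d = u.getD j d := by
    intro u j
    rw [List.getD_append_right _ _ _ _ (by omega), Nat.add_sub_cancel_left]
  have mid0 : ∀ (u : List Color), (l ++ u).getD l.length d = u.getD 0 d := fun u => mid u 0
  have right : ∀ j, (l ++ (Q ++ r)).getD (l.length + sh.outs + j) d =
      (l ++ (P ++ r)).getD (l.length + sh.ins + j) d := by
    intro j
    rw [add_assoc, add_assoc, mid, mid, ← hs.length.1, ← hs.length.2,
      List.getD_append_right _ _ _ _ (by omega), List.getD_append_right _ _ _ _ (by omega),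
      Nat.add_sub_cancel_left, Nat.add_sub_cancel_left]
  refine ⟨⟨left _ _, right, ?_, ?_, ?_⟩, ?_⟩
  · rintro ⟨⟩
    cases hs
    simp only [mid, mid0]
    rfl
  · rintro ⟨⟩
    cases hs
    simp only [mid, mid0]
    rfl
  · rintro k ⟨⟩
    cases hs
    simp only [mid, mid0]
    exact ⟨rfl, rfl⟩
  · cases hs
    · rfl
    · rfl
    · simp only [pieceMark, mid, mid0]
      rfl

theorem Colors.exists_levels {n : ℕ} {w : Word Crossing} {s t : List Color}
    {ms : List (Bool × ℤ)} (h : Colors n s w t ms) : ∃ S : ℕ → List Color,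
      ∀ h p, w[h]? = some p → ∃ μ, ms[h]? = some μ ∧
        PieceColors n p.shape p.pos (S h) (S (h + 1)) μ := by
  suffices ∃ S : ℕ → List Color, S 0 = s ∧ ∀ h p, w[h]? = some p → ∃ μ, ms[h]? = some μ ∧
      PieceColors n p.shape p.pos (S h) (S (h + 1)) μ by
    obtain ⟨S, -, hS⟩ := this
    exact ⟨S, hS⟩
  induction w generalizing s ms with
  | nil => exact ⟨fun _ => s, rfl, fun h p hp => by simp at hp⟩
  | cons p w ih =>
    obtain ⟨q, μ, ms', h1, h2, rfl⟩ := h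
    obtain ⟨S, rfl, hS⟩ := ih h2
    refine ⟨fun h => Nat.casesOn h s S, rfl, fun h p' hp' => ?_⟩
    cases h with
    | zero =>
      obtain rfl : p = p' := by simpa using hp'
      exact ⟨μ, rfl, h1⟩
    | succ h => exact hS h p' (by simpa using hp')

theorem Colors.exists_pointColors {n : ℕ} {w : Word Crossing} {s t : List Color}
    {ms : List (Bool × ℤ)} (h : Colors n s w t ms) : ∃ col, PointColors w col ∧
      ∀ h p, w[h]? = some p → ms[h]? = some (pieceMark n p fun j => col (h, j)) := by
  obtain ⟨S, hS⟩ := h.exists_levels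
  -- Places beyond the last strand get one fixed colour, so `ColorStep.right` holds there too.
  refine ⟨fun x => (S x.1).getD x.2 ⟨true, 0⟩, fun h p hp => ?_, fun h p hp => ?_⟩
  · obtain ⟨μ, -, hμ⟩ := hS h p hp
    exact (hμ.colorStep _).1
  · obtain ⟨μ, h1, hμ⟩ := hS h p hp
    rw [h1, (hμ.colorStep ⟨true, 0⟩).2]

/-! ### The chord index in terms of colours -/

theorem sum_range_replace {u v : ℕ → ℤ} {m i a b : ℕ} (hm : i + a ≤ m)
    (left : ∀ j < i, v j = u j) (right : ∀ j, v (i + b + j) = u (i + a + j)) :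
    ∑ j ∈ Finset.range (m - a + b), v j - ∑ j ∈ Finset.range m, u j =
      ∑ j ∈ Finset.range b, v (i + j) - ∑ j ∈ Finset.range a, u (i + j) := by
  obtain ⟨r, rfl⟩ := Nat.exists_eq_add_of_le hm
  have e : i + a + r - a + b = i + b + r := by omega
  rw [e, Finset.sum_range_add, Finset.sum_range_add _ (i + a), Finset.sum_range_add _ i,
    Finset.sum_range_add _ i, Finset.sum_congr rfl fun j hj => left j (Finset.mem_range.1 hj),
    Finset.sum_congr rfl fun j _ => right j]
  ring

/-- The total flow of `u` out of the shape of a piece. -/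
def flux (p : Piece Crossing) (f g : ℕ → ℤ) : ℤ :=
  ∑ j ∈ Finset.range p.shape.outs, g (p.pos + j) - ∑ j ∈ Finset.range p.shape.ins, f (p.pos + j)

/-- A discrete divergence theorem: the flux of a piece is the change of the level sum of `u`, the
changes telescope, and a link diagram has no strands at its bottom and top. -/
theorem sum_flux {w : Word Crossing} (hw : IsLinkDiagram w) (u : ℕ × ℕ → ℤ) (F : ℕ → ℤ)
    (left : ∀ h p, w[h]? = some p → ∀ j < p.pos, u (h + 1, j) = u (h, j))
    (right : ∀ h p, w[h]? = some p → ∀ j,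
      u (h + 1, p.pos + p.shape.outs + j) = u (h, p.pos + p.shape.ins + j))
    (hF : ∀ h p, w[h]? = some p → F h = flux p (fun j => u (h, j)) fun j => u (h + 1, j)) :
    ∑ h ∈ Finset.range w.length, F h = 0 := by
  have hsum : ∀ h ∈ Finset.range w.length, F h =
      ∑ j ∈ Finset.range (width w (h + 1)), u (h + 1, j) -
        ∑ j ∈ Finset.range (width w h), u (h, j) := by
    intro h hh
    have hl : h < w.length := Finset.mem_range.1 hh
    have hp : w[h]? = some w[h] := List.getElem?_eq_getElem hl
    rw [hF h _ hp, width_succ w hp]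
    exact (sum_range_replace (u := fun j => u (h, j)) (v := fun j => u (h + 1, j))
      (pos_add_ins_le hw hp) (left h _ hp) (right h _ hp)).symm
  rw [Finset.sum_congr rfl hsum,
    Finset.sum_range_sub fun h => ∑ j ∈ Finset.range (width w h), u (h, j),
    width_of_length_le hw le_rfl]
  simp [width]

theorem flux_cup (i : ℕ) (f g : ℕ → ℤ) : flux (cup i) f g = g i + g (i + 1) := by
  simp [flux, Shape.ins, Shape.outs, Finset.sum_range_succ]

theorem flux_cap (i : ℕ) (f g : ℕ → ℤ) : flux (cap i) f g = -(f i + f (i + 1)) := by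
  simp [flux, Shape.ins, Shape.outs, Finset.sum_range_succ]

theorem flux_cross (k : Crossing) (i : ℕ) (f g : ℕ → ℤ) :
    flux (cross k i) f g = g i + g (i + 1) - (f i + f (i + 1)) := by
  simp [flux, Shape.ins, Shape.outs, Finset.sum_range_succ]

theorem upSign_mul_self (b : Bool) : upSign b * upSign b = 1 := by cases b <;> rfl

theorem Crossing.colorLeft_up (k : Crossing) (x y : Color) : (k.colorLeft x y).up = y.up := by
  unfold Crossing.colorLeft; split <;> rfl

theorem Crossing.colorRight_up (k : Crossing) (x y : Color) : (k.colorRight x y).up = x.up := by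
  unfold Crossing.colorRight; split <;> rfl

variable {K : KnotDiagram} {o : K.Orientation} {col : ℕ × ℕ → Color}

theorem smoothedArcs_of_ne {w : Word Crossing} {up : ℕ × ℕ → Bool} {c h : ℕ} (hc : h ≠ c)
    {e e' : End} : smoothedArcs w up c h e e' ↔ arcs w h e e' := by
  simp [smoothedArcs, hc]

theorem smoothedArcs_self {w : Word Crossing} {up : ℕ × ℕ → Bool} {c i : ℕ} {k : Crossing}
    (hc : w[c]? = some (cross k i)) {e e' : End} :
    smoothedArcs w up c c e e' ↔ SmoothedArc (up (c, i) == up (c, i + 1)) i e e' := by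
  simp [smoothedArcs, hc]

/-- A function that is constant along the strands of the diagram which is smoothed at `c`. -/
structure SmoothedInvariant (w : Word Crossing) (up : ℕ × ℕ → Bool) (c : ℕ) (χ : ℕ × ℕ → ℤ) :
    Prop where
  eq_of_arc : ∀ h e e', smoothedArcs w up c h e e' → χ (e.point h) = χ (e'.point h)

theorem SmoothedInvariant.left {w : Word Crossing} {up : ℕ × ℕ → Bool} {c : ℕ} {χ : ℕ × ℕ → ℤ}
    (hχ : SmoothedInvariant w up c χ) {k : Crossing} {i : ℕ} (hc : w[c]? = some (cross k i))
    {h : ℕ} {p : Piece Crossing} (hp : w[h]? = some p) {j : ℕ} (hj : j < p.pos) :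
    χ (h + 1, j) = χ (h, j) := by
  by_cases hh : h = c
  · subst hh
    obtain rfl := Option.some.inj (hp.symm.trans hc)
    simp only at hj
    exact (hχ.eq_of_arc h (.bot j) (.top j) ((smoothedArcs_self hc).2
      (.vertical j (Or.inr (by omega))))).symm
  · exact (hχ.eq_of_arc h (.bot j) (.top j) ((smoothedArcs_of_ne hh).2
      ⟨p, hp, .left p j hj⟩)).symm

theorem SmoothedInvariant.right {w : Word Crossing} {up : ℕ × ℕ → Bool} {c : ℕ} {χ : ℕ × ℕ → ℤ}
    (hχ : SmoothedInvariant w up c χ) {k : Crossing} {i : ℕ} (hc : w[c]? = some (cross k i))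
    {h : ℕ} {p : Piece Crossing} (hp : w[h]? = some p) (j : ℕ) :
    χ (h + 1, p.pos + p.shape.outs + j) = χ (h, p.pos + p.shape.ins + j) := by
  by_cases hh : h = c
  · subst hh
    obtain rfl := Option.some.inj (hp.symm.trans hc)
    exact (hχ.eq_of_arc h (.bot (i + 2 + j)) (.top (i + 2 + j)) ((smoothedArcs_self hc).2
      (.vertical _ (Or.inr (by omega))))).symm
  · exact (hχ.eq_of_arc h (.bot _) (.top _) ((smoothedArcs_of_ne hh).2
      ⟨p, hp, .right p j⟩)).symm

/-- The two components of the diagram that is smoothed at `c` are different. -/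
theorem exists_separating (hcol : PointColors K.word col)
    (hup : ∀ x, InDiagram K.word x → o.up x = (col x).up) {c i : ℕ} {k : Crossing}
    (hc : K.word[c]? = some (cross k i)) :
    ∃ τ, SmoothedInvariant K.word o.up c τ ∧
      (o.up (c, i) = o.up (c, i + 1) → τ (c, i) ≠ τ (c, i + 1)) ∧
      (o.up (c, i) ≠ o.up (c, i + 1) → τ (c, i) ≠ τ (c + 1, i)) := by
  have hle := pos_add_ins_le K.isClosed hc
  simp only [Shape.ins] at hle
  have u1 : o.up (c, i) = (col (c, i)).up := hup _ (by simp only [InDiagram]; omega)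
  have u2 : o.up (c, i + 1) = (col (c, i + 1)).up := hup _ (by simp only [InDiagram]; omega)
  -- Along the orientation `τ` increases by one on the strand through `c` that rises to the right on
  -- the page, decreases by one on the other, and is constant away from `c`.
  obtain ⟨τ, hτ⟩ := K.exists_potentialStep o
    (fun h => if h = c then upSign (o.up (h, i)) else 0)
    (fun h => if h = c then -upSign (o.up (h, i + 1)) else 0) (by
      intro h k' i' hp
      by_cases hh : h = c
      · subst hh
        obtain ⟨⟨⟩, rfl⟩ : k = k' ∧ i = i' := by
          have := hc.symm.trans hp
          simpa using this
        simp [upSign_mul_self]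
      · simp [hh])
  -- The flow of `τ` itself gives no information at `c`, but that of its square does. If the two
  -- strands come in with values `a` and `b` and go out with `a + 1` and `b - 1`, conservation
  -- forces `b = a + 1`. The oriented smoothing thus joins ends of equal value, and `τ` is `a` on
  -- one side of it and `a + 1` on the other.
  have hsq := sum_flux K.isClosed (fun x => upSign (col x).up * τ x ^ 2)
    (fun h => if h = c then flux (cross k i) (fun j => upSign (col (c, j)).up * τ (c, j) ^ 2)
      (fun j => upSign (col (c + 1, j)).up * τ (c + 1, j) ^ 2) else 0)
    (fun h p hp j hj => by
      have h1 : col (h + 1, j) = col (h, j) := (hcol h p hp).left j hj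
      have h2 : τ (h + 1, j) = τ (h, j) := (hτ h p hp).left j hj
      rw [h1, h2])
    (fun h p hp j => by
      have h1 : col (h + 1, p.pos + p.shape.outs + j) = col (h, p.pos + p.shape.ins + j) :=
        (hcol h p hp).right j
      have h2 : τ (h + 1, p.pos + p.shape.outs + j) = τ (h, p.pos + p.shape.ins + j) :=
        (hτ h p hp).right j
      rw [h1, h2])
    (fun h p hp => by
      by_cases hh : h = c
      · subst hh
        obtain rfl := Option.some.inj (hp.symm.trans hc)
        simp
      · have h1 := hcol h p hp
        have h2 := hτ h p hp
        simp only [hh, if_false] at h2 ⊢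
        obtain ⟨sh, i⟩ := p
        cases sh with
        | cup =>
          have e1 := h1.cup rfl
          have e2 := h2.cup rfl
          simp only at e1 e2
          rw [flux_cup]
          simp [e1, e2, Color.rev, upSign_not]
        | cap =>
          have e1 := h1.cap rfl
          have e2 := h2.cap rfl
          simp only at e1 e2
          rw [flux_cap]
          simp [e1, e2, Color.rev, upSign_not]
        | cross k =>
          obtain ⟨e1, e1'⟩ := h1.cross k rfl
          obtain ⟨e2, e2'⟩ := h2.cross k rfl
          simp only at e1 e2 e1' e2'
          rw [flux_cross]
          simp only [e1, e2, e1', e2', Crossing.colorLeft_up, Crossing.colorRight_up]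
          ring)
  have hcl : c < K.word.length := (List.getElem?_eq_some_iff.1 hc).1
  rw [Finset.sum_ite_eq' (Finset.range K.word.length) c (fun _ => _),
    if_pos (Finset.mem_range.2 hcl), flux_cross] at hsq
  obtain ⟨e1, e1'⟩ := (hcol c _ hc).cross k rfl
  have hτc := hτ c _ hc
  obtain ⟨e2, e2'⟩ := hτc.cross k rfl
  simp only [if_true] at e1 e2 e1' e2'
  simp only [e1, e1', Crossing.colorLeft_up, Crossing.colorRight_up, ← u1, ← u2] at hsq
  have hvert : o.up (c, i) = o.up (c, i + 1) →
      τ (c + 1, i) = τ (c, i) ∧ τ (c + 1, i + 1) = τ (c, i + 1) ∧ τ (c, i) ≠ τ (c, i + 1) := by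
    intro hpar
    rw [e2, e2'] at hsq ⊢
    rw [← hpar] at hsq ⊢
    revert hsq
    generalize o.up (c, i) = b
    cases b <;> simp only [upSign, if_true, Bool.false_eq_true, if_false] <;> intro hsq <;>
      refine ⟨by linarith, by linarith, fun h => ?_⟩ <;> rw [h] at hsq <;> linarith
  have hhor : o.up (c, i) ≠ o.up (c, i + 1) →
      τ (c, i) = τ (c, i + 1) ∧ τ (c + 1, i) = τ (c + 1, i + 1) ∧ τ (c, i) ≠ τ (c + 1, i) := by
    intro hanti
    rw [e2, e2'] at hsq ⊢
    revert hanti hsq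
    cases o.up (c, i) <;> cases o.up (c, i + 1) <;>
      simp only [upSign, if_true, Bool.false_eq_true, if_false, ne_eq, not_true_eq_false,
        false_imp_iff, imp_true_iff] <;>
      intro hsq _ <;> refine ⟨by linarith, by linarith, fun h => ?_⟩ <;> linarith
  refine ⟨τ, ⟨fun h e e' ha => ?_⟩, fun h => (hvert h).2.2, fun h => (hhor h).2.2⟩
  by_cases hh : h = c
  · subst hh
    rw [smoothedArcs_self hc] at ha
    cases ha with
    | vertical j hj =>
      simp only [End.point]
      by_cases j1 : j < i
      · exact (hτc.left j j1).symm
      by_cases j2 : i + 2 ≤ j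
      · obtain ⟨d, rfl⟩ := Nat.exists_eq_add_of_le j2
        exact (hτc.right d).symm
      have hpar : o.up (h, i) = o.up (h, i + 1) := by
        rcases hj with hj | hj
        · simpa using hj
        · omega
      obtain rfl | rfl : j = i ∨ j = i + 1 := by omega
      · exact (hvert hpar).1.symm
      · exact (hvert hpar).2.1.symm
    | below hj => exact (hhor (by simpa using hj)).1
    | above hj => exact (hhor (by simpa using hj)).2.1
  · rw [smoothedArcs_of_ne hh] at ha
    obtain ⟨p, hp, ha⟩ := ha
    have h2 := hτ h p hp
    simp only [hh, if_false] at h2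
    cases ha with
    | left _ j hj => exact (h2.left j hj).symm
    | right _ j => exact (h2.right j).symm
    | cup i => exact (h2.cup rfl).symm
    | cap i => exact (h2.cap rfl).symm
    | crossRight k i =>
      have := (h2.cross k rfl).2
      rw [add_zero] at this
      exact this.symm
    | crossLeft k i =>
      have := (h2.cross k rfl).1
      rw [add_zero] at this
      exact this.symm

theorem sign_eq_colorSign {w : Word Crossing} {up : ℕ × ℕ → Bool} {h i : ℕ} {k : Crossing}
    (hp : w[h]? = some (cross k i)) (h1 : up (h, i) = (col (h, i)).up)
    (h2 : up (h, i + 1) = (col (h, i + 1)).up) :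
    sign w up h = k.colorSign (col (h, i)) (col (h, i + 1)) := by
  cases k <;> simp [sign, hp, Crossing.colorSign, h1, h2]

theorem sign_of_not_isReal {w : Word Crossing} {up : ℕ × ℕ → Bool} {h : ℕ} (hr : ¬ IsReal w h) :
    sign w up h = 0 := by
  unfold sign
  split
  · exact absurd ⟨_, Or.inl ‹_›⟩ hr
  · exact absurd ⟨_, Or.inr ‹_›⟩ hr
  · rfl

-- When both strands of a crossing, or neither, lie on `K₁`, the difference of the indicators
-- vanishes; so the two filtered sums merge into one over all pieces other than `c`.
open Classical in
theorem chordIndex_eq_sum (w : Word Crossing) (up : ℕ × ℕ → Bool) (c : ℕ) :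
    chordIndex w up c = ∑ h ∈ Finset.range w.length, if h = c then 0 else sign w up h *
      ((if overPoint w h ∈ firstComponent w up c then 1 else 0) -
        if underPoint w h ∈ firstComponent w up c then 1 else 0) := by
  rw [chordIndex, Finset.sum_filter, Finset.sum_filter, ← Finset.sum_sub_distrib]
  refine Finset.sum_congr rfl fun h _ => ?_
  by_cases hh : h = c
  · simp [hh]
  by_cases hr : IsReal w h
  · by_cases ho : overPoint w h ∈ firstComponent w up c <;>
      by_cases hu : underPoint w h ∈ firstComponent w up c <;> simp [hh, hr, ho, hu]
  · simp [hr, sign_of_not_isReal hr]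

/-- The flow of the labels on one component out of a crossing. -/
theorem flux_label {w : Word Crossing} {up : ℕ × ℕ → Bool} {k : Crossing} {h i : ℕ}
    (hp : w[h]? = some (cross k i)) (h1 : up (h, i) = (col (h, i)).up)
    (h2 : up (h, i + 1) = (col (h, i + 1)).up) {χ : ℕ × ℕ → ℤ}
    (hcol : ColorStep (cross k i) (fun j => col (h, j)) fun j => col (h + 1, j))
    (hl : χ (h + 1, i) = χ (h, i + 1)) (hr : χ (h + 1, i + 1) = χ (h, i)) :
    flux (cross k i) (fun j => χ (h, j) * (upSign (col (h, j)).up * (col (h, j)).label))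
      (fun j => χ (h + 1, j) * (upSign (col (h + 1, j)).up * (col (h + 1, j)).label)) =
    sign w up h * (χ (overPoint w h) - χ (underPoint w h)) := by
  obtain ⟨e1, e2⟩ := hcol.cross k rfl
  simp only at e1 e2
  rw [flux_cross]
  simp only [e1, e2, hl, hr, Crossing.colorLeft_up, Crossing.colorRight_up,
    sign_eq_colorSign hp h1 h2]
  obtain ⟨u, a⟩ := col (h, i)
  obtain ⟨v, b⟩ := col (h, i + 1)
  cases k <;> cases u <;> cases v <;>
    simp [Crossing.colorLeft, Crossing.colorRight, Crossing.colorSign, overPoint, underPoint, hp,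
      upSign] <;> ring

theorem underOut_cases (w : Word Crossing) (up : ℕ × ℕ → Bool) {c i : ℕ} {k : Crossing}
    (hc : w[c]? = some (cross k i)) :
    underOut w up c = (c, i) ∨ underOut w up c = (c, i + 1) ∨
      underOut w up c = (c + 1, i) ∨ underOut w up c = (c + 1, i + 1) := by
  unfold underOut underPoint underPointAbove
  cases k <;> simp only [hc] <;> split <;> simp

/-- The flow of the labels along `K₁` has total flux zero. Crossings other than `c` contribute the
chord index (`flux_label`), so the index is minus the flux at `c`, a difference of two labels there.
The sign depends on which of the two smoothed strands belongs to `K₁`. -/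
theorem chordIndex_eq_gap (hcol : PointColors K.word col)
    (hup : ∀ x, InDiagram K.word x → o.up x = (col x).up) {c i : ℕ} {k : Crossing}
    (hc : K.word[c]? = some (cross k i)) (hk : k ≠ .virt) :
    chordIndex K.word o.up c = gap (col (c, i)) (col (c, i + 1)) ∨
      chordIndex K.word o.up c = -gap (col (c, i)) (col (c, i + 1)) := by
  classical
  obtain ⟨τ, hτ, hτ1, hτ2⟩ := exists_separating hcol hup hc
  have hle := pos_add_ins_le K.isClosed hc
  simp only [Shape.ins] at hle
  have u1 : o.up (c, i) = (col (c, i)).up := hup _ (by simp only [InDiagram]; omega)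
  have u2 : o.up (c, i + 1) = (col (c, i + 1)).up := hup _ (by simp only [InDiagram]; omega)
  set K₁ := firstComponent K.word o.up c with hK
  let χ : ℕ × ℕ → ℤ := fun x => if x ∈ K₁ then 1 else 0
  have hχ : SmoothedInvariant K.word o.up c χ := by
    refine ⟨fun h e e' ha => ?_⟩
    have : e.point h ∈ K₁ ↔ e'.point h ∈ K₁ :=
      ⟨fun hx => hx.trans _ _ _ (.rel _ _ ⟨h, e, e', ha, rfl, rfl⟩),
        fun hx => hx.trans _ _ _ (.symm _ _ (.rel _ _ ⟨h, e, e', ha, rfl, rfl⟩))⟩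
    simp only [χ, this]
  have hτK : ∀ x ∈ K₁, τ x = τ (underOut K.word o.up c) := by
    have : ∀ x y, SameComponent (smoothedArcs K.word o.up c) x y → τ x = τ y := by
      intro x y hxy
      induction hxy with
      | rel x y h =>
        obtain ⟨h, e, e', ha, rfl, rfl⟩ := h
        exact hτ.eq_of_arc h e e' ha
      | refl => rfl
      | symm _ _ _ ih => exact ih.symm
      | trans _ _ _ _ _ ih ih' => exact ih.trans ih'
    exact fun x hx => (this _ _ hx).symm
  have hflux := sum_flux K.isClosed (fun x => χ x * (upSign (col x).up * (col x).label))
    (fun h => (if h = c then 0 else sign K.word o.up h *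
      (χ (overPoint K.word h) - χ (underPoint K.word h))) +
      if h = c then flux (cross k i)
        (fun j => χ (c, j) * (upSign (col (c, j)).up * (col (c, j)).label))
        (fun j => χ (c + 1, j) * (upSign (col (c + 1, j)).up * (col (c + 1, j)).label)) else 0)
    (fun h p hp j hj => by
      have h1 : col (h + 1, j) = col (h, j) := (hcol h p hp).left j hj
      rw [h1, hχ.left hc hp hj])
    (fun h p hp j => by
      have h1 : col (h + 1, p.pos + p.shape.outs + j) = col (h, p.pos + p.shape.ins + j) :=
        (hcol h p hp).right j
      rw [h1, hχ.right hc hp j])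
    (fun h p hp => by
      by_cases hh : h = c
      · subst hh
        obtain rfl := Option.some.inj (hp.symm.trans hc)
        simp
      · have h1 := hcol h p hp
        have hle' := pos_add_ins_le K.isClosed hp
        have harc : ∀ e e', p.Arc e e' → χ (e.point h) = χ (e'.point h) := fun e e' ha =>
          hχ.eq_of_arc h e e' ((smoothedArcs_of_ne hh).2 ⟨p, hp, ha⟩)
        simp only [hh, if_false, add_zero]
        obtain ⟨sh, i⟩ := p
        cases sh with
        | cup =>
          have e1 := h1.cup rfl
          have e2 := harc _ _ (.cup i)
          simp only [End.point] at e1 e2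
          rw [flux_cup]
          simp [e1, e2, Color.rev, upSign_not, sign, hp]
        | cap =>
          have e1 := h1.cap rfl
          have e2 := harc _ _ (.cap i)
          simp only [End.point] at e1 e2
          rw [flux_cap]
          simp [e1, e2, Color.rev, upSign_not, sign, hp]
        | cross k =>
          simp only [Shape.ins] at hle'
          exact (flux_label hp (hup _ (by simp only [InDiagram]; omega))
            (hup _ (by simp only [InDiagram]; omega)) h1 (harc _ _ (.crossLeft k i)).symm
            (harc _ _ (.crossRight k i)).symm).symm)
  have hcl : c < K.word.length := (List.getElem?_eq_some_iff.1 hc).1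
  rw [Finset.sum_add_distrib, Finset.sum_ite_eq' (Finset.range K.word.length) c (fun _ => _),
    if_pos (Finset.mem_range.2 hcl), flux_cross] at hflux
  have hidx : chordIndex K.word o.up c = _ := chordIndex_eq_sum K.word o.up c
  rw [← hidx] at hflux
  obtain ⟨e1, e2⟩ := (hcol c _ hc).cross k rfl
  simp only at e1 e2
  have hmem : ∀ x, χ x = 1 → τ x = τ (underOut K.word o.up c) := by
    intro x hx
    refine hτK x ?_
    by_contra hn
    simp [χ, hn] at hx
  have h01 : ∀ x, χ x = 0 ∨ χ x = 1 := by
    intro x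
    by_cases hx : x ∈ K₁ <;> simp [χ, hx]
  have hout : χ (underOut K.word o.up c) = 1 := if_pos (Relation.EqvGen.refl _)
  have hcases := underOut_cases K.word o.up hc
  clear_value χ
  by_cases hpar : o.up (c, i) = o.up (c, i + 1)
  · have a1 := hχ.eq_of_arc c _ _ ((smoothedArcs_self hc).2 (.vertical i (Or.inl (by simpa))))
    have a2 := hχ.eq_of_arc c _ _ ((smoothedArcs_self hc).2 (.vertical (i + 1) (Or.inl (by simpa))))
    simp only [End.point] at a1 a2
    -- `τ` is constant on `K₁` and differs on the two smoothed strands, so exactly one of them lies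
    -- on `K₁`.
    have hne : ¬ (χ (c, i) = 1 ∧ χ (c, i + 1) = 1) := fun h =>
      hτ1 hpar ((hmem _ h.1).trans (hmem _ h.2).symm)
    have hone : χ (c, i) = 1 ∨ χ (c, i + 1) = 1 := by
      rcases hcases with e | e | e | e <;> rw [e] at hout
      exacts [Or.inl hout, Or.inr hout, Or.inl (a1.trans hout), Or.inr (a2.trans hout)]
    rw [← a1, ← a2, e1, e2] at hflux
    rw [u1, u2] at hpar
    revert hpar hflux
    obtain ⟨u, a⟩ := col (c, i)
    obtain ⟨v, b⟩ := col (c, i + 1)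
    rcases h01 (c, i) with h1 | h1 <;> rcases h01 (c, i + 1) with h2 | h2 <;>
      simp only [h1, h2] at hne hone ⊢ <;> simp at hne hone <;>
      cases u <;> cases v <;>
      simp [gap, Crossing.colorLeft, Crossing.colorRight, hk, upSign] <;> intro hflux <;> omega
  · have a1 := hχ.eq_of_arc c _ _ ((smoothedArcs_self hc).2 (.below (by simpa)))
    have a2 := hχ.eq_of_arc c _ _ ((smoothedArcs_self hc).2 (.above (by simpa)))
    simp only [End.point] at a1 a2
    -- For antiparallel strands the smoothing is a maximum below a minimum, so one point below and
    -- one above `c` represent the two smoothed strands.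
    have hne : ¬ (χ (c, i) = 1 ∧ χ (c + 1, i) = 1) := fun h =>
      hτ2 hpar ((hmem _ h.1).trans (hmem _ h.2).symm)
    have hone : χ (c, i) = 1 ∨ χ (c + 1, i) = 1 := by
      rcases hcases with e | e | e | e <;> rw [e] at hout
      exacts [Or.inl hout, Or.inl (a1.trans hout), Or.inr hout, Or.inr (a2.trans hout)]
    rw [← a1, ← a2, e1, e2] at hflux
    rw [u1, u2] at hpar
    revert hpar hflux
    obtain ⟨u, a⟩ := col (c, i)
    obtain ⟨v, b⟩ := col (c, i + 1)
    rcases h01 (c, i) with h1 | h1 <;> rcases h01 (c + 1, i) with h2 | h2 <;>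
      simp only [h1, h2] at hne hone ⊢ <;> simp at hne hone <;>
      cases u <;> cases v <;>
      simp [gap, Crossing.colorLeft, Crossing.colorRight, hk, upSign] <;> intro hflux <;> omega

end VirtualKnots

namespace VirtualKnots

/-! ### Invariance -/

/-- The colour of a strand after its orientation and its label are reversed. -/
def Color.flip (x : Color) : Color := ⟨!x.up, -x.label⟩

theorem gap_flip (x y : Color) : gap x.flip y.flip = -gap x y := by
  obtain ⟨u, a⟩ := x
  obtain ⟨v, b⟩ := y
  cases u <;> cases v <;> simp [gap, Color.flip] <;> ring

theorem Crossing.colorLeft_flip (k : Crossing) (x y : Color) :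
    k.colorLeft x.flip y.flip = (k.colorLeft x y).flip := by
  obtain ⟨u, a⟩ := x
  unfold Crossing.colorLeft
  split
  · rfl
  · cases u <;> simp [Color.flip, upSign] <;> ring

theorem Crossing.colorRight_flip (k : Crossing) (x y : Color) :
    k.colorRight x.flip y.flip = (k.colorRight x y).flip := by
  obtain ⟨u, a⟩ := y
  unfold Crossing.colorRight
  split
  · rfl
  · cases u <;> simp [Color.flip, upSign] <;> ring

theorem PointColors.flip {w : Word Crossing} {col : ℕ × ℕ → Color} (hcol : PointColors w col) :
    PointColors w fun x => (col x).flip := by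
  intro h p hp
  have hs := hcol h p hp
  refine ⟨fun j hj => congrArg _ (hs.left j hj), fun j => congrArg _ (hs.right j),
    fun he => (congrArg _ (hs.cup he)).trans rfl, fun he => (congrArg _ (hs.cap he)).trans rfl,
    fun k he => ?_⟩
  rw [k.colorLeft_flip, k.colorRight_flip]
  exact ⟨congrArg _ (hs.cross k he).1, congrArg _ (hs.cross k he).2⟩

theorem pieceMark_flip (n : ℕ) (p : Piece Crossing) (f : ℕ → Color) :
    pieceMark n p (fun j => (f j).flip) = pieceMark n p f := by
  obtain ⟨_ | _ | k, i⟩ := p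
  · rfl
  · rfl
  · refine Prod.ext (Crossing.mark_congr Iff.rfl fun _ => Or.inr (gap_flip _ _)) ?_
    cases k <;> simp [pieceMark, Crossing.colorSign, Color.flip]

/-- The orientation of a coloured diagram. -/
def PointColors.orientation {K : KnotDiagram} {col : ℕ × ℕ → Color}
    (hcol : PointColors K.word col) : K.Orientation where
  up x := (col x).up
  compatible h e e' ha := by
    obtain ⟨p, hp, ha⟩ := ha
    have hs := hcol h p hp
    cases ha with
    | left _ j hj =>
      have := hs.left j hj
      simp [End.point, End.isTop, this]
    | right _ j =>
      have := hs.right j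
      simp [End.point, End.isTop, this]
    | cup i =>
      have := hs.cup rfl
      simp only at this
      simp [End.point, End.isTop, this, Color.rev]
    | cap i =>
      have := hs.cap rfl
      simp only at this
      simp [End.point, End.isTop, this, Color.rev]
    | crossRight k i =>
      have := (hs.cross k rfl).2
      simp only at this
      simp [End.point, End.isTop, this, Crossing.colorRight_up]
    | crossLeft k i =>
      have := (hs.cross k rfl).1
      simp only at this
      simp [End.point, End.isTop, this, Crossing.colorLeft_up]

/-- Whether two orientations agree does not change along an arc, and a knot is connected. Away from
the points of the diagram their values are unrelated. -/
theorem KnotDiagram.Orientation.eq_or_eq_not {K : KnotDiagram} (o o' : K.Orientation) :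
    (∀ x, InDiagram K.word x → o.up x = o'.up x) ∨
      ∀ x, InDiagram K.word x → o.up x = !o'.up x := by
  have key : ∀ x y, SameComponent (arcs K.word) x y →
      (o.up x = o'.up x ↔ o.up y = o'.up y) := by
    intro x y hxy
    induction hxy with
    | rel x y h =>
      obtain ⟨h, e, e', ha, rfl, rfl⟩ := h
      have h1 := (o.compatible h e e' ha).trans (o'.compatible h e e' ha).symm
      revert h1
      generalize o.up (e.point h) = a, o.up (e'.point h) = b, o'.up (e.point h) = c,
        o'.up (e'.point h) = d
      revert a b c d
      decide
    | refl => exact Iff.rfl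
    | symm _ _ _ ih => exact ih.symm
    | trans _ _ _ _ _ ih ih' => exact ih.trans ih'
  by_cases hex : ∃ x, InDiagram K.word x ∧ o.up x ≠ o'.up x
  · obtain ⟨x, hx, hne⟩ := hex
    refine Or.inr fun y hy => ?_
    have := mt (key x y (K.connected x y hx hy)).2 hne
    revert this
    cases o.up y <;> cases o'.up y <;> simp
  · push Not at hex
    exact Or.inl hex

open Classical in
theorem pieceMark_eq {K : KnotDiagram} {o : K.Orientation} {col : ℕ × ℕ → Color}
    (hcol : PointColors K.word col) (hup : ∀ x, InDiagram K.word x → o.up x = (col x).up)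
    {h : ℕ} {p : Piece Crossing} (hp : K.word[h]? = some p) (n : ℕ) :
    pieceMark n p (fun j => col (h, j)) =
      (decide (h ∈ indexedCrossings n K.word o.up), sign K.word o.up h) := by
  have hl : h < K.word.length := (List.getElem?_eq_some_iff.1 hp).1
  have hC : h ∈ indexedCrossings n K.word o.up ↔
      IsReal K.word h ∧ (n : ℤ) ∣ chordIndex K.word o.up h := by
    simp [indexedCrossings, hl]
  by_cases hr : IsReal K.word h
  · obtain ⟨k, i, hk, rfl⟩ : ∃ k i, k ≠ .virt ∧ p = cross k i := by
      obtain ⟨i, e | e⟩ := hr <;> rw [hp, Option.some.injEq] at e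
      exacts [⟨.slash, i, by decide, e⟩, ⟨.backslash, i, by decide, e⟩]
    have hle := pos_add_ins_le K.isClosed hp
    simp only [Shape.ins] at hle
    refine Prod.ext ?_ (sign_eq_colorSign hp (hup _ (by simp only [InDiagram]; omega))
      (hup _ (by simp only [InDiagram]; omega))).symm
    simp only [pieceMark, Crossing.mark, hC, hr, true_and, hk, ne_eq, not_false_eq_true]
    rcases chordIndex_eq_gap hcol hup hp hk with e | e <;> rw [e]
    rw [decide_eq_decide, dvd_neg]
  · rw [sign_of_not_isReal hr, decide_eq_false fun hm => hr (hC.1 hm).1]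
    obtain ⟨_ | _ | _ | _ | _, i⟩ := p
    · rfl
    · rfl
    · rfl
    · exact absurd ⟨_, Or.inl hp⟩ hr
    · exact absurd ⟨_, Or.inr hp⟩ hr

/-- The orientation carried by the colouring is `o` or its reverse. In the second case the colours
are flipped, which preserves all marks and signs; then `pieceMark_eq` identifies these with the
crossings of `indexedCrossings` and their signs. -/
theorem Colors.graphicalJones_eq {n : ℕ} {K : KnotDiagram} {ms : List (Bool × ℤ)}
    (hc : Colors n [] K.word [] ms) (o : K.Orientation) :
    graphicalJones n K o = evalWord (stateSum K.word ms) := by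
  classical
  obtain ⟨col, hcol, hms⟩ := hc.exists_pointColors
  obtain ⟨col', hcol', hup, hmark⟩ : ∃ col', PointColors K.word col' ∧
      (∀ x, InDiagram K.word x → o.up x = (col' x).up) ∧
      ∀ h p, pieceMark n p (fun j => col (h, j)) = pieceMark n p fun j => col' (h, j) := by
    rcases o.eq_or_eq_not hcol.orientation with e | e
    · exact ⟨col, hcol, e, fun _ _ => rfl⟩
    · exact ⟨_, hcol.flip, e, fun h p => (pieceMark_flip n p _).symm⟩
  rw [VirtualKnots.graphicalJones_eq]
  congr 2
  refine List.ext_getElem? fun h => ?_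
  by_cases hl : h < K.word.length
  · have hp : K.word[h]? = some K.word[h] := List.getElem?_eq_getElem hl
    rw [hms h _ hp, hmark, pieceMark_eq hcol' hup hp n]
    simp [hl]
  · rw [List.getElem?_eq_none (by simpa using hl),
      List.getElem?_eq_none (by rw [hc.length_eq]; exact not_lt.1 hl)]

/-- Both sides compute the invariant for one and the same orientation, which the first colouring
provides. -/
theorem Colors.evalWord_eq {n : ℕ} {K : KnotDiagram} {ms ms' : List (Bool × ℤ)}
    (hc : Colors n [] K.word [] ms) (hc' : Colors n [] K.word [] ms') :
    evalWord (stateSum K.word ms) = evalWord (stateSum K.word ms') := by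
  obtain ⟨col, hcol, -⟩ := hc.exists_pointColors
  exact (hc.graphicalJones_eq hcol.orientation).symm.trans (hc'.graphicalJones_eq hcol.orientation)

/-- No orientations are given on the intermediate diagrams, so the existence of colourings is
carried along the chain together with the equality of values, in both directions because moves may
be inverted. -/
theorem KnotDiagram.Equivalent.exists_colors {K K' : KnotDiagram} (h : K.Equivalent K') (n : ℕ) :
    ((∃ ms, Colors n [] K.word [] ms) ↔ ∃ ms', Colors n [] K'.word [] ms') ∧
      ∀ ms ms', Colors n [] K.word [] ms → Colors n [] K'.word [] ms' →
        evalWord (stateSum K.word ms) = evalWord (stateSum K'.word ms') := by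
  induction h with
  | rel K K' h =>
    refine ⟨⟨fun ⟨ms, hc⟩ => ?_, fun ⟨ms', hc⟩ => h.exists_colors K.isClosed hc⟩,
      fun ms ms' hc hc' => ?_⟩
    · obtain ⟨ms', hc', -⟩ := h.colors hc
      exact ⟨ms', hc'⟩
    · obtain ⟨ms₁, hc₁, e⟩ := h.colors hc
      exact e.trans (hc₁.evalWord_eq hc')
  | refl K => exact ⟨Iff.rfl, fun _ _ => Colors.evalWord_eq⟩
  | symm _ _ _ ih => exact ⟨ih.1.symm, fun ms ms' hc hc' => (ih.2 ms' ms hc' hc).symm⟩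
  | trans _ _ _ _ _ ih ih' =>
    refine ⟨ih.1.trans ih'.1, fun ms ms' hc hc' => ?_⟩
    obtain ⟨ms₁, hc₁⟩ := ih.1.1 ⟨ms, hc⟩
    exact (ih.2 _ _ hc hc₁).trans (ih'.2 _ _ hc₁ hc')

end VirtualKnots

/-- For every natural number `n`, the graphical indexed Jones polynomial of index `n` is an
invariant of virtual knots: it takes the same value for any two equivalent virtual knot diagrams,
whichever way these are oriented. -/
theorem theorem4p4 (n : ℕ) (K K' : VirtualKnots.KnotDiagram) (h : K.Equivalent K')
    (o : K.Orientation) (o' : K'.Orientation) :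
    VirtualKnots.graphicalJones n K o = VirtualKnots.graphicalJones n K' o' := by
  obtain ⟨col, hcol⟩ := VirtualKnots.exists_pointColors K o
  obtain ⟨ms, hc⟩ := hcol.colors K.isClosed n
  obtain ⟨h1, h2⟩ := h.exists_colors n
  obtain ⟨ms', hc'⟩ := h1.1 ⟨ms, hc⟩
  rw [hc.graphicalJones_eq, hc'.graphicalJones_eq, h2 _ _ hc hc']
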